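/- **Setting.** Let $G$ be an infinite, connected, locally finite graph on a countable vertex set $\mathbb V$, with graph distance $\mathrm{dist}$ and balls $\mathbb V_{v,r}=\{u:\mathrm{dist}(u,v)\le r\}$ ($\mathbb V_{v,-1}=\emptyset$), and let $\Gamma$ be a group acting on $\mathbb V$ by automorphisms of $G$ with finitely many orbits. Put $B(r)=\max_{v}|\mathbb V_{v,r}|$. For any set $A$, let $\Gamma$ act on $A^{\mathbb V}$ by $(\gamma\omega)_v=\omega_{\gamma^{-1}v}$. Assume the sphere condition $$\mathbb V_{v,r}\setminus\mathbb V_{v,r-1}\not\subset\mathbb V_{u,r}\qquad\text{for all distinct }u,v\in\mathbb V\text{ and all integers }r\ge0 .$$ Let $S$ be a non-empty finite totally ordered set with maximum $+$ and minimum $-$. Let $\boldsymbol\pm\in S^{\mathbb V}$ be the constant configurations, let $S^{\mathbb V}$ carry the coordinatewise partial order, let $\Omega^{\pm}$ be the set of configurations equal to $\boldsymbol\pm$ off a finite set, and let $\Omega_V^\tau$ be the set of configurations equal to $\tau$ off $V$. An *upwards-downwards specification* is a family $\rho=(\rho_V^\tau)$, indexed by finite $V\subset\mathbb V$ and $\tau\in\Omega^+\cup\Omega^-$,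 of probability measures $\rho_V^\tau$ supported on $\Omega_V^\tau$, such that $\rho_V^\tau=\rho_V^{\tau'}$ whenever $\tau=\tau'$ off $V$, and $\rho_V^\tau(\,\cdot\mid\Omega_U^\tau)=\rho_U^\tau$ whenever $U\subset V$ and $\rho_V^\tau(\Omega_U^\tau)>0$. Assume that $\rho$ is: * *monotone*: $\rho_V^\tau(A)\le\rho_V^{\tau'}(A)$ for every finite $V$, all $\tau\le\tau'$ in $\Omega^+\cup\Omega^-$ and every increasing event $A$; * *$\Gamma$-invariant*: $\rho_{\gamma V}^{\gamma\tau}(\gamma^{-1}\omega\in\cdot)=\rho_V^\tau$ for all $\gamma\in\Gamma$, finite $V$ and $\tau\in\Omega^+\cup\Omega^-$; * *irreducible*: for every finite $V$ and each of the two signs, $\{\omega:\rho_V^{\boldsymbol\pm}(\omega)>0\}$ contains $\boldsymbol\pm$ and is connected in the Hamming graph (configurations are adjacent when they differ at exactly one site); * *marginally-finite*: the laws $\rho_{\{v\}}^\tau(\sigma_v\in\cdot)$, for $v\in\mathbb V$ and $\tau\in\Omega^+\cup\Omega^-$, form a finite set of distinct measures. For a finite set $\tilde T$, an *i.i.d.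 process* is $Y=(Y_v(n))_{v\in\mathbb V,n\in\mathbb N}$ with independent identically distributed $\tilde T$-valued coordinates. A *coding* from $Y$ to a measure $\mu$ on $S^{\mathbb V}$ is a measurable map $\varphi:(\tilde T^{\mathbb N})^{\mathbb V}\to S^{\mathbb V}$ such that $\varphi(Y)$ has law $\mu$ and $\varphi$ commutes with $\Gamma$ on a $\Gamma$-invariant set of full measure. Its *space-time coding radius* $R^*_v(y)\in\mathbb N\cup\{\infty\}$ is the least $r$ such that $\varphi(y')_v=\varphi(y)_v$ for every $y'$ with $y'_w(i)=y_w(i)$ for all $w\in\mathbb V_{v,r}$ and $0\le i\le r$; write $R^*_v=R^*_v(Y)$. The coding is *space-time finitary* if $R^*_v<\infty$ almost surely for every $v$. **Theorem.** The weak limits $\mu^{\pm}=\lim_{V\uparrow\mathbb V}\rho_V^{\boldsymbol\pm}$ (for the product of the discrete topologies) exist and are probability measures, and: 1. If $\mu^+=\mu^-$, then there is a space-time finitary coding from some i.i.d. process with finite-valued coordinates to $\mu^+$. 2. Suppose weak spatial mixing holds: there are $C,c>0$ with $$\big\|\rho^{\boldsymbol+}_{\mathbb V_{v,r}}(\sigma_v\in\cdot)-\rho^{\boldsymbol-}_{\mathbb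 V_{v,r}}(\sigma_v\in\cdot)\big\|_{TV}\le Ce^{-cr}\qquad\text{for all }v\in\mathbb V,\ r\ge0 .$$ Then there is a space-time finitary coding from some i.i.d. process with finite-valued coordinates to $\mu^+$ such that: * if $B(r)=\exp(o(r))$ as $r\to\infty$, then its space-time coding radius beats any stretched exponential: $\Pr(R^*_v\ge r)\le\exp(-r^{1-o(1)})$ as $r\to\infty$, uniformly in $v$; * if $B(r)=\exp\big(o(\tfrac r{\log r})\big)$ as $r\to\infty$, then its space-time coding radius has exponential tails: there are $C',c'>0$ with $\Pr(R^*_v\ge r)\le C'e^{-c'r}$ for all $v\in\mathbb V$ and $r\ge0$. -/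

import Mathlib

open Filter Topology MeasureTheory Asymptotics

namespace SpaceTimeCoding

noncomputable section

/-! ### Balls, spheres and growth of a graph -/

/-- The closed ball of radius `r` around `v` in the graph distance. -/
def closedBall {V : Type*} (G : SimpleGraph V) (v : V) (r : ℕ) : Set V :=
  {u | G.edist v u ≤ r}

/-- The sphere of radius `r` around `v`: the ball of radius `r` without the ball of
radius `r - 1` (the latter being empty for `r = 0`). -/
def sphere {V : Type*} (G : SimpleGraph V) (v : V) (r : ℕ) : Set V :=
  {u | G.edist v u = r}

/-- Every vertex has finitely many neighbours. -/
def IsLocallyFinite {V : Type*} (G : SimpleGraph V) : Prop :=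
  ∀ v, (G.neighborSet v).Finite

theorem closedBall_finite {V : Type*} {G : SimpleGraph V} (hG : IsLocallyFinite G) (v : V)
    (r : ℕ) : (closedBall G v r).Finite := by
  induction r with
  | zero =>
    refine (Set.finite_singleton v).subset fun u hu => ?_
    have h0 : G.edist v u = 0 := by
      have hu' : G.edist v u ≤ ((0 : ℕ) : ℕ∞) := hu
      exact le_antisymm (by exact_mod_cast hu') bot_le
    rw [SimpleGraph.edist_eq_zero_iff] at h0
    exact h0.symm
  | succ r ih =>
    refine (ih.union (ih.biUnion fun w _ => hG w)).subset fun u hu => ?_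
    have hu' : G.edist v u ≤ ((r + 1 : ℕ) : ℕ∞) := hu
    have hne : G.edist v u ≠ ⊤ := ne_top_of_le_ne_top (ENat.natCast_ne_top _) hu'
    obtain ⟨p, hp⟩ := SimpleGraph.exists_walk_of_edist_ne_top hne
    rw [← hp] at hu'
    have hlen : p.length ≤ r + 1 := by exact_mod_cast hu'
    by_cases hle : p.length ≤ r
    · left
      exact (SimpleGraph.edist_le p).trans (by exact_mod_cast hle)
    · right
      have hnil : ¬ p.Nil := by
        intro h
        have := SimpleGraph.Walk.length_eq_zero_iff.mpr h
        omega
      refine Set.mem_biUnion (x := p.penultimate) ?_ (p.adj_penultimate hnil)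
      have h1 : p.dropLast.length ≤ r := by
        have := SimpleGraph.Walk.length_dropLast_add_one hnil
        omega
      exact (SimpleGraph.edist_le p.dropLast).trans (by exact_mod_cast h1)

/-- The ball of radius `r` around `v` as a finite set. -/
def ballFinset {V : Type*} {G : SimpleGraph V} (hG : IsLocallyFinite G) (v : V) (r : ℕ) :
    Finset V :=
  (closedBall_finite hG v r).toFinset

/-- The growth function `B(r)`: the largest cardinality of a ball of radius `r`. (On a
locally finite quasi-transitive graph the cardinalities are bounded.) -/
def growth {V : Type*} (G : SimpleGraph V) (r : ℕ) : ℕ :=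
  ⨆ v, (closedBall G v r).ncard

/-- No sphere is contained in the ball of the same radius around another vertex. -/
def SphereCondition {V : Type*} (G : SimpleGraph V) : Prop :=
  ∀ u v : V, u ≠ v → ∀ r : ℕ, ¬ sphere G v r ⊆ closedBall G u r

/-- `Γ` acts by automorphisms of `G`. -/
def ActsByAutomorphisms (Γ : Type*) {V : Type*} [Group Γ] [MulAction Γ V]
    (G : SimpleGraph V) : Prop :=
  ∀ (γ : Γ) (u v : V), G.Adj (γ • u) (γ • v) ↔ G.Adj u v

/-- The action of `Γ` on `V` has finitely many orbits. -/
def QuasiTransitive (Γ V : Type*) [Group Γ] [MulAction Γ V] : Prop :=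
  Finite (MulAction.orbitRel.Quotient Γ V)

/-! ### Configurations -/

/-- The action of a group on configurations, `(γ ω)_v = ω_{γ⁻¹ v}`. -/
def translate {Γ V A : Type*} [Group Γ] [MulAction Γ V] (γ : Γ) (ω : V → A) : V → A :=
  fun v => ω (γ⁻¹ • v)

/-- The image of a finite set of vertices under a group element. -/
def translateFinset {Γ V : Type*} [Group Γ] [MulAction Γ V] (γ : Γ) (Λ : Finset V) :
    Finset V :=
  Λ.map (MulAction.toPerm γ).toEmbedding

/-- Configurations agreeing with `⊤` outside a finite set. -/
def upConfig (V S : Type*) [Top S] : Set (V → S) := {ω | {v | ω v ≠ ⊤}.Finite}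

/-- Configurations agreeing with `⊥` outside a finite set. -/
def downConfig (V S : Type*) [Bot S] : Set (V → S) := {ω | {v | ω v ≠ ⊥}.Finite}

/-- The boundary conditions of an upwards-downwards specification. -/
def upDownConfig (V S : Type*) [Top S] [Bot S] : Set (V → S) :=
  upConfig V S ∪ downConfig V S

/-- Configurations that agree with `τ` outside `Λ`. -/
def agreeOff {V S : Type*} (Λ : Finset V) (τ : V → S) : Set (V → S) :=
  {ω | ∀ v, v ∉ Λ → ω v = τ v}

/-- The Hamming graph: two configurations are adjacent if they differ at exactly one site. -/
def hammingGraph (V S : Type*) : SimpleGraph (V → S) where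
  Adj ω ω' := ∃! v, ω v ≠ ω' v
  symm := ⟨fun ω ω' h => by simpa only [ne_comm] using h⟩
  loopless := ⟨fun ω h => by obtain ⟨v, hv, -⟩ := h; exact hv rfl⟩

/-! ### Upwards-downwards specifications -/

/-- An upwards-downwards specification. The measures `ρ_Λ^τ` (with `Λ` finite and `τ` equal to
`⊤` off a finite set or to `⊥` off a finite set) are discrete, so they are given by their
probability mass functions. Values of `meas` at other `τ` are irrelevant and never used. -/
structure UpDownSpec (V S : Type*) [Top S] [Bot S] where
  /-- The family of measures `ρ_Λ^τ`. -/
  meas : Finset V → (V → S) → PMF (V → S)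
  /-- `ρ_Λ^τ` is supported on configurations agreeing with `τ` off `Λ`. -/
  support_subset : ∀ (Λ : Finset V), ∀ τ ∈ upDownConfig V S,
    (meas Λ τ).support ⊆ agreeOff Λ τ
  /-- `ρ_Λ^τ` depends on `τ` only through its values off `Λ`. -/
  eq_of_agreeOff : ∀ (Λ : Finset V), ∀ τ ∈ upDownConfig V S, ∀ τ' ∈ upDownConfig V S,
    τ' ∈ agreeOff Λ τ → meas Λ τ = meas Λ τ'
  /-- Conditioning `ρ_Λ^τ` on agreeing with `τ` off a subset `U` of `Λ` gives `ρ_U^τ`, whenever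
  this event has positive probability. -/
  consistent : ∀ (U Λ : Finset V), U ⊆ Λ → ∀ τ ∈ upDownConfig V S,
    ∀ h : ∃ ω ∈ agreeOff U τ, ω ∈ (meas Λ τ).support,
      (meas Λ τ).filter (agreeOff U τ) h = meas U τ

/-- `p` is stochastically dominated by `q`. -/
def StochLE {α : Type*} [Preorder α] (p q : PMF α) : Prop :=
  ∀ A : Set α, IsUpperSet A → p.toOuterMeasure A ≤ q.toOuterMeasure A

/-- The law of the spin at `v`. -/
def marginal {V S : Type*} (p : PMF (V → S)) (v : V) : PMF S := p.map fun σ => σ v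

/-- Total variation distance on a finite set. -/
def tvDist {S : Type*} [Fintype S] (p q : PMF S) : ℝ :=
  (1 / 2) * ∑ s, |(p s).toReal - (q s).toReal|

namespace UpDownSpec

/-- Monotonicity in the boundary condition. -/
def Monotonic {V S : Type*} [Preorder S] [Top S] [Bot S] (ρ : UpDownSpec V S) : Prop :=
  ∀ (Λ : Finset V), ∀ τ ∈ upDownConfig V S, ∀ τ' ∈ upDownConfig V S, τ ≤ τ' →
    StochLE (ρ.meas Λ τ) (ρ.meas Λ τ')

/-- Invariance under the group `Γ`. -/
def Invariant (Γ : Type*) {V S : Type*} [Group Γ] [MulAction Γ V] [Top S] [Bot S]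
    (ρ : UpDownSpec V S) : Prop :=
  ∀ (γ : Γ) (Λ : Finset V), ∀ τ ∈ upDownConfig V S,
    (ρ.meas (translateFinset γ Λ) (translate γ τ)).map (translate γ⁻¹) = ρ.meas Λ τ

/-- Irreducibility: for every finite `Λ`, the support of `ρ_Λ^⊤` contains `⊤` and is connected
in the Hamming graph, and similarly for `⊥`. -/
def Irreducible {V S : Type*} [Top S] [Bot S] (ρ : UpDownSpec V S) : Prop :=
  ∀ Λ : Finset V,
    ((⊤ : V → S) ∈ (ρ.meas Λ ⊤).support ∧
      ((hammingGraph V S).induce (ρ.meas Λ ⊤).support).Connected) ∧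
    ((⊥ : V → S) ∈ (ρ.meas Λ ⊥).support ∧
      ((hammingGraph V S).induce (ρ.meas Λ ⊥).support).Connected)

/-- Only finitely many distinct single-site conditional distributions occur. -/
def MarginallyFinite {V S : Type*} [Top S] [Bot S] (ρ : UpDownSpec V S) : Prop :=
  {p : PMF S | ∃ v, ∃ τ ∈ upDownConfig V S, p = marginal (ρ.meas {v} τ) v}.Finite

/-- `ρ_Λ^τ` as a probability measure for the product σ-algebra on configurations. -/
def toProb {V S : Type*} [MeasurableSpace S] [Top S] [Bot S] (ρ : UpDownSpec V S)
    (Λ : Finset V) (τ : V → S) : ProbabilityMeasure (V → S) :=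
  ⟨(ρ.meas Λ τ).toMeasure, inferInstance⟩

/-- Weak spatial mixing. -/
def WeakSpatialMixing {V S : Type*} [Fintype S] [Top S] [Bot S] {G : SimpleGraph V}
    (hG : IsLocallyFinite G) (ρ : UpDownSpec V S) : Prop :=
  ∃ C c : ℝ, 0 < C ∧ 0 < c ∧ ∀ (v : V) (r : ℕ),
    tvDist (marginal (ρ.meas (ballFinset hG v r) ⊤) v)
      (marginal (ρ.meas (ballFinset hG v r) ⊥) v) ≤ C * Real.exp (-c * r)

end UpDownSpec

/-! ### Codings -/

/-- The law of an i.i.d. process `(Y_v(n))` indexed by `v : V` and `n : ℕ` whose coordinates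
have law `p`. -/
def iidLaw (V : Type*) {T : Type*} [MeasurableSpace T] (p : PMF T) : Measure (V → ℕ → T) :=
  Measure.infinitePi fun _ : V => Measure.infinitePi fun _ : ℕ => p.toMeasure

/-- `φ` is a `Γ`-equivariant coding from a process with law `P` to a process with law `μ`. -/
structure IsCoding (Γ : Type*) {V A S : Type*} [Group Γ] [MulAction Γ V] [MeasurableSpace A]
    [MeasurableSpace S] (P : Measure (V → A)) (μ : Measure (V → S))
    (φ : (V → A) → (V → S)) : Prop where
  measurable : Measurable φ
  map_eq : P.map φ = μ
  /-- `φ` commutes with `Γ` on an invariant set of full measure. -/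
  equivariant : ∃ E : Set (V → A), MeasurableSet E ∧ P Eᶜ = 0 ∧
    (∀ (γ : Γ), ∀ y ∈ E, translate γ y ∈ E) ∧
    ∀ (γ : Γ), ∀ y ∈ E, φ (translate γ y) = translate γ (φ y)

/-- `φ(y)_v` is determined by the `y_w(i)` with `w` at distance at most `r` from `v` and
`i ≤ r`. -/
def DeterminedAt {V T S : Type*} (G : SimpleGraph V) (φ : (V → ℕ → T) → (V → S)) (v : V)
    (y : V → ℕ → T) (r : ℕ) : Prop :=
  ∀ y' : V → ℕ → T, (∀ w ∈ closedBall G v r, ∀ i ≤ r, y' w i = y w i) → φ y' v = φ y v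

/-- The space-time coding radius of `φ` at `v` and `y` (`⊤` if `φ(y)_v` is not determined at
any finite radius). -/
def spaceTimeRadius {V T S : Type*} (G : SimpleGraph V) (φ : (V → ℕ → T) → (V → S)) (v : V)
    (y : V → ℕ → T) : ℕ∞ :=
  ⨅ (r : ℕ) (_ : DeterminedAt G φ v y r), (r : ℕ∞)

/-- The space-time coding radius is almost surely finite at every vertex. -/
def SpaceTimeFinitary {V T S : Type*} [MeasurableSpace T] (G : SimpleGraph V)
    (P : Measure (V → ℕ → T)) (φ : (V → ℕ → T) → (V → S)) : Prop :=
  ∀ v, ∀ᵐ y ∂P, spaceTimeRadius G φ v y ≠ ⊤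

/-- The space-time coding radius `R` beats any stretched exponential:
`ℙ(R_v ≥ r) ≤ exp (-r ^ (1 - o(1)))` as `r → ∞`, uniformly in `v`. -/
def TailBeatsStretchedExp {V T S : Type*} [MeasurableSpace T] (G : SimpleGraph V)
    (P : Measure (V → ℕ → T)) (φ : (V → ℕ → T) → (V → S)) : Prop :=
  ∃ ε : ℕ → ℝ, Tendsto ε atTop (𝓝 0) ∧ ∀ᶠ r : ℕ in atTop, ∀ v,
    P {y | (r : ℕ∞) ≤ spaceTimeRadius G φ v y} ≤
      ENNReal.ofReal (Real.exp (-((r : ℝ) ^ (1 - ε r))))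

/-- The space-time coding radius has exponential tails. -/
def ExponentialTail {V T S : Type*} [MeasurableSpace T] (G : SimpleGraph V)
    (P : Measure (V → ℕ → T)) (φ : (V → ℕ → T) → (V → S)) : Prop :=
  ∃ C c : ℝ, 0 < C ∧ 0 < c ∧ ∀ (r : ℕ) (v : V),
    P {y | (r : ℕ∞) ≤ spaceTimeRadius G φ v y} ≤ ENNReal.ofReal (C * Real.exp (-c * r))

end

end SpaceTimeCoding

/-!
# Finitary codings of monotone specifications, by coupling from the past

The coding is a coupling from the past. In every time slice all sites of a finite volume are updated
once, by a monotone heat-bath rule driven by independent symbols: a symbol selects a state for each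
of the finitely many single-site conditional laws, monotonically in the law
(`exists_law_selection`, `heatBath_selectionRule`). The chain started from `⊤` decreases when the
volume grows or the starting time recedes (`run_path_top_anti`), and irreducibility makes its law in
a fixed volume converge to `ρ_Λ^⊤` (`HeatBath.noise_top_le`). Hence the limit of these chains has the
law `μ⁺`, in a coupling in which the spin at a given site is eventually the same for all large
volumes; this gives the weak limit (`tendsto_toProb_of_coupling`). The limit from `⊥` is the same
statement for the reversed order of `S`.

**The order of the updates.** To make the coding equivariant, the order within a slice is random:
the site `v` has as its label the sequence of the parities of independent bits on the spheres around
`v`, and labels are compared lexicographically. By the sphere condition, at every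
level the comparison of two labels involves a bit that occurs at no earlier level, so the labels of
two sites agree on their first `k` digits with probability at most `2 ^ (-k)`
(`noise_tie_le`). All estimates on the dynamics are uniform over the order of the updates, which
enters as an arbitrary `Schedule`.

**The coding radius.** If the extremal chains in the ball of radius `n` around `v`, run for `n`
slices, agree at `v`, and if the labels in that ball differ within `k` digits, then the coded spin at
`v` is determined within the space-time radius `n + k` (`determinedAt_codingMap`). If `μ⁺ = μ⁻`, the
two limits are ordered and have the same law, so they coincide almost surely, and the radius is
finite. Otherwise let `decay n` be the worst-case probability, over orders and sites, that the
extremal chains disagree; the tail of the radius is bounded by `decay n` and the probability of a tie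
(`iidLaw_radius_le`).

**Decay of disagreement under weak spatial mixing.** If the chains agree on a ball `B` at some time,
they can disagree at its centre later only through the influence of the boundary of `B`, whose
probability is bounded by the total variation distance in the mixing condition, for any running time
(`noise_influence_le`). The reason is that a stationary chain in a large volume, raised to `⊤` off
`B`, is dominated by the stationary chain in `B`. With `b R` bounding the size of balls this gives
`decay (s + t) ≤ g R + b R * decay s * decay t` for `R ≤ s` (`decay_add_le`), which yields the
stretched exponential bounds when balls grow subexponentially (`stretched_decay`). The factor `b R`
costs a logarithm in the exponent. To remove it, the set of disagreeing sites is followed along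
dyadic scales: either it stays close to the centre, or there is a scale at which it jumps, and then
two distant disagreements occur at the same time, in independent boxes. The resulting recursion
(`decay_le_multiscale`) propagates exponential decay from one scale to all larger ones
(`exp_decay_of_multiscale`), and the first recursion provides the bound at the initial scale when
`log (b r) = o (r / log r)` (`exp_decay`).
-/

namespace SpaceTimeCoding

noncomputable section

open scoped Classical ENNReal NNReal

/-! ### Sequential single-site updates -/

section Dynamics

variable {V A S : Type*}

/-- Resample the spin at the site of the space-time point `p` by the rule `f`, which reads the
noise symbol `y p` and the current configuration. -/
def siteUpdate (f : V → A → (V → S) → S) (y : V × ℕ → A) (p : V × ℕ) (σ : V → S) : V → S :=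
  Function.update σ p.1 (f p.1 (y p) σ)

/-- Perform the updates at the space-time points of a list, starting from `ξ`. Time runs backwards
along the list: the head is the *last* point to be updated. -/
def run (f : V → A → (V → S) → S) (y : V × ℕ → A) (l : List (V × ℕ)) (ξ : V → S) : V → S :=
  l.foldr (siteUpdate f y) ξ

variable {f : V → A → (V → S) → S} {y : V × ℕ → A}

@[simp] lemma run_nil (ξ : V → S) : run f y [] ξ = ξ := rfl

@[simp] lemma run_cons (p : V × ℕ) (l : List (V × ℕ)) (ξ : V → S) :
    run f y (p :: l) ξ = siteUpdate f y p (run f y l ξ) := rfl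

lemma run_append (l l' : List (V × ℕ)) (ξ : V → S) :
    run f y (l ++ l') ξ = run f y l (run f y l' ξ) := List.foldr_append

lemma run_congr {y y' : V × ℕ → A} {l : List (V × ℕ)} (h : ∀ p ∈ l, y p = y' p) (ξ : V → S) :
    run f y l ξ = run f y' l ξ := by
  induction l with
  | nil => rfl
  | cons p l ih =>
    simp only [List.mem_cons, forall_eq_or_imp] at h
    rw [run_cons, run_cons, ih h.2, siteUpdate, siteUpdate, h.1]

lemma run_apply_of_notMem {l : List (V × ℕ)} {v : V} (h : ∀ p ∈ l, p.1 ≠ v) (ξ : V → S) :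
    run f y l ξ v = ξ v := by
  induction l with
  | nil => rfl
  | cons p l ih =>
    simp only [List.mem_cons, forall_eq_or_imp] at h
    rw [run_cons, siteUpdate, Function.update_of_ne h.1.symm, ih h.2]

lemma run_mem_agreeOff {l : List (V × ℕ)} {Λ : Finset V} (h : ∀ p ∈ l, p.1 ∈ Λ) {τ ξ : V → S}
    (hξ : ξ ∈ agreeOff Λ τ) : run f y l ξ ∈ agreeOff Λ τ := fun v hv => by
  rw [run_apply_of_notMem (fun p hp (e : p.1 = v) => hv (e ▸ h p hp)), hξ v hv]

end Dynamics

section Configurations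

variable {V S : Type*}

lemma top_mem_upDownConfig [Top S] [Bot S] : (⊤ : V → S) ∈ upDownConfig V S :=
  Or.inl (by simp [upConfig])

lemma bot_mem_upDownConfig [Top S] [Bot S] : (⊥ : V → S) ∈ upDownConfig V S :=
  Or.inr (by simp [downConfig])

lemma mem_agreeOff_self (Λ : Finset V) (τ : V → S) : τ ∈ agreeOff Λ τ := fun _ _ => rfl

lemma agreeOff_symm {Λ : Finset V} {σ τ : V → S} (h : σ ∈ agreeOff Λ τ) : τ ∈ agreeOff Λ σ :=
  fun v hv => (h v hv).symm

lemma agreeOff_trans {Λ : Finset V} {σ τ υ : V → S} (h : σ ∈ agreeOff Λ τ)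
    (h' : τ ∈ agreeOff Λ υ) : σ ∈ agreeOff Λ υ :=
  fun v hv => (h v hv).trans (h' v hv)

lemma mem_upDownConfig_of_agreeOff [Top S] [Bot S] {Λ : Finset V} {σ τ : V → S}
    (h : σ ∈ agreeOff Λ τ) (hτ : τ ∈ upDownConfig V S) : σ ∈ upDownConfig V S := by
  rcases hτ with hτ | hτ
  · refine Or.inl ((hτ.union Λ.finite_toSet).subset fun v hv => ?_)
    by_cases hv' : v ∈ Λ
    · exact Or.inr hv'
    · exact Or.inl (by simpa [h v hv'] using hv)
  · refine Or.inr ((hτ.union Λ.finite_toSet).subset fun v hv => ?_)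
    by_cases hv' : v ∈ Λ
    · exact Or.inr hv'
    · exact Or.inl (by simpa [h v hv'] using hv)

lemma update_mem_agreeOff {Λ : Finset V} {σ : V → S} {v : V} (hv : v ∈ Λ) (s : S) :
    Function.update σ v s ∈ agreeOff Λ σ := fun w hw =>
  Function.update_of_ne (fun e : w = v => hw (e ▸ hv)) s σ

lemma agreeOff_finite [Finite S] (Λ : Finset V) (τ : V → S) : (agreeOff Λ τ).Finite := by
  refine Set.Finite.of_finite_image (f := fun (σ : V → S) (v : Λ) => σ v) (Set.toFinite _) ?_
  intro σ hσ σ' hσ' h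
  funext v
  by_cases hv : v ∈ Λ
  · exact congrFun h ⟨v, hv⟩
  · rw [hσ v hv, hσ' v hv]

lemma agreeOff_ncard_le [Fintype S] (Λ : Finset V) (τ : V → S) :
    (agreeOff Λ τ).ncard ≤ Fintype.card S ^ Λ.card := by
  have h := Set.ncard_le_ncard_of_injOn (s := agreeOff Λ τ) (t := (Set.univ : Set (Λ → S)))
    (fun σ v => σ v) (fun _ _ => Set.mem_univ _) ?_ (Set.toFinite _)
  · simpa [Set.ncard_univ, Nat.card_eq_fintype_card] using h
  · intro σ hσ σ' hσ' h
    funext v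
    by_cases hv : v ∈ Λ
    · exact congrFun h ⟨v, hv⟩
    · rw [hσ v hv, hσ' v hv]

/-- The configuration that equals `σ` on `Λ` and `⊤` elsewhere. -/
def raiseOff [Top S] (Λ : Finset V) (σ : V → S) : V → S := fun v => if v ∈ Λ then σ v else ⊤

lemma raiseOff_mem_agreeOff [Top S] (Λ : Finset V) (σ : V → S) :
    raiseOff Λ σ ∈ agreeOff Λ ⊤ := fun v hv => by simp [raiseOff, hv]

lemma raiseOff_mem [Top S] [Bot S] (Λ : Finset V) (σ : V → S) :
    raiseOff Λ σ ∈ upDownConfig V S :=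
  mem_upDownConfig_of_agreeOff (raiseOff_mem_agreeOff Λ σ) top_mem_upDownConfig

lemma le_raiseOff [Preorder S] [OrderTop S] (Λ : Finset V) (σ : V → S) : σ ≤ raiseOff Λ σ :=
  fun v => by by_cases h : v ∈ Λ <;> simp [raiseOff, h]

lemma raiseOff_mono [Preorder S] [OrderTop S] (Λ : Finset V) :
    Monotone (raiseOff Λ : (V → S) → V → S) :=
  fun σ σ' h v => by by_cases hv : v ∈ Λ <;> simp [raiseOff, hv, h v]

lemma raiseOff_congr [Top S] {Λ : Finset V} {σ σ' : V → S} (h : ∀ v ∈ Λ, σ v = σ' v) :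
    raiseOff Λ σ = raiseOff Λ σ' := by
  funext v; by_cases hv : v ∈ Λ <;> simp [raiseOff, hv, h]

end Configurations

section Monotone

variable {V A S : Type*} [Preorder S] [BoundedOrder S] {f : V → A → (V → S) → S}
  {y : V × ℕ → A}

/-- An update rule that is monotone on the admissible boundary conditions. -/
def MonotoneRule (f : V → A → (V → S) → S) : Prop :=
  ∀ v a, MonotoneOn (f v a) (upDownConfig V S)

lemma siteUpdate_mem {σ : V → S} (hσ : σ ∈ upDownConfig V S) (p : V × ℕ) :
    siteUpdate f y p σ ∈ upDownConfig V S :=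
  mem_upDownConfig_of_agreeOff (update_mem_agreeOff (Finset.mem_singleton_self p.1) _) hσ

lemma run_mem {σ : V → S} (hσ : σ ∈ upDownConfig V S) (l : List (V × ℕ)) :
    run f y l σ ∈ upDownConfig V S := by
  induction l with
  | nil => exact hσ
  | cons p l ih => exact siteUpdate_mem ih p

lemma siteUpdate_mono (hf : MonotoneRule f) {σ σ' : V → S} (hσ : σ ∈ upDownConfig V S)
    (hσ' : σ' ∈ upDownConfig V S) (h : σ ≤ σ') (p : V × ℕ) :
    siteUpdate f y p σ ≤ siteUpdate f y p σ' := by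
  intro v
  by_cases hv : v = p.1
  · subst hv; simpa [siteUpdate] using hf _ _ hσ hσ' h
  · simpa [siteUpdate, hv] using h v

lemma run_mono (hf : MonotoneRule f) {σ σ' : V → S} (hσ : σ ∈ upDownConfig V S)
    (hσ' : σ' ∈ upDownConfig V S) (h : σ ≤ σ') (l : List (V × ℕ)) :
    run f y l σ ≤ run f y l σ' := by
  induction l with
  | nil => exact h
  | cons p l ih => exact siteUpdate_mono hf (run_mem hσ l) (run_mem hσ' l) ih p

/-- Freezing the spins outside `Λ` in the maximal state can only increase the configuration. -/
lemma run_le_run_filter (hf : MonotoneRule f) {σ σ' : V → S} (hσ : σ ∈ upDownConfig V S)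
    (hσ' : σ' ∈ upDownConfig V S) (h : σ ≤ σ') (Λ : Finset V) (htop : ∀ v ∉ Λ, σ' v = ⊤)
    (l : List (V × ℕ)) :
    run f y l σ ≤ run f y (l.filter fun p => p.1 ∈ Λ) σ' := by
  induction l with
  | nil => exact h
  | cons p l ih =>
    by_cases hp : p.1 ∈ Λ
    · rw [List.filter_cons_of_pos (by simpa using hp)]
      exact siteUpdate_mono hf (run_mem hσ l) (run_mem hσ' _) ih p
    · rw [List.filter_cons_of_neg (by simpa using hp), run_cons]
      intro v
      by_cases hv : v = p.1
      · subst hv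
        rw [run_apply_of_notMem (l := l.filter _) _ σ', htop _ hp]
        · exact le_top
        · intro q hq e
          exact hp (e ▸ by simpa using (List.mem_filter.1 hq).2)
      · simpa [siteUpdate, hv] using ih v

end Monotone

/-! ### Schedules -/

/-- A schedule prescribes, for every time slice, an order in which the sites of finite sets are
updated; the orders of different finite sets are compatible. -/
structure Schedule (V : Type*) where
  /-- The sites of a finite set in the order of a time slice. -/
  order : ℕ → Finset V → List V
  nodup : ∀ i Λ, (order i Λ).Nodup
  mem_order : ∀ i Λ v, v ∈ order i Λ ↔ v ∈ Λ
  filter_order : ∀ i, ∀ Λ Λ' : Finset V, Λ ⊆ Λ' →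
    order i Λ = (order i Λ').filter fun v => v ∈ Λ

namespace Schedule

variable {V : Type*} (o : Schedule V)

/-- The updates of all sites of `Λ` in the time slices `i, …, i + n - 1`. Slice `i` comes last in
time, hence first in the list. -/
def path (Λ : Finset V) (i : ℕ) : ℕ → List (V × ℕ)
  | 0 => []
  | n + 1 => (o.order i Λ).map (fun v => (v, i)) ++ path Λ (i + 1) n

lemma path_add (Λ : Finset V) (i m n : ℕ) :
    o.path Λ i (m + n) = o.path Λ i m ++ o.path Λ (i + m) n := by
  induction m generalizing i with
  | zero => simp [path]
  | succ m ih =>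
    rw [show m + 1 + n = (m + n) + 1 by omega, path, path, ih, List.append_assoc]
    congr 3; omega

lemma mem_path {Λ : Finset V} {i n : ℕ} {p : V × ℕ} :
    p ∈ o.path Λ i n ↔ p.1 ∈ Λ ∧ i ≤ p.2 ∧ p.2 < i + n := by
  induction n generalizing i with
  | zero => simp [path]
  | succ n ih =>
    rw [path, List.mem_append, ih]
    obtain ⟨v, j⟩ := p
    simp only [List.mem_map, o.mem_order, Prod.mk.injEq]
    constructor
    · rintro (⟨w, hw, rfl, rfl⟩ | ⟨h1, h2, h3⟩)
      · exact ⟨hw, le_rfl, by omega⟩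
      · exact ⟨h1, by omega, by omega⟩
    · rintro ⟨h1, h2, h3⟩
      by_cases hj : j = i
      · exact Or.inl ⟨v, h1, rfl, hj.symm⟩
      · exact Or.inr ⟨h1, by omega, by omega⟩

lemma path_nodup (Λ : Finset V) (i n : ℕ) : (o.path Λ i n).Nodup := by
  induction n generalizing i with
  | zero => simp [path]
  | succ n ih =>
    rw [path, List.nodup_append']
    refine ⟨(o.nodup i Λ).map fun _ _ h => (Prod.mk.inj h).1, ih _, ?_⟩
    intro p hp hp'
    obtain ⟨w, -, rfl⟩ := List.mem_map.1 hp
    have := (o.mem_path.1 hp').2.1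
    simp at this

lemma path_filter {Λ Λ' : Finset V} (h : Λ ⊆ Λ') (i n : ℕ) :
    o.path Λ i n = (o.path Λ' i n).filter fun p => p.1 ∈ Λ := by
  induction n generalizing i with
  | zero => simp [path]
  | succ n ih =>
    rw [path, path, List.filter_append, ← ih, o.filter_order i Λ Λ' h, List.filter_map]
    rfl

lemma path_length (Λ : Finset V) (i n : ℕ) : (o.path Λ i n).length = n * Λ.card := by
  have hlen : ∀ i, (o.order i Λ).length = Λ.card := fun i => by
    rw [← List.toFinset_card_of_nodup (o.nodup i Λ)]
    congr 1; ext v; simp [o.mem_order]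
  induction n generalizing i with
  | zero => simp [path]
  | succ n ih => rw [path, List.length_append, List.length_map, hlen, ih]; ring

end Schedule

section Comparison

variable {V A S : Type*} [Preorder S] [BoundedOrder S] {f : V → A → (V → S) → S}
  {y : V × ℕ → A} (o : Schedule V)

lemma run_path_le_raiseOff (hf : MonotoneRule f) {Λ Λ' : Finset V} (h : Λ ⊆ Λ') (i n : ℕ)
    {σ : V → S} (hσ : σ ∈ upDownConfig V S) :
    run f y (o.path Λ' i n) σ ≤ run f y (o.path Λ i n) (raiseOff Λ σ) := by
  rw [o.path_filter h]
  exact run_le_run_filter hf hσ (raiseOff_mem Λ σ) (le_raiseOff Λ σ) Λ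
    (fun v hv => by simp [raiseOff, hv]) _

/-- The chain started from the maximal state decreases with the volume and the running time. -/
lemma run_path_top_anti (hf : MonotoneRule f) {Λ Λ' : Finset V} (h : Λ ⊆ Λ') (i : ℕ) {n n' : ℕ}
    (hn : n ≤ n') :
    run f y (o.path Λ' i n') (⊤ : V → S) ≤ run f y (o.path Λ i n) ⊤ := by
  obtain ⟨k, rfl⟩ := Nat.exists_eq_add_of_le hn
  rw [o.path_add, run_append]
  refine (run_path_le_raiseOff o hf h i n (run_mem top_mem_upDownConfig _)).trans ?_
  exact run_mono hf (raiseOff_mem _ _) top_mem_upDownConfig le_top _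

end Comparison

/-! ### Reversing the order of the spins -/

section Dual

variable {V A S : Type*} [Preorder S] [BoundedOrder S] {f : V → A → (V → S) → S}
  {y : V × ℕ → A} (o : Schedule V)

lemma upDownConfig_dual (V S : Type*) [Top S] [Bot S] :
    upDownConfig V Sᵒᵈ = upDownConfig V S := Set.union_comm _ _

lemma MonotoneRule.dual (hf : MonotoneRule f) : MonotoneRule (S := Sᵒᵈ) f := by
  intro v a σ hσ σ' hσ' h
  rw [upDownConfig_dual] at hσ hσ'
  exact hf v a hσ' hσ h

/-- The configuration that equals `σ` on `Λ` and `⊥` elsewhere. -/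
def lowerOff {V S : Type*} [Bot S] (Λ : Finset V) (σ : V → S) : V → S :=
  fun v => if v ∈ Λ then σ v else ⊥

lemma lowerOff_mem {V S : Type*} [Top S] [Bot S] (Λ : Finset V) (σ : V → S) :
    lowerOff Λ σ ∈ upDownConfig V S := by
  rw [← upDownConfig_dual]
  exact raiseOff_mem (S := Sᵒᵈ) Λ σ

lemma lowerOff_congr {V S : Type*} [Bot S] {Λ : Finset V} {σ σ' : V → S}
    (h : ∀ v ∈ Λ, σ v = σ' v) : lowerOff Λ σ = lowerOff Λ σ' :=
  raiseOff_congr (S := Sᵒᵈ) h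

lemma lowerOff_le_raiseOff (Λ : Finset V) (σ : V → S) : lowerOff Λ σ ≤ raiseOff Λ σ :=
  have h : lowerOff Λ σ ≤ σ := le_raiseOff (S := Sᵒᵈ) Λ σ
  h.trans (le_raiseOff Λ σ)

lemma lowerOff_run_path_le (hf : MonotoneRule f) {Λ Λ' : Finset V} (h : Λ ⊆ Λ') (i n : ℕ)
    {σ : V → S} (hσ : σ ∈ upDownConfig V S) :
    run f y (o.path Λ i n) (lowerOff Λ σ) ≤ run f y (o.path Λ' i n) σ :=
  run_path_le_raiseOff (S := Sᵒᵈ) o hf.dual h i n (by rwa [upDownConfig_dual])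

/-- The chain started from the minimal state increases with the volume and the running time. -/
lemma run_path_bot_mono (hf : MonotoneRule f) {Λ Λ' : Finset V} (h : Λ ⊆ Λ') (i : ℕ) {n n' : ℕ}
    (hn : n ≤ n') :
    run f y (o.path Λ i n) (⊥ : V → S) ≤ run f y (o.path Λ' i n') ⊥ :=
  run_path_top_anti (S := Sᵒᵈ) o hf.dual h i hn

end Dual

/-! ### Disagreement of the extremal chains -/

section Disagreement

variable {V A S : Type*} [PartialOrder S] [BoundedOrder S] {f : V → A → (V → S) → S}
  (o : Schedule V)

/-- The noise for which the two extremal chains in the volume `Λ`, started `n` slices before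
slice `i`, disagree at `v` after slice `i`. -/
def disagree (f : V → A → (V → S) → S) (o : Schedule V) (Λ : Finset V) (i n : ℕ) (v : V) :
    Set (V × ℕ → A) :=
  {y | run f y (o.path Λ i n) (⊤ : V → S) v ≠ run f y (o.path Λ i n) (⊥ : V → S) v}

lemma disagree_anti (hf : MonotoneRule f) {Λ Λ' : Finset V} (h : Λ ⊆ Λ') (i : ℕ) {n n' : ℕ}
    (hn : n ≤ n') (v : V) : disagree f o Λ' i n' v ⊆ disagree f o Λ i n v := by
  intro y hy hy'
  refine hy (le_antisymm ?_ ?_)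
  · exact (run_path_top_anti o hf h i hn v).trans
      (hy'.le.trans (run_path_bot_mono o hf h i hn v))
  · exact run_mono hf bot_mem_upDownConfig top_mem_upDownConfig bot_le _ v

end Disagreement

/-! ### Heat-bath updates of a specification -/

lemma pmf_map_congr {α β : Type*} (p : PMF α) {g h : α → β} (hgh : ∀ a ∈ p.support, g a = h a) :
    p.map g = p.map h := by
  ext b
  rw [PMF.map_apply, PMF.map_apply]
  refine tsum_congr fun a => ?_
  by_cases ha : a ∈ p.support
  · rw [hgh a ha]
  · rw [(p.apply_eq_zero_iff a).2 ha]; simp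

lemma pmf_bind_congr {α β : Type*} (p : PMF α) {g h : α → PMF β}
    (hgh : ∀ a ∈ p.support, g a = h a) : p.bind g = p.bind h := by
  ext b
  rw [PMF.bind_apply, PMF.bind_apply]
  refine tsum_congr fun a => ?_
  by_cases ha : a ∈ p.support
  · rw [hgh a ha]
  · rw [(p.apply_eq_zero_iff a).2 ha]; simp

namespace UpDownSpec

section

variable {V S : Type*} [Top S] [Bot S] (ρ : UpDownSpec V S)

lemma mem_of_mem_support {Λ : Finset V} {τ σ : V → S} (hτ : τ ∈ upDownConfig V S)
    (hσ : σ ∈ (ρ.meas Λ τ).support) : σ ∈ upDownConfig V S :=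
  mem_upDownConfig_of_agreeOff (ρ.support_subset Λ τ hτ hσ) hτ

/-- On the support of `ρ_Λ^τ`, conditioning on the spins off `B` gives `ρ_B^σ`. -/
lemma meas_eq_filter {B Λ : Finset V} (hB : B ⊆ Λ) {τ σ : V → S} (hτ : τ ∈ upDownConfig V S)
    (hσ : σ ∈ (ρ.meas Λ τ).support) :
    (ρ.meas Λ τ).filter (agreeOff B σ) ⟨σ, mem_agreeOff_self B σ, hσ⟩ = ρ.meas B σ := by
  have hσ' := ρ.mem_of_mem_support hτ hσ
  have h := ρ.eq_of_agreeOff Λ τ hτ σ hσ' (ρ.support_subset Λ τ hτ hσ)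
  have h2 := ρ.consistent B Λ hB σ hσ' ⟨σ, mem_agreeOff_self B σ, h ▸ hσ⟩
  rw [← h2]
  congr 1

/-- Resampling a subvolume from its conditional law leaves `ρ_Λ^τ` invariant. -/
lemma bind_meas {B Λ : Finset V} (hB : B ⊆ Λ) {τ : V → S} (hτ : τ ∈ upDownConfig V S) :
    (ρ.meas Λ τ).bind (ρ.meas B) = ρ.meas Λ τ := by
  set p := ρ.meas Λ τ with hp
  ext ω
  rw [PMF.bind_apply]
  have key : ∀ σ, p σ * ρ.meas B σ ω =
      (agreeOff B ω).indicator p σ * (p ω * (∑' σ', (agreeOff B ω).indicator p σ')⁻¹) := by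
    intro σ
    by_cases hσ : σ ∈ p.support
    · rw [← ρ.meas_eq_filter hB hτ hσ, PMF.filter_apply]
      by_cases hω : ω ∈ agreeOff B σ
      · have e : agreeOff B σ = agreeOff B ω := Set.ext fun x =>
          ⟨fun hx => agreeOff_trans hx (agreeOff_symm hω), fun hx => agreeOff_trans hx hω⟩
        rw [← e, Set.indicator_of_mem hω, Set.indicator_of_mem (mem_agreeOff_self B σ)]
      · rw [Set.indicator_of_notMem hω, Set.indicator_of_notMem fun h => hω (agreeOff_symm h)]
        simp
    · have h0 := (p.apply_eq_zero_iff σ).2 hσ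
      rw [h0, Set.indicator_apply, h0]
      simp
  rw [tsum_congr key, ENNReal.tsum_mul_right]
  by_cases hω : p ω = 0
  · simp [hω]
  have h1 : ∑' σ', (agreeOff B ω).indicator p σ' ≠ 0 := fun h => hω (by
    have := ENNReal.tsum_eq_zero.1 h ω
    rwa [Set.indicator_of_mem (mem_agreeOff_self B ω)] at this)
  rw [mul_left_comm, ENNReal.mul_inv_cancel h1 (p.tsum_coe_indicator_ne_top _), mul_one]

lemma support_finite [Finite S] (Λ : Finset V) {τ : V → S} (hτ : τ ∈ upDownConfig V S) :
    (ρ.meas Λ τ).support.Finite :=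
  (agreeOff_finite Λ τ).subset (ρ.support_subset Λ τ hτ)

/-- The same specification for the reversed order of spins. -/
def dual : UpDownSpec V Sᵒᵈ where
  meas := fun Λ τ => ρ.meas Λ τ
  support_subset Λ τ hτ := ρ.support_subset Λ τ (by rwa [upDownConfig_dual] at hτ)
  eq_of_agreeOff Λ τ hτ τ' hτ' h := ρ.eq_of_agreeOff Λ τ (by rwa [upDownConfig_dual] at hτ) τ'
    (by rwa [upDownConfig_dual] at hτ') h
  consistent U Λ hU τ hτ h := ρ.consistent U Λ hU τ (by rwa [upDownConfig_dual] at hτ) h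

end

end UpDownSpec

lemma StochLE.dual {α : Type*} [Preorder α] {p q : PMF α} (h : StochLE p q) :
    StochLE (α := αᵒᵈ) q p := by
  suffices key : ∀ E : Set α, IsLowerSet E → q.toOuterMeasure E ≤ p.toOuterMeasure E from
    fun E hE => key E fun a b hab ha => hE hab ha
  intro E hE
  have h2 := h _ hE.compl
  have hc : ∀ r : PMF α, r.toOuterMeasure E + r.toOuterMeasure Eᶜ = 1 := fun r => by
    rw [PMF.toOuterMeasure_apply, PMF.toOuterMeasure_apply, ← ENNReal.tsum_add, ← r.tsum_coe]
    refine tsum_congr fun a => ?_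
    by_cases ha : a ∈ E <;> simp [ha]
  have hfin : ∀ r : PMF α, r.toOuterMeasure Eᶜ ≠ ⊤ := fun r =>
    ne_top_of_le_ne_top ENNReal.one_ne_top ((hc r).le.trans' le_add_self)
  have e : ∀ r : PMF α, r.toOuterMeasure E = 1 - r.toOuterMeasure Eᶜ := fun r =>
    ENNReal.eq_sub_of_add_eq (hfin r) (hc r)
  rw [e q, e p]
  exact tsub_le_tsub_left h2 1

lemma UpDownSpec.Monotonic.dual {V S : Type*} [Preorder S] [BoundedOrder S]
    {ρ : UpDownSpec V S} (h : ρ.Monotonic) : ρ.dual.Monotonic := by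
  intro Λ τ hτ τ' hτ' hle
  rw [upDownConfig_dual] at hτ hτ'
  exact (h Λ τ' hτ' τ hτ hle).dual

section HeatBath

variable {V A S : Type*}

/-- The transition law of an update at `v`. -/
def stepLaw (q : PMF A) (f : V → A → (V → S) → S) (v : V) (σ : V → S) : PMF (V → S) :=
  q.map fun a => Function.update σ v (f v a σ)

/-- The transition law of a sequence of updates. -/
def runLaw (q : PMF A) (f : V → A → (V → S) → S) : List (V × ℕ) → (V → S) → PMF (V → S)
  | [], ξ => PMF.pure ξ
  | p :: l, ξ => (runLaw q f l ξ).bind (stepLaw q f p.1)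

lemma support_stepLaw_subset {q : PMF A} {f : V → A → (V → S) → S} {v : V} {σ ω : V → S}
    (h : ω ∈ (stepLaw q f v σ).support) :
    ω ∈ agreeOff {v} σ := by
  obtain ⟨a, -, rfl⟩ := (PMF.mem_support_map_iff _ _ _).1 h
  exact update_mem_agreeOff (Finset.mem_singleton_self v) _

lemma bind_stepLaw_apply [Fintype A] {q : PMF A} {f : V → A → (V → S) → S} (p : PMF (V → S))
    (v : V) (E : Set (V → S)) :
    (p.bind (stepLaw q f v)).toOuterMeasure E =
      ∑ a, q a * p.toOuterMeasure {σ | Function.update σ v (f v a σ) ∈ E} := by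
  rw [PMF.toOuterMeasure_bind_apply]
  simp_rw [stepLaw, PMF.toOuterMeasure_map_apply, PMF.toOuterMeasure_apply_fintype q,
    Finset.mul_sum]
  rw [Summable.tsum_finsetSum fun _ _ => ENNReal.summable]
  refine Finset.sum_congr rfl fun a _ => ?_
  rw [PMF.toOuterMeasure_apply, ← ENNReal.tsum_mul_left]
  refine tsum_congr fun σ => ?_
  by_cases h : Function.update σ v (f v a σ) ∈ E <;> simp [Set.indicator, h, mul_comm]

variable [Preorder S] [BoundedOrder S]

/-- The rule `f`, driven by noise symbols of law `q`, is a monotone coupling of the single-site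
conditional laws of `ρ`. -/
structure HeatBath (ρ : UpDownSpec V S) (q : PMF A) (f : V → A → (V → S) → S) : Prop where
  mono : MonotoneRule f
  law : ∀ v, ∀ σ ∈ upDownConfig V S, q.map (fun a => f v a σ) = marginal (ρ.meas {v} σ) v

variable {ρ : UpDownSpec V S} {q : PMF A} {f : V → A → (V → S) → S}

lemma HeatBath.dual (H : HeatBath ρ q f) : HeatBath (S := Sᵒᵈ) ρ.dual q f where
  mono := H.mono.dual
  law v σ hσ := H.law v σ (by rwa [upDownConfig_dual] at hσ)

lemma HeatBath.stepLaw_eq (H : HeatBath ρ q f) (v : V) {σ : V → S}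
    (hσ : σ ∈ upDownConfig V S) : stepLaw q f v σ = ρ.meas {v} σ := by
  have h1 : stepLaw q f v σ = (marginal (ρ.meas {v} σ) v).map (Function.update σ v) := by
    rw [← H.law v σ hσ, PMF.map_comp]; rfl
  rw [h1, marginal, PMF.map_comp]
  conv_rhs => rw [← PMF.map_id (ρ.meas {v} σ)]
  refine pmf_map_congr _ fun ω hω => ?_
  funext w
  by_cases hw : w = v
  · subst hw; simp
  · simp [hw, ρ.support_subset {v} σ hσ hω w (by simpa using hw)]

lemma HeatBath.bind_stepLaw (H : HeatBath ρ q f) {Λ : Finset V} {τ : V → S}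
    (hτ : τ ∈ upDownConfig V S) {v : V} (hv : v ∈ Λ) :
    (ρ.meas Λ τ).bind (stepLaw q f v) = ρ.meas Λ τ := by
  rw [pmf_bind_congr _ fun σ hσ => H.stepLaw_eq v (ρ.mem_of_mem_support hτ hσ),
    ρ.bind_meas (by simpa using hv) hτ]

/-- The measure `ρ_Λ^τ` is stationary for updates inside `Λ`. -/
lemma HeatBath.bind_runLaw (H : HeatBath ρ q f) {Λ : Finset V} {τ : V → S}
    (hτ : τ ∈ upDownConfig V S) {l : List (V × ℕ)} (hl : ∀ p ∈ l, p.1 ∈ Λ) :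
    (ρ.meas Λ τ).bind (runLaw q f l) = ρ.meas Λ τ := by
  induction l with
  | nil => exact PMF.bind_pure _
  | cons p l ih =>
    simp only [List.mem_cons, forall_eq_or_imp] at hl
    simp only [runLaw]
    rw [← PMF.bind_bind, ih hl.2, H.bind_stepLaw hτ hl.1]

lemma StochLE.apply_le {p p' : PMF (V → S)} (h : StochLE p p')
    (hp : p.support ⊆ upDownConfig V S) (hp' : p'.support ⊆ upDownConfig V S) {E : Set (V → S)}
    (hE : ∀ σ ∈ upDownConfig V S, ∀ σ' ∈ upDownConfig V S, σ ≤ σ' → σ ∈ E → σ' ∈ E) :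
    p.toOuterMeasure E ≤ p'.toOuterMeasure E := by
  have hU : IsUpperSet {σ' | ∃ σ ∈ E ∩ upDownConfig V S, σ ≤ σ'} :=
    fun a b hab ⟨σ, hσ, hle⟩ => ⟨σ, hσ, hle.trans hab⟩
  refine (PMF.toOuterMeasure_mono p fun σ hσ => ?_).trans ((h _ hU).trans
    (PMF.toOuterMeasure_mono p' fun σ hσ => ?_))
  · exact ⟨σ, ⟨hσ.1, hp hσ.2⟩, le_rfl⟩
  · obtain ⟨⟨σ', hσ', hle⟩, hs⟩ := hσ
    exact hE σ' hσ'.2 σ (hp' hs) hle hσ'.1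

lemma StochLE.bind_stepLaw [Fintype A] (hf : MonotoneRule f) {p p' : PMF (V → S)}
    (h : StochLE p p') (hp : p.support ⊆ upDownConfig V S)
    (hp' : p'.support ⊆ upDownConfig V S) (v : V) :
    StochLE (p.bind (stepLaw q f v)) (p'.bind (stepLaw q f v)) := by
  intro E hE
  rw [bind_stepLaw_apply, bind_stepLaw_apply]
  refine Finset.sum_le_sum fun a _ => ?_
  refine mul_le_mul' le_rfl ?_
  refine h.apply_le hp hp' fun σ hσ σ' hσ' hle hm => hE ?_ hm
  exact siteUpdate_mono (y := fun _ => a) hf hσ hσ' hle (v, 0)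

lemma support_bind_runLaw_subset {p : PMF (V → S)} (hp : p.support ⊆ upDownConfig V S)
    (l : List (V × ℕ)) : (p.bind (runLaw q f l)).support ⊆ upDownConfig V S := by
  induction l with
  | nil => simpa [runLaw] using hp
  | cons x l ih =>
    simp only [runLaw]
    rw [← PMF.bind_bind]
    intro ω hω
    obtain ⟨σ, hσ, hω⟩ := (PMF.mem_support_bind_iff _ _ _).1 hω
    exact mem_upDownConfig_of_agreeOff (support_stepLaw_subset hω) (ih hσ)

lemma StochLE.bind_runLaw [Fintype A] (hf : MonotoneRule f) {p p' : PMF (V → S)}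
    (h : StochLE p p') (hp : p.support ⊆ upDownConfig V S)
    (hp' : p'.support ⊆ upDownConfig V S) (l : List (V × ℕ)) :
    StochLE (p.bind (runLaw q f l)) (p'.bind (runLaw q f l)) := by
  induction l with
  | nil => simpa [runLaw] using h
  | cons x l ih =>
    simp only [runLaw]
    rw [← PMF.bind_bind, ← PMF.bind_bind]
    exact ih.bind_stepLaw hf (support_bind_runLaw_subset hp l)
      (support_bind_runLaw_subset hp' l) x.1

/-- The restriction of `ρ_Λ^τ` to a subvolume is dominated by the measure of the subvolume with
maximal boundary condition. -/
lemma UpDownSpec.Monotonic.map_raiseOff_le (hρ : ρ.Monotonic) {B Λ : Finset V} (hB : B ⊆ Λ)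
    {τ : V → S} (hτ : τ ∈ upDownConfig V S) :
    StochLE ((ρ.meas Λ τ).map (raiseOff B)) (ρ.meas B ⊤) := by
  intro E hE
  have hE' : IsUpperSet (raiseOff B ⁻¹' E) := hE.preimage (raiseOff_mono B)
  rw [PMF.toOuterMeasure_map_apply, ← ρ.bind_meas hB hτ, PMF.toOuterMeasure_bind_apply]
  have hle : ∀ σ, ρ.meas Λ τ σ * (ρ.meas B σ).toOuterMeasure (raiseOff B ⁻¹' E) ≤
      ρ.meas Λ τ σ * (ρ.meas B ⊤).toOuterMeasure E := by
    intro σ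
    by_cases hσ : σ ∈ (ρ.meas Λ τ).support
    · refine mul_le_mul' le_rfl ?_
      refine (hρ B σ (ρ.mem_of_mem_support hτ hσ) ⊤ top_mem_upDownConfig le_top _ hE').trans ?_
      refine PMF.toOuterMeasure_mono _ fun ω hω => ?_
      have : raiseOff B ω = ω := by
        funext v
        by_cases hv : v ∈ B
        · simp [raiseOff, hv]
        · simp [raiseOff, hv, ρ.support_subset B ⊤ top_mem_upDownConfig hω.2 v hv]
      rw [← this]; exact hω.1
    · rw [((ρ.meas Λ τ).apply_eq_zero_iff σ).2 hσ]; simp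
  refine (ENNReal.tsum_le_tsum hle).trans ?_
  rw [ENNReal.tsum_mul_right, PMF.tsum_coe, one_mul]

end HeatBath

/-! ### Independent noise -/

section Noise

variable {ι A : Type*}

/-- The event `E` is determined by the coordinates in `J`. -/
def EventOn (J : Finset ι) (E : Set (ι → A)) : Prop :=
  ∀ y y' : ι → A, (∀ i ∈ J, y i = y' i) → y ∈ E → y' ∈ E

namespace EventOn

variable {J K : Finset ι} {E F : Set (ι → A)}

lemma mono (h : EventOn J E) (hJK : J ⊆ K) : EventOn K E :=
  fun y y' hy => h y y' fun i hi => hy i (hJK hi)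

lemma inter (hE : EventOn J E) (hF : EventOn J F) : EventOn J (E ∩ F) :=
  fun y y' hy h => ⟨hE y y' hy h.1, hF y y' hy h.2⟩

lemma eq_preimage (h : EventOn J E) : E = J.restrict ⁻¹' (J.restrict '' E) := by
  refine Set.Subset.antisymm (Set.subset_preimage_image _ _) ?_
  rintro y ⟨y', hy', e⟩
  exact h y' y (fun i hi => congrFun e ⟨i, hi⟩) hy'

end EventOn

variable [MeasurableSpace A] [MeasurableSingletonClass A]

/-- The law of independent noise symbols. -/
def noise (ι : Type*) {A : Type*} [MeasurableSpace A] (q : PMF A) : Measure (ι → A) :=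
  Measure.infinitePi fun _ => q.toMeasure

instance (q : PMF A) : IsProbabilityMeasure (noise ι q) := by
  unfold noise; infer_instance

lemma noise_cylinder (q : PMF A) (J : Finset ι) (c : ι → A) :
    noise ι q {y | ∀ i ∈ J, y i = c i} = ∏ i ∈ J, q (c i) := by
  have : {y : ι → A | ∀ i ∈ J, y i = c i} = (J : Set ι).pi fun i => {c i} := by
    ext y; simp [Set.mem_pi]
  rw [this, noise, Measure.infinitePi_pi (fun _ => q.toMeasure)
    fun i _ => MeasurableSet.singleton _]
  exact Finset.prod_congr rfl fun i _ => q.toMeasure_apply_singleton _ (.singleton _)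

lemma noise_coord (q : PMF A) (i : ι) (a : A) : noise ι q {y | y i = a} = q a := by
  have := noise_cylinder q {i} fun _ => a
  simpa using this

variable [Finite A]

lemma EventOn.measurableSet {J : Finset ι} {E : Set (ι → A)} (h : EventOn J E) :
    MeasurableSet E := by
  rw [h.eq_preimage]
  exact (Finset.measurable_restrict J) (Set.toFinite _).measurableSet

lemma noise_inter_of_disjoint (q : PMF A) {J K : Finset ι} {E F : Set (ι → A)}
    (hE : EventOn J E) (hF : EventOn K F) (hJK : Disjoint J K) :
    noise ι q (E ∩ F) = noise ι q E * noise ι q F := by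
  have h1 := ProbabilityTheory.iIndepFun_infinitePi (P := fun _ : ι => q.toMeasure)
    (X := fun _ a => a) (fun _ => measurable_id)
  have h2 := h1.indepFun_finset J K hJK fun i => measurable_pi_apply i
  have h3 := h2.measure_inter_preimage_eq_mul (J.restrict '' E) (K.restrict '' F)
    (Set.toFinite _).measurableSet (Set.toFinite _).measurableSet
  have e1 := hE.eq_preimage
  have e2 := hF.eq_preimage
  conv_lhs => rw [e1, e2]
  conv_rhs => rw [e1, e2]
  exact h3

/-- Decomposition of an event according to the value of one coordinate on which the remaining
randomness does not depend. -/
lemma noise_eq_sum_coord {A : Type*} [Fintype A] [MeasurableSpace A] [MeasurableSingletonClass A]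
    (q : PMF A) {J : Finset ι} {i : ι} (hi : i ∉ J) {E : Set (ι → A)}
    {F : A → Set (ι → A)} (hF : ∀ a, EventOn J (F a)) (hE : ∀ y, y ∈ E ↔ y ∈ F (y i)) :
    noise ι q E = ∑ a, q a * noise ι q (F a) := by
  have hcoord : ∀ a, EventOn {i} {y : ι → A | y i = a} := fun a y y' hy h => by
    have := hy i (Finset.mem_singleton_self i)
    simpa [← this] using h
  have e : E = ⋃ a ∈ (Finset.univ : Finset A), ({y | y i = a} ∩ F a) := by
    ext y; simp [hE y]
  rw [e, measure_biUnion_finset]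
  · refine Finset.sum_congr rfl fun a _ => ?_
    rw [noise_inter_of_disjoint q (hcoord a) (hF a) (by simpa using hi), noise_coord]
  · intro a _ b _ hab
    refine Set.disjoint_left.2 fun y hy hy' => hab ?_
    exact hy.1.symm.trans hy'.1
  · exact fun a _ => (hcoord a).measurableSet.inter (hF a).measurableSet

end Noise

section RunLaw

variable {V A S : Type*} {f : V → A → (V → S) → S}

lemma eventOn_run (l : List (V × ℕ)) {J : Finset (V × ℕ)} (hJ : ∀ p ∈ l, p ∈ J)
    {h : (V × ℕ → A) → V → S} (hh : ∀ E, EventOn J (h ⁻¹' E)) (E : Set (V → S)) :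
    EventOn J {y | run f y l (h y) ∈ E} := by
  intro y y' hy hm
  have e : h y' = h y := hh {h y} y y' hy rfl
  change run f y' l (h y') ∈ E
  rw [e, ← run_congr (fun p hp => hy p (hJ p hp))]
  exact hm

lemma eventOn_run_const (l : List (V × ℕ)) {J : Finset (V × ℕ)} (hJ : ∀ p ∈ l, p ∈ J)
    (ξ : V → S) (E : Set (V → S)) : EventOn J {y | run f y l ξ ∈ E} :=
  eventOn_run l hJ (h := fun _ => ξ) (fun _ _ _ _ h => h) E

variable [Fintype A] [MeasurableSpace A] [MeasurableSingletonClass A] {q : PMF A}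

/-- If the random initial configuration `h` has law `p` and is independent of the noise used along
the list `l`, then the final configuration has law `p.bind (runLaw q f l)`. -/
lemma noise_run (l : List (V × ℕ)) (hl : l.Nodup) {J : Finset (V × ℕ)} (hJ : ∀ p ∈ l, p ∉ J)
    {h : (V × ℕ → A) → V → S} (hh : ∀ E, EventOn J (h ⁻¹' E)) {p : PMF (V → S)}
    (hp : ∀ E, noise _ q (h ⁻¹' E) = p.toOuterMeasure E) (E : Set (V → S)) :
    noise _ q {y | run f y l (h y) ∈ E} = (p.bind (runLaw q f l)).toOuterMeasure E := by
  induction l generalizing E with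
  | nil =>
    have h0 : p.bind (runLaw q f []) = p := PMF.bind_pure p
    rw [h0]
    exact hp E
  | cons x l ih =>
    rw [List.nodup_cons] at hl
    simp only [List.mem_cons, forall_eq_or_imp] at hJ
    have ih' := ih hl.2 hJ.2
    simp only [runLaw]
    rw [← PMF.bind_bind, bind_stepLaw_apply]
    rw [noise_eq_sum_coord q (J := J ∪ l.toFinset) (i := x) (by simp [hJ.1, hl.1])
      (F := fun a => {y | run f y l (h y) ∈ {σ | Function.update σ x.1 (f x.1 a σ) ∈ E}})]
    · exact Finset.sum_congr rfl fun a _ => by rw [ih']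
    · exact fun a => eventOn_run l (fun p hp => by simp [hp])
        (fun E => (hh E).mono Finset.subset_union_left) _
    · exact fun y => Iff.rfl

lemma noise_run_const (l : List (V × ℕ)) (hl : l.Nodup) (ξ : V → S) (E : Set (V → S)) :
    noise _ q {y | run f y l ξ ∈ E} = (runLaw q f l ξ).toOuterMeasure E := by
  have := noise_run (q := q) (f := f) l hl (J := ∅) (by simp) (h := fun _ => ξ)
    (fun _ _ _ _ h => h) (p := PMF.pure ξ) (fun E => ?_) E
  · simpa using this
  · rw [PMF.toOuterMeasure_pure_apply]
    by_cases h : ξ ∈ E <;> simp [h]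

end RunLaw

/-! ### Comparison with the stationary measures -/

section Average

variable {Ω α : Type*} [MeasurableSpace Ω] (μ : Measure Ω) (p : PMF α) {E : α → Set Ω}

lemma toOuterMeasure_eq_tsum_support (s : Set α) :
    p.toOuterMeasure s = ∑' x : p.support, s.indicator p x := by
  rw [PMF.toOuterMeasure_apply, tsum_subtype p.support fun x => s.indicator p x]
  refine tsum_congr fun x => ?_
  by_cases hx : x ∈ p.support
  · rw [Set.indicator_of_mem hx]
  · rw [Set.indicator_of_notMem hx, Set.indicator_apply, (p.apply_eq_zero_iff x).2 hx]; simp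

/-- The probability under `p` of a random event depends measurably on the randomness. -/
lemma measurable_average (hE : ∀ x, MeasurableSet (E x)) :
    Measurable fun ω => p.toOuterMeasure {x | ω ∈ E x} := by
  have : Countable p.support := p.support_countable.to_subtype
  simp_rw [toOuterMeasure_eq_tsum_support]
  refine Measurable.tsum fun x => ?_
  have : (fun ω => ({x | ω ∈ E x} : Set α).indicator p (x : α)) =
      (E x).indicator fun _ => p (x : α) := by
    funext ω
    by_cases h : ω ∈ E x <;> simp [Set.indicator, h]
  rw [this]
  exact measurable_const.indicator (hE x)

lemma lintegral_average (hE : ∀ x, MeasurableSet (E x)) :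
    ∫⁻ ω, p.toOuterMeasure {x | ω ∈ E x} ∂μ = ∑' x, p x * μ (E x) := by
  have : Countable p.support := p.support_countable.to_subtype
  have hind : ∀ x : α, (fun ω => ({x | ω ∈ E x} : Set α).indicator p x) =
      (E x).indicator fun _ => p x := by
    intro x
    funext ω
    by_cases h : ω ∈ E x <;> simp [Set.indicator, h]
  simp_rw [toOuterMeasure_eq_tsum_support]
  rw [lintegral_tsum fun x => ?_]
  · have h1 : ∀ x : p.support, ∫⁻ ω, ({x | ω ∈ E x} : Set α).indicator p (x : α) ∂μ =
        p x * μ (E x) := fun x => by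
      rw [hind x, lintegral_indicator (hE x), setLIntegral_const]
    rw [tsum_congr h1, tsum_subtype p.support fun x => p x * μ (E x)]
    refine tsum_congr fun x => ?_
    by_cases hx : x ∈ p.support
    · rw [Set.indicator_of_mem hx]
    · rw [Set.indicator_of_notMem hx, (p.apply_eq_zero_iff x).2 hx, zero_mul]
  · rw [hind x]
    exact (measurable_const.indicator (hE x)).aemeasurable

end Average

section Influence

variable {V A S : Type*} [Fintype A] [MeasurableSpace A] [MeasurableSingletonClass A]
  [Preorder S] [BoundedOrder S] {ρ : UpDownSpec V S} {q : PMF A} {f : V → A → (V → S) → S}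

/-- Run the stationary chain in `Λ`, then raise the spins off `B` to the maximum and run the chain
in `B`: the resulting law is dominated by the stationary measure of `B`. -/
lemma lintegral_raiseOff_le (H : HeatBath ρ q f) (hρ : ρ.Monotonic) {B Λ : Finset V}
    (hB : B ⊆ Λ) {l l' : List (V × ℕ)} (hl : ∀ p ∈ l, p.1 ∈ B) (hl' : ∀ p ∈ l', p.1 ∈ Λ)
    (hn : (l ++ l').Nodup) {E : Set (V → S)} (hE : IsUpperSet E) :
    ∫⁻ y, (ρ.meas Λ ⊤).toOuterMeasure {ξ | run f y l (raiseOff B (run f y l' ξ)) ∈ E}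
      ∂(noise (V × ℕ) q) ≤ (ρ.meas B ⊤).toOuterMeasure E := by
  rw [List.nodup_append'] at hn
  have hev : ∀ ξ E', EventOn l'.toFinset ((fun y => raiseOff B (run f y l' ξ)) ⁻¹' E') :=
    fun ξ E' => eventOn_run_const (f := f) l' (by simp) ξ (raiseOff B ⁻¹' E')
  have hlaw : ∀ ξ, noise (V × ℕ) q {y | run f y l (raiseOff B (run f y l' ξ)) ∈ E} =
      (((runLaw q f l' ξ).map (raiseOff B)).bind (runLaw q f l)).toOuterMeasure E := fun ξ =>
    noise_run l hn.1 (J := l'.toFinset) (fun p hp hp' => hn.2.2 hp (by simpa using hp'))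
      (hev ξ) (fun E' => by
        rw [PMF.toOuterMeasure_map_apply, ← noise_run_const l' hn.2.1]; rfl) E
  refine (lintegral_average (noise (V × ℕ) q) (ρ.meas Λ ⊤)
    (E := fun ξ => {y | run f y l (raiseOff B (run f y l' ξ)) ∈ E}) ?_).trans_le ?_
  rotate_left
  · simp_rw [hlaw]
    rw [← PMF.toOuterMeasure_bind_apply, ← PMF.bind_bind, ← PMF.map_bind,
      H.bind_runLaw top_mem_upDownConfig hl', ← H.bind_runLaw top_mem_upDownConfig hl]
    refine (hρ.map_raiseOff_le hB top_mem_upDownConfig).bind_runLaw H.mono ?_ ?_ l E hE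
    · intro σ hσ
      obtain ⟨ξ, -, rfl⟩ := (PMF.mem_support_map_iff _ _ _).1 hσ
      exact raiseOff_mem B ξ
    · exact fun σ hσ => ρ.mem_of_mem_support top_mem_upDownConfig hσ
  · exact fun ξ => (eventOn_run (f := f) l (J := l.toFinset ∪ l'.toFinset)
      (fun p hp => Finset.mem_union_left _ (List.mem_toFinset.2 hp))
      (fun E' => (hev ξ E').mono Finset.subset_union_right) E).measurableSet

lemma lintegral_lowerOff_le (H : HeatBath ρ q f) (hρ : ρ.Monotonic) {B Λ : Finset V}
    (hB : B ⊆ Λ) {l l' : List (V × ℕ)} (hl : ∀ p ∈ l, p.1 ∈ B) (hl' : ∀ p ∈ l', p.1 ∈ Λ)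
    (hn : (l ++ l').Nodup) {E : Set (V → S)} (hE : IsLowerSet E) :
    ∫⁻ y, (ρ.meas Λ ⊥).toOuterMeasure {ξ | run f y l (lowerOff B (run f y l' ξ)) ∈ E}
      ∂(noise (V × ℕ) q) ≤ (ρ.meas B ⊥).toOuterMeasure E :=
  lintegral_raiseOff_le (S := Sᵒᵈ) H.dual hρ.dual hB hl hl' hn
    (E := E) fun _ _ hab ha => hE hab ha

lemma toOuterMeasure_eq_one {α : Type*} (p : PMF α) {E : Set α} (h : p.support ⊆ E) :
    p.toOuterMeasure E = 1 := (PMF.toOuterMeasure_apply_eq_one_iff p E).2 h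

variable {S : Type*} [PartialOrder S] [BoundedOrder S] {ρ : UpDownSpec V S}
  {f : V → A → (V → S) → S}

/-- The extremal chains started in the volume `Λ` agree on `B` before slice `i + m`, but disagree
at `w` after slice `i`. -/
def influence (f : V → A → (V → S) → S) (o : Schedule V) (B Λ : Finset V) (i m n : ℕ) (w : V) :
    Set (V × ℕ → A) :=
  {y | ∀ v ∈ B, y ∉ disagree f o Λ (i + m) n v} ∩ disagree f o Λ i (m + n) w

/-- The influence of the boundary of `B` on the event `s ≤ σ w`. Both extremal chains are compared
with chains in `B` that are stationary up to a monotone change of their starting point: after the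
extremal chains have merged on `B`, the stationary starting points are irrelevant, and otherwise
the comparison costs nothing. -/
lemma noise_influence_threshold_le (H : HeatBath ρ q f) (hρ : ρ.Monotonic) (o : Schedule V)
    {B Λ : Finset V} (hB : B ⊆ Λ) (i m n : ℕ) (w : V) (s : S) :
    noise (V × ℕ) q ({y | ∀ v ∈ B, y ∉ disagree f o Λ (i + m) n v} ∩
        {y | s ≤ run f y (o.path Λ i (m + n)) ⊤ w ∧ ¬ s ≤ run f y (o.path Λ i (m + n)) ⊥ w}) + 1 ≤
      (ρ.meas B ⊤).toOuterMeasure {σ | s ≤ σ w} +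
        (ρ.meas B ⊥).toOuterMeasure {σ | ¬ s ≤ σ w} := by
  set l := o.path B i m
  set l' := o.path Λ (i + m) n with hl'
  set bad := {y | ∀ v ∈ B, y ∉ disagree f o Λ (i + m) n v} ∩
    {y | s ≤ run f y (o.path Λ i (m + n)) ⊤ w ∧ ¬ s ≤ run f y (o.path Λ i (m + n)) ⊥ w}
  have hl1 : ∀ p ∈ l, p.1 ∈ B := fun p hp => (o.mem_path.1 hp).1
  have hl2 : ∀ p ∈ l', p.1 ∈ Λ := fun p hp => (o.mem_path.1 hp).1
  have hn : (l ++ l').Nodup := by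
    rw [List.nodup_append']
    refine ⟨o.path_nodup _ _ _, o.path_nodup _ _ _, fun p hp hp' => ?_⟩
    have h1 := (o.mem_path.1 hp).2.2
    have h2 := (o.mem_path.1 hp').2.1
    omega
  set F : (V × ℕ → A) → ℝ≥0∞ := fun y => (ρ.meas Λ ⊤).toOuterMeasure
    {ξ | run f y l (raiseOff B (run f y l' ξ)) ∈ {σ : V → S | s ≤ σ w}}
  set F' : (V × ℕ → A) → ℝ≥0∞ := fun y => (ρ.meas Λ ⊥).toOuterMeasure
    {ξ | run f y l (lowerOff B (run f y l' ξ)) ∈ {σ : V → S | ¬ s ≤ σ w}}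
  -- pointwise in the noise: on `bad` all starting points give the same spins on `B`, so both terms
  -- on the right equal `1`; off `bad` the two terms cover every starting point
  have hpt : ∀ y, bad.indicator (fun _ => (1 : ℝ≥0∞)) y + 1 ≤ F y + F' y := by
    intro y
    by_cases hy : y ∈ bad
    · rw [Set.indicator_of_mem hy]
      obtain ⟨hagree, hs, hs'⟩ := hy
      have heq : ∀ ξ, ∀ v ∈ B, ξ ∈ upDownConfig V S →
          run f y l' ξ v = run f y l' ⊤ v ∧ run f y l' ξ v = run f y l' ⊥ v := by
        intro ξ v hv hξ
        have h1 := run_mono (y := y) H.mono hξ top_mem_upDownConfig le_top l' v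
        have h2 := run_mono (y := y) H.mono bot_mem_upDownConfig hξ bot_le l' v
        have h3 : run f y l' ⊤ v = run f y l' ⊥ v := not_not.1 (hagree v hv)
        exact ⟨le_antisymm h1 (h3 ▸ h2), le_antisymm (h3 ▸ h1) h2⟩
      rw [o.path_add, run_append] at hs hs'
      refine add_le_add (le_of_eq ?_) (le_of_eq ?_)
      · refine (toOuterMeasure_eq_one _ fun ξ hξ => ?_).symm
        have hξ' := ρ.mem_of_mem_support top_mem_upDownConfig hξ
        refine hs.trans ?_
        rw [raiseOff_congr (fun v hv => (heq ξ v hv hξ').1)]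
        exact run_path_le_raiseOff o H.mono hB i m (run_mem top_mem_upDownConfig _) w
      · refine (toOuterMeasure_eq_one _ fun ξ hξ => ?_).symm
        have hξ' := ρ.mem_of_mem_support bot_mem_upDownConfig hξ
        refine fun h => hs' (h.trans ?_)
        rw [lowerOff_congr (fun v hv => (heq ξ v hv hξ').2)]
        exact lowerOff_run_path_le o H.mono hB i m (run_mem bot_mem_upDownConfig _) w
    · rw [Set.indicator_of_notMem hy, zero_add]
      have h1 : (ρ.meas Λ ⊥).toOuterMeasure
          {ξ | run f y l (raiseOff B (run f y l' ξ)) ∈ {σ : V → S | s ≤ σ w}} ≤ F y := by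
        refine (hρ Λ ⊥ bot_mem_upDownConfig ⊤ top_mem_upDownConfig bot_le).apply_le
          (fun σ hσ => ρ.mem_of_mem_support bot_mem_upDownConfig hσ)
          (fun σ hσ => ρ.mem_of_mem_support top_mem_upDownConfig hσ)
          fun σ hσ σ' hσ' hle hm => ?_
        refine le_trans (a := s) hm ?_
        exact run_mono H.mono (raiseOff_mem _ _) (raiseOff_mem _ _)
          (raiseOff_mono B (run_mono H.mono hσ hσ' hle l')) l w
      refine le_trans (le_of_eq ?_) ((measure_union_le _ _).trans (add_le_add h1 le_rfl))
      refine (toOuterMeasure_eq_one _ fun ξ hξ => ?_).symm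
      by_cases hc : s ≤ run f y l (lowerOff B (run f y l' ξ)) w
      · refine Or.inl (le_trans (a := s) hc ?_)
        exact run_mono H.mono (lowerOff_mem _ _) (raiseOff_mem _ _)
          (lowerOff_le_raiseOff B _) l w
      · exact Or.inr hc
  have hbad : MeasurableSet bad := by
    refine EventOn.measurableSet (J := (o.path Λ i (m + n)).toFinset) ?_
    refine EventOn.inter (fun y y' hy h v hv hd => h v hv ?_) (fun y y' hy h => ?_)
    · have e : ∀ ξ : V → S, run f y l' ξ = run f y' l' ξ := fun ξ => run_congr (fun p hp => hy p (by
        rw [List.mem_toFinset, o.path_add]; exact List.mem_append_right _ hp)) ξ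
      change run f y l' ⊤ v ≠ run f y l' ⊥ v
      rw [e, e]; exact hd
    · have e : ∀ ξ : V → S, run f y (o.path Λ i (m + n)) ξ = run f y' (o.path Λ i (m + n)) ξ :=
        fun ξ => run_congr (fun p hp => hy p (by simpa using hp)) ξ
      change s ≤ run f y' _ ⊤ w ∧ ¬ s ≤ run f y' _ ⊥ w
      rw [← e, ← e]; exact h
  have hF : Measurable F := measurable_average (ρ.meas Λ ⊤)
    (E := fun ξ => {y | run f y l (raiseOff B (run f y l' ξ)) ∈ {σ : V → S | s ≤ σ w}})
    fun ξ => (eventOn_run (f := f) l (J := l.toFinset ∪ l'.toFinset)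
      (fun p hp => Finset.mem_union_left _ (List.mem_toFinset.2 hp))
      (fun E' => (eventOn_run_const (f := f) l'
        (fun p hp => Finset.mem_union_right _ (List.mem_toFinset.2 hp)) ξ
        (raiseOff B ⁻¹' E'))) _).measurableSet
  calc noise (V × ℕ) q bad + 1
      = ∫⁻ y, (bad.indicator (fun _ => (1 : ℝ≥0∞)) y + 1) ∂(noise (V × ℕ) q) := by
        rw [lintegral_add_right _ measurable_const, lintegral_indicator hbad]
        simp
    _ ≤ ∫⁻ y, (F y + F' y) ∂(noise (V × ℕ) q) := lintegral_mono hpt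
    _ = ∫⁻ y, F y ∂(noise (V × ℕ) q) + ∫⁻ y, F' y ∂(noise (V × ℕ) q) :=
        lintegral_add_left hF _
    _ ≤ _ := add_le_add
        (lintegral_raiseOff_le H hρ hB hl1 hl2 hn fun σ σ' hle (h : s ≤ σ w) => h.trans (hle w))
        (lintegral_lowerOff_le H hρ hB hl1 hl2 hn fun σ σ' hle (h : ¬ s ≤ σ w) h' =>
          h (h'.trans (hle w)))

end Influence

section TotalVariation

variable {S : Type*} [Fintype S]

lemma tvDist_nonneg (p p' : PMF S) : 0 ≤ tvDist p p' := by
  unfold tvDist; positivity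

/-- The two probabilities of complementary events exceed `1` by at most the `ℓ¹` distance. -/
lemma toOuterMeasure_add_compl_le (p p' : PMF S) (E : Set S) :
    p.toOuterMeasure E + p'.toOuterMeasure Eᶜ ≤ 1 + ENNReal.ofReal (2 * tvDist p p') := by
  have hs : ∀ r : PMF S, ∀ F : Set S, r.toOuterMeasure F =
      ENNReal.ofReal (∑ s, F.indicator (fun s => (r s).toReal) s) := by
    intro r F
    rw [PMF.toOuterMeasure_apply_fintype, ENNReal.ofReal_sum_of_nonneg fun s _ =>
      Set.indicator_nonneg (fun _ _ => ENNReal.toReal_nonneg) s]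
    refine Finset.sum_congr rfl fun s _ => ?_
    by_cases h : s ∈ F <;> simp [h, r.apply_ne_top]
  have h1 : ∑ s, (p' s).toReal = 1 := by
    rw [← ENNReal.toReal_sum fun s _ => p'.apply_ne_top s, ← tsum_fintype (L := .unconditional S),
      p'.tsum_coe, ENNReal.toReal_one]
  have hnn : ∀ r : PMF S, ∀ F : Set S, 0 ≤ ∑ s, F.indicator (fun s => (r s).toReal) s :=
    fun r F => Finset.sum_nonneg fun s _ =>
      Set.indicator_nonneg (fun _ _ => ENNReal.toReal_nonneg) s
  rw [hs, hs, ← ENNReal.ofReal_add (hnn _ _) (hnn _ _), ← ENNReal.ofReal_one,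
    ← ENNReal.ofReal_add zero_le_one (by linarith [tvDist_nonneg p p'])]
  refine ENNReal.ofReal_le_ofReal ?_
  rw [← Finset.sum_add_distrib, ← h1, tvDist, ← mul_assoc]
  norm_num
  rw [← Finset.sum_add_distrib]
  refine Finset.sum_le_sum fun s _ => ?_
  by_cases h : s ∈ E
  · simp only [Set.indicator_of_mem h, Set.indicator_of_notMem (fun h' : s ∈ Eᶜ => h' h)]
    linarith [le_abs_self ((p s).toReal - (p' s).toReal)]
  · simp only [Set.indicator_of_notMem h, Set.indicator_of_mem (Set.mem_compl h)]
    linarith [abs_nonneg ((p s).toReal - (p' s).toReal)]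

lemma marginal_apply {V S : Type*} (p : PMF (V → S)) (v : V) (E : Set S) :
    (marginal p v).toOuterMeasure E = p.toOuterMeasure {σ | σ v ∈ E} :=
  PMF.toOuterMeasure_map_apply _ _ _

end TotalVariation

section Threshold

variable {V A S : Type*} [LinearOrder S] [BoundedOrder S] {f : V → A → (V → S) → S}
  {o : Schedule V}

/-- A disagreement of ordered configurations is seen by some threshold event. -/
lemma disagree_subset_threshold (hf : MonotoneRule f) (Λ : Finset V) (i n : ℕ) (v : V) :
    disagree f o Λ i n v ⊆ ⋃ s : S, {y | s ≤ run f y (o.path Λ i n) ⊤ v ∧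
      ¬ s ≤ run f y (o.path Λ i n) ⊥ v} := by
  intro y hy
  refine Set.mem_iUnion.2 ⟨run f y (o.path Λ i n) ⊤ v, le_rfl, fun h => hy (le_antisymm h ?_)⟩
  exact run_mono hf bot_mem_upDownConfig top_mem_upDownConfig bot_le _ v

lemma eventOn_disagree (Λ : Finset V) (i n : ℕ) (v : V) {J : Finset (V × ℕ)}
    (hJ : ∀ p ∈ o.path Λ i n, p ∈ J) : EventOn J (disagree f o Λ i n v) := by
  intro y y' hy h
  have e : ∀ ξ : V → S, run f y (o.path Λ i n) ξ = run f y' (o.path Λ i n) ξ :=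
    fun ξ => run_congr (fun p hp => hy p (hJ p hp)) ξ
  change run f y' _ ⊤ v ≠ run f y' _ ⊥ v
  rw [← e, ← e]; exact h

variable [Fintype S] [Fintype A] [MeasurableSpace A] [MeasurableSingletonClass A]
  {ρ : UpDownSpec V S} {q : PMF A}

lemma boundary_threshold_le (B : Finset V) (w : V) (s : S) :
    (ρ.meas B ⊤).toOuterMeasure {σ | s ≤ σ w} + (ρ.meas B ⊥).toOuterMeasure {σ | ¬ s ≤ σ w} ≤
      1 + ENNReal.ofReal
        (2 * tvDist (marginal (ρ.meas B ⊤) w) (marginal (ρ.meas B ⊥) w)) := by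
  have := toOuterMeasure_add_compl_le (marginal (ρ.meas B ⊤) w) (marginal (ρ.meas B ⊥) w)
    {t | s ≤ t}
  rwa [marginal_apply, marginal_apply] at this

/-- Once the extremal chains agree on `B`, only the boundary of `B` can make them disagree at `w`
later on, which is at most as likely as in the stationary measures of `B`. -/
lemma noise_influence_le (H : HeatBath ρ q f) (hρ : ρ.Monotonic)
    {B Λ : Finset V} (hB : B ⊆ Λ) (i m n : ℕ) (w : V) :
    noise (V × ℕ) q (influence f o B Λ i m n w) ≤ Fintype.card S * ENNReal.ofReal
      (2 * tvDist (marginal (ρ.meas B ⊤) w) (marginal (ρ.meas B ⊥) w)) := by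
  refine (measure_mono (Set.inter_subset_inter_right _
    (disagree_subset_threshold H.mono Λ i (m + n) w))).trans ?_
  rw [Set.inter_iUnion]
  refine (measure_iUnion_fintype_le _ _).trans ?_
  rw [← nsmul_eq_mul, ← Finset.card_univ]
  refine Finset.sum_le_card_nsmul _ _ _ fun s _ => ?_
  refine (ENNReal.add_le_add_iff_right ENNReal.one_ne_top).1 ?_
  rw [add_comm _ (1 : ℝ≥0∞), add_comm _ (1 : ℝ≥0∞)]
  refine le_trans ?_ (boundary_threshold_le B w s)
  rw [add_comm]
  exact noise_influence_threshold_le H hρ o hB i m n w s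

end Threshold

/-! ### Mixing in a finite volume -/

section Mixing

variable {V A S : Type*} {q : PMF A} {f : V → A → (V → S) → S}

/-- The smallest positive probability of a noise symbol. -/
def minProb (q : PMF A) : ℝ≥0∞ := ⨅ a ∈ q.support, q a

lemma minProb_le {a : A} (h : a ∈ q.support) : minProb q ≤ q a := iInf₂_le a h

lemma minProb_le_one : minProb q ≤ 1 := by
  obtain ⟨a, ha⟩ := q.support_nonempty
  exact (minProb_le ha).trans (q.coe_le_one a)

lemma minProb_pos [Finite A] : 0 < minProb q := by
  obtain ⟨a₀, ha₀⟩ := q.support_nonempty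
  obtain ⟨a, ha, h⟩ := Set.exists_min_image q.support q (Set.toFinite _) ⟨a₀, ha₀⟩
  exact lt_of_lt_of_le ((q.apply_pos_iff a).2 ha) (le_iInf₂ h)

lemma pow_le_runLaw {l : List (V × ℕ)} {ξ ω : V → S} (h : ω ∈ (runLaw q f l ξ).support) :
    minProb q ^ l.length ≤ runLaw q f l ξ ω := by
  induction l generalizing ω with
  | nil =>
    have : ω = ξ := by simpa [runLaw] using h
    simp [runLaw, this]
  | cons p l ih =>
    obtain ⟨σ, hσ, hω⟩ := (PMF.mem_support_bind_iff _ _ _).1 h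
    obtain ⟨a, ha, rfl⟩ := (PMF.mem_support_map_iff _ _ _).1 hω
    rw [List.length_cons, pow_succ, runLaw, PMF.bind_apply]
    refine le_trans ?_ (ENNReal.le_tsum σ)
    refine mul_le_mul' (ih hσ) ((minProb_le ha).trans ?_)
    rw [stepLaw, PMF.map_apply]
    refine le_trans ?_ (ENNReal.le_tsum a)
    simp

variable [PartialOrder S] [BoundedOrder S] {ρ : UpDownSpec V S} (o : Schedule V) {Λ : Finset V}

lemma HeatBath.support_runLaw_subset (H : HeatBath ρ q f) {τ ξ : V → S}
    (hτ : τ ∈ upDownConfig V S) {l : List (V × ℕ)} (hl : ∀ p ∈ l, p.1 ∈ Λ)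
    (hξ : ξ ∈ (ρ.meas Λ τ).support) : (runLaw q f l ξ).support ⊆ (ρ.meas Λ τ).support := by
  intro ω hω
  rw [← H.bind_runLaw hτ hl]
  exact (PMF.mem_support_bind_iff _ _ _).2 ⟨ξ, hξ, hω⟩

lemma HeatBath.mem_support_stepLaw (H : HeatBath ρ q f) {τ σ σ' : V → S}
    (hτ : τ ∈ upDownConfig V S) (hσ : σ ∈ (ρ.meas Λ τ).support)
    (hσ' : σ' ∈ (ρ.meas Λ τ).support) {v : V} (hv : v ∈ Λ) (h : σ' ∈ agreeOff {v} σ) :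
    σ' ∈ (stepLaw q f v σ).support := by
  rw [H.stepLaw_eq v (ρ.mem_of_mem_support hτ hσ),
    ← ρ.meas_eq_filter (by simpa using hv) hτ hσ, PMF.support_filter]
  exact ⟨h, hσ'⟩

/-- In one sweep the chain can move across an edge of the Hamming graph, whatever the order of the
updates. -/
lemma HeatBath.mem_support_sweep (H : HeatBath ρ q f) {τ σ σ' : V → S}
    (hτ : τ ∈ upDownConfig V S) (hσ : σ ∈ (ρ.meas Λ τ).support)
    (hσ' : σ' ∈ (ρ.meas Λ τ).support) {v : V} (h : σ' ∈ agreeOff {v} σ) (i : ℕ) (l : List V)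
    (hl : l.Nodup) (hΛ : ∀ w ∈ l, w ∈ Λ) :
    (if v ∈ l then σ' else σ) ∈ (runLaw q f (l.map fun w => (w, i)) σ).support := by
  induction l with
  | nil => simp [runLaw]
  | cons w l ih =>
    rw [List.nodup_cons] at hl
    simp only [List.mem_cons, forall_eq_or_imp] at hΛ
    have ih' := ih hl.2 hΛ.2
    rw [List.map_cons, runLaw]
    refine (PMF.mem_support_bind_iff _ _ _).2 ⟨_, ih', ?_⟩
    by_cases hw : v = w
    · subst hw
      rw [if_neg hl.1, if_pos List.mem_cons_self]
      exact H.mem_support_stepLaw hτ hσ hσ' hΛ.1 h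
    · simp only [List.mem_cons, hw, false_or]
      split_ifs
      · exact H.mem_support_stepLaw hτ hσ' hσ' hΛ.1 (mem_agreeOff_self _ _)
      · exact H.mem_support_stepLaw hτ hσ hσ hΛ.1 (mem_agreeOff_self _ _)

lemma HeatBath.mem_support_path (H : HeatBath ρ q f) {τ : V → S} (hτ : τ ∈ upDownConfig V S)
    {σ σ' : (ρ.meas Λ τ).support}
    (w : ((hammingGraph V S).induce (ρ.meas Λ τ).support).Walk σ σ') (i n : ℕ)
    (hn : w.length ≤ n) :
    (σ' : V → S) ∈ (runLaw q f (o.path Λ i n) σ).support := by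
  have happ : ∀ l l' : List (V × ℕ), ∀ ξ : V → S,
      runLaw q f (l ++ l') ξ = (runLaw q f l' ξ).bind (runLaw q f l) := by
    intro l l' ξ
    induction l with
    | nil => exact (PMF.bind_pure _).symm
    | cons p l ih => simp only [List.cons_append, runLaw, ih, PMF.bind_bind]
  have hstay : ∀ (κ : (ρ.meas Λ τ).support) (i m : ℕ),
      (κ : V → S) ∈ (runLaw q f (o.path Λ i m) κ).support := by
    intro κ i m
    induction m generalizing i with
    | zero => simp [Schedule.path, runLaw]
    | succ m ih =>
      rw [Schedule.path, happ]
      refine (PMF.mem_support_bind_iff _ _ _).2 ⟨_, ih (i + 1), ?_⟩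
      by_cases hV : Nonempty V
      · obtain ⟨v⟩ := hV
        simpa using H.mem_support_sweep hτ κ.2 κ.2 (v := v) (mem_agreeOff_self _ _) i
          (o.order i Λ) (o.nodup i Λ) fun w hw => (o.mem_order i Λ w).1 hw
      · have : o.order i Λ = [] := by
          rw [List.eq_nil_iff_forall_not_mem]
          exact fun v => (hV ⟨v⟩).elim
        simp [this, runLaw]
  induction w generalizing n with
  | nil => exact hstay _ i n
  | @cons κ κ' κ'' hadj w ih =>
    obtain ⟨n, rfl⟩ : ∃ m, n = m + 1 := ⟨n - 1, by simp at hn; omega⟩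
    rw [SimpleGraph.Walk.length_cons] at hn
    rw [o.path_add, happ]
    refine (PMF.mem_support_bind_iff _ _ _).2 ⟨κ', ?_, ih n (by omega)⟩
    obtain ⟨v, hv, huniq⟩ : ∃! v, (κ : V → S) v ≠ (κ' : V → S) v := hadj
    have hoff : (κ' : V → S) ∈ agreeOff {v} (κ : V → S) := fun w hw => by
      by_contra hne
      exact hw (by simpa using huniq w (fun e => hne e.symm))
    have hvΛ : v ∈ Λ := by
      by_contra hvn
      exact hv ((ρ.support_subset Λ τ hτ κ.2 v hvn).trans
        (ρ.support_subset Λ τ hτ κ'.2 v hvn).symm)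
    have := H.mem_support_sweep hτ κ.2 κ'.2 hoff (i + n) (o.order (i + n) Λ)
      (o.nodup _ Λ) fun w hw => (o.mem_order _ Λ w).1 hw
    rw [if_pos ((o.mem_order _ Λ v).2 hvΛ)] at this
    simpa [Schedule.path] using this

variable [Fintype S]

/-- Starting from any state of the support, the chain reaches the maximal state within a number of
sweeps that depends only on the size of the volume, with probability bounded below. -/
lemma HeatBath.pow_le_runLaw_top (H : HeatBath ρ q f)
    (htop : (⊤ : V → S) ∈ (ρ.meas Λ ⊤).support)
    (hconn : ((hammingGraph V S).induce (ρ.meas Λ ⊤).support).Connected)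
    {b : ℕ} (hb : Λ.card ≤ b) (i : ℕ) {ξ : V → S} (hξ : ξ ∈ (ρ.meas Λ ⊤).support) :
    minProb q ^ (Fintype.card S ^ b * b) ≤
      runLaw q f (o.path Λ i (Fintype.card S ^ b)) ξ ⊤ := by
  have hfin : Finite (ρ.meas Λ ⊤).support :=
    (ρ.support_finite Λ top_mem_upDownConfig).to_subtype
  have := Fintype.ofFinite (ρ.meas Λ ⊤).support
  obtain ⟨w, hw⟩ := (hconn ⟨ξ, hξ⟩ ⟨⊤, htop⟩).exists_isPath
  have hlt := hw.length_lt
  have hcard : Fintype.card (ρ.meas Λ ⊤).support ≤ Fintype.card S ^ b := by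
    rw [← Nat.card_eq_fintype_card, Nat.card_coe_set_eq]
    refine (Set.ncard_le_ncard (ρ.support_subset Λ ⊤ top_mem_upDownConfig)
      (agreeOff_finite _ _)).trans ((agreeOff_ncard_le Λ _).trans ?_)
    have : 0 < Fintype.card S := Fintype.card_pos_iff.2 ⟨⊤⟩
    exact Nat.pow_le_pow_right this hb
  have hmem := H.mem_support_path o top_mem_upDownConfig w i (Fintype.card S ^ b) (by omega)
  refine le_trans ?_ (pow_le_runLaw hmem)
  rw [o.path_length]
  exact pow_le_pow_right_of_le_one' minProb_le_one (Nat.mul_le_mul le_rfl hb)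

variable [Fintype A] [MeasurableSpace A] [MeasurableSingletonClass A]

/-- The chain started from the maximal state couples with the chain started from any other state of
the support, exponentially fast in the number of sweeps. -/
lemma HeatBath.noise_ne_le (H : HeatBath ρ q f)
    (htop : (⊤ : V → S) ∈ (ρ.meas Λ ⊤).support)
    (hconn : ((hammingGraph V S).induce (ρ.meas Λ ⊤).support).Connected)
    {b : ℕ} (hb : Λ.card ≤ b) (k i : ℕ) {ξ : V → S} (hξ : ξ ∈ (ρ.meas Λ ⊤).support) :
    noise (V × ℕ) q {y | run f y (o.path Λ i (k * Fintype.card S ^ b)) ⊤ ≠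
        run f y (o.path Λ i (k * Fintype.card S ^ b)) ξ} ≤
      (1 - minProb q ^ (Fintype.card S ^ b * b)) ^ k := by
  set N := Fintype.card S ^ b with hN
  set ε := minProb q ^ (N * b)
  have hε : ε ≠ ⊤ := (pow_le_one' minProb_le_one _).trans_lt ENNReal.one_lt_top |>.ne
  induction k generalizing ξ with
  | zero => simpa using prob_le_one
  | succ k ih =>
    set l := o.path Λ i (k * N)
    set l' := o.path Λ (i + k * N) N
    have hl' : ∀ p ∈ l', p.1 ∈ Λ := fun p hp => (o.mem_path.1 hp).1
    have hpath : o.path Λ i ((k + 1) * N) = l ++ l' := by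
      rw [add_mul, one_mul, o.path_add]
    set Z : Finset (V → S) := (agreeOff_finite Λ ⊤).toFinset.erase ⊤
    -- if the lower chain is at `⊤` after the first `N` slices, then both chains are, and they stay
    -- together; otherwise they can be restarted from `⊤` and from the current state `ζ ≠ ⊤`
    have hsub : {y | run f y (o.path Λ i ((k + 1) * N)) ⊤ ≠
        run f y (o.path Λ i ((k + 1) * N)) ξ} ⊆
        ⋃ ζ ∈ Z, ({y | run f y l' ξ ∈ ({ζ} : Set (V → S))} ∩
          {y | run f y l ⊤ ≠ run f y l ζ}) := by
      intro y hy
      change run f y _ ⊤ ≠ run f y _ ξ at hy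
      rw [hpath, run_append, run_append] at hy
      have hξ' := ρ.mem_of_mem_support top_mem_upDownConfig hξ
      have hle := run_mono (y := y) H.mono hξ' top_mem_upDownConfig le_top l'
      refine Set.mem_iUnion₂.2 ⟨run f y l' ξ, ?_, rfl, ?_⟩
      · refine Finset.mem_erase.2 ⟨fun e => hy ?_, ?_⟩
        · have : run f y l' ⊤ = ⊤ := top_le_iff.1 (e ▸ hle)
          rw [e, this]
        · rw [Set.Finite.mem_toFinset]
          exact run_mem_agreeOff hl' (ρ.support_subset Λ ⊤ top_mem_upDownConfig hξ)
      · intro e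
        refine hy (le_antisymm ?_ ?_)
        · rw [← e]
          exact run_mono H.mono (run_mem top_mem_upDownConfig _) top_mem_upDownConfig le_top l
        · exact run_mono H.mono (run_mem hξ' _) (run_mem top_mem_upDownConfig _) hle l
    have hdisj : Disjoint l'.toFinset l.toFinset := by
      refine Finset.disjoint_left.2 fun p hp hp' => ?_
      have h1 := (o.mem_path.1 (List.mem_toFinset.1 hp)).2.1
      have h2 := (o.mem_path.1 (List.mem_toFinset.1 hp')).2.2
      omega
    have hterm : ∀ ζ ∈ Z, noise (V × ℕ) q ({y | run f y l' ξ ∈ ({ζ} : Set (V → S))} ∩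
        {y | run f y l ⊤ ≠ run f y l ζ}) ≤ runLaw q f l' ξ ζ * (1 - ε) ^ k := by
      intro ζ _
      have hev : EventOn l.toFinset {y | run f y l ⊤ ≠ run f y l ζ} := fun y y' hy h => by
        have e : ∀ κ, run f y l κ = run f y' l κ :=
          fun κ => run_congr (fun p hp => hy p (by simpa using hp)) κ
        change run f y' l ⊤ ≠ run f y' l ζ
        rw [← e, ← e]; exact h
      rw [noise_inter_of_disjoint q (eventOn_run_const l' (by simp) ξ {ζ}) hev hdisj,
        noise_run_const l' (o.path_nodup _ _ _), PMF.toOuterMeasure_apply_singleton]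
      by_cases hζ : ζ ∈ (runLaw q f l' ξ).support
      · exact mul_le_mul' le_rfl
          (ih (H.support_runLaw_subset top_mem_upDownConfig hl' hξ hζ))
      · rw [(PMF.apply_eq_zero_iff _ _).2 hζ]; simp
    refine (measure_mono hsub).trans ((measure_biUnion_finset_le _ _).trans
      ((Finset.sum_le_sum hterm).trans ?_))
    rw [← Finset.sum_mul, pow_succ, mul_comm]
    refine mul_le_mul' le_rfl (ENNReal.le_sub_of_add_le_right hε ?_)
    have h1 := H.pow_le_runLaw_top o htop hconn hb (i + k * N) hξ
    calc ∑ ζ ∈ Z, runLaw q f l' ξ ζ + ε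
        ≤ ∑ ζ ∈ Z, runLaw q f l' ξ ζ + runLaw q f l' ξ ⊤ := add_le_add le_rfl h1
      _ = ∑ ζ ∈ (agreeOff_finite Λ (⊤ : V → S)).toFinset, runLaw q f l' ξ ζ :=
          Finset.sum_erase_add _ _ (by simpa using mem_agreeOff_self Λ _)
      _ ≤ ∑' ζ, runLaw q f l' ξ ζ := ENNReal.sum_le_tsum _
      _ = 1 := PMF.tsum_coe _

/-- The chain started from the maximal state approaches the stationary measure. -/
lemma HeatBath.noise_top_le (H : HeatBath ρ q f)
    (htop : (⊤ : V → S) ∈ (ρ.meas Λ ⊤).support)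
    (hconn : ((hammingGraph V S).induce (ρ.meas Λ ⊤).support).Connected)
    {b : ℕ} (hb : Λ.card ≤ b) (k i : ℕ) (E : Set (V → S)) :
    noise (V × ℕ) q {y | run f y (o.path Λ i (k * Fintype.card S ^ b)) ⊤ ∈ E} ≤
      (ρ.meas Λ ⊤).toOuterMeasure E + (1 - minProb q ^ (Fintype.card S ^ b * b)) ^ k := by
  set l := o.path Λ i (k * Fintype.card S ^ b)
  set e := (1 - minProb q ^ (Fintype.card S ^ b * b)) ^ k
  have h1 : ∀ ξ ∈ (ρ.meas Λ ⊤).support, noise (V × ℕ) q {y | run f y l ⊤ ∈ E} ≤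
      (runLaw q f l ξ).toOuterMeasure E + e := by
    intro ξ hξ
    rw [← noise_run_const l (o.path_nodup _ _ _)]
    refine le_trans ?_ (add_le_add le_rfl (H.noise_ne_le o htop hconn hb k i hξ))
    refine le_trans (measure_mono fun y hy => ?_) (measure_union_le _ _)
    by_cases h : run f y l ⊤ = run f y l ξ
    · left; change run f y l ξ ∈ E; rw [← h]; exact hy
    · exact Or.inr h
  have h2 : ∑' ξ, ρ.meas Λ ⊤ ξ * noise (V × ℕ) q {y | run f y l ⊤ ∈ E} ≤
      ∑' ξ, (ρ.meas Λ ⊤ ξ * (runLaw q f l ξ).toOuterMeasure E + ρ.meas Λ ⊤ ξ * e) := by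
    refine ENNReal.tsum_le_tsum fun ξ => ?_
    by_cases hξ : ξ ∈ (ρ.meas Λ ⊤).support
    · rw [← mul_add]; exact mul_le_mul' le_rfl (h1 ξ hξ)
    · rw [(PMF.apply_eq_zero_iff _ _).2 hξ]; simp
  rw [ENNReal.tsum_add, ENNReal.tsum_mul_right, ENNReal.tsum_mul_right, PMF.tsum_coe, one_mul,
    one_mul, ← PMF.toOuterMeasure_bind_apply,
    H.bind_runLaw top_mem_upDownConfig fun p hp => (o.mem_path.1 hp).1] at h2
  exact h2

lemma HeatBath.noise_bot_le (H : HeatBath ρ q f)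
    (hbot : (⊥ : V → S) ∈ (ρ.meas Λ ⊥).support)
    (hconn : ((hammingGraph V S).induce (ρ.meas Λ ⊥).support).Connected)
    {b : ℕ} (hb : Λ.card ≤ b) (k i : ℕ) (E : Set (V → S)) :
    noise (V × ℕ) q {y | run f y (o.path Λ i (k * Fintype.card S ^ b)) ⊥ ∈ E} ≤
      (ρ.meas Λ ⊥).toOuterMeasure E + (1 - minProb q ^ (Fintype.card S ^ b * b)) ^ k :=
  H.dual.noise_top_le (S := Sᵒᵈ) o hbot hconn hb k i E

end Mixing

/-! ### Balls -/

section Balls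

variable {V : Type*} {G : SimpleGraph V} (hG : IsLocallyFinite G)

lemma mem_ballFinset {u v : V} {r : ℕ} : u ∈ ballFinset hG v r ↔ G.edist v u ≤ r := by
  simp [ballFinset, closedBall]

lemma self_mem_ballFinset (v : V) (r : ℕ) : v ∈ ballFinset hG v r := by
  simp [mem_ballFinset]

lemma ballFinset_subset {v w : V} {R t n : ℕ} (hw : w ∈ ballFinset hG v R) (h : R + t ≤ n) :
    ballFinset hG w t ⊆ ballFinset hG v n := by
  intro x hx
  rw [mem_ballFinset] at *
  calc G.edist v x ≤ G.edist v w + G.edist w x := SimpleGraph.edist_triangle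
    _ ≤ (R : ℕ∞) + t := add_le_add hw hx
    _ ≤ n := by exact_mod_cast h

lemma ballFinset_mono (v : V) {r s : ℕ} (h : r ≤ s) : ballFinset hG v r ⊆ ballFinset hG v s :=
  ballFinset_subset hG (self_mem_ballFinset hG v 0) (by omega)

lemma ballFinset_disjoint {v w : V} {R s t : ℕ} (hw : w ∉ ballFinset hG v R) (h : s + t ≤ R) :
    Disjoint (ballFinset hG v s) (ballFinset hG w t) := by
  refine Finset.disjoint_left.2 fun x hx hx' => hw ?_
  rw [mem_ballFinset] at *
  rw [SimpleGraph.edist_comm] at hx'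
  calc G.edist v w ≤ G.edist v x + G.edist x w := SimpleGraph.edist_triangle
    _ ≤ (s : ℕ∞) + t := add_le_add hx hx'
    _ ≤ R := by exact_mod_cast h

end Balls

/-! ### Disagreement of the chains in balls -/

section Recursion

variable {V A S : Type*} {G : SimpleGraph V} (hG : IsLocallyFinite G)
  [LinearOrder S] [BoundedOrder S] {f : V → A → (V → S) → S}
  {o : Schedule V}

/-- The extremal chains in the ball of radius `n` around `v`, run for `n` slices, disagree at
`v` after slice `i`. -/
def ballDisagree (f : V → A → (V → S) → S) (o : Schedule V) (i n : ℕ) (v : V) :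
    Set (V × ℕ → A) :=
  disagree f o (ballFinset hG v n) i n v

lemma disagree_subset_ballDisagree (hf : MonotoneRule f) {Λ : Finset V} {i m n : ℕ} {v : V}
    (hΛ : ballFinset hG v m ⊆ Λ) (h : m ≤ n) :
    disagree f o Λ i n v ⊆ ballDisagree hG f o i m v :=
  disagree_anti o hf hΛ i h v

/-- The space-time points that determine `ballDisagree`. -/
def box (v : V) (i n : ℕ) : Finset (V × ℕ) := ballFinset hG v n ×ˢ Finset.Ico i (i + n)

lemma eventOn_ballDisagree (i n : ℕ) (v : V) :
    EventOn (box hG v i n) (ballDisagree hG f o i n v) :=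
  eventOn_disagree _ i n v fun p hp => by
    have := o.mem_path.1 hp
    simp [box, this]

lemma box_subset_Ico {v : V} {i n a b : ℕ} (ha : a ≤ i) (hb : i + n ≤ b) {Λ : Finset V}
    (hΛ : ballFinset hG v n ⊆ Λ) : box hG v i n ⊆ Λ ×ˢ Finset.Ico a b :=
  Finset.product_subset_product hΛ (Finset.Ico_subset_Ico ha hb)

lemma disjoint_of_time {Λ Λ' : Finset V} {a b c d : ℕ} (h : b ≤ c) :
    Disjoint (Λ ×ˢ Finset.Ico a b) (Λ' ×ˢ Finset.Ico c d) := by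
  refine Finset.disjoint_left.2 fun p hp hp' => ?_
  simp only [Finset.mem_product, Finset.mem_Ico] at hp hp'
  omega

lemma eventOn_influence (B Λ : Finset V) (i m n : ℕ) (w : V) :
    EventOn (Λ ×ˢ Finset.Ico i (i + (m + n))) (influence f o B Λ i m n w) := by
  refine EventOn.inter (fun y y' hy h v hv hd => h v hv ?_)
    (eventOn_disagree _ _ _ _ fun p hp => ?_)
  · refine eventOn_disagree (o := o) (f := f) Λ (i + m) n v (J := Λ ×ˢ Finset.Ico i (i + (m + n)))
      (fun p hp => ?_) y' y (fun p hp => (hy p hp).symm) hd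
    have := o.mem_path.1 hp
    simp only [Finset.mem_product, Finset.mem_Ico]
    exact ⟨this.1, by omega, by omega⟩
  · have := o.mem_path.1 hp
    simp [this]

/-- A disagreement at `w` propagates from the ball of radius `R` around `w` or is caused by the
boundary of that ball. -/
lemma disagree_subset_influence {Λ B : Finset V} (i m n : ℕ) (w : V) :
    disagree f o Λ i (m + n) w ⊆ influence f o B Λ i m n w ∪
      ⋃ x ∈ B, disagree f o Λ (i + m) n x := by
  intro y hy
  by_cases h : ∀ x ∈ B, y ∉ disagree f o Λ (i + m) n x
  · exact Or.inl ⟨h, hy⟩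
  · push Not at h
    obtain ⟨x, hx, h⟩ := h
    exact Or.inr (Set.mem_iUnion₂.2 ⟨x, hx, h⟩)

variable [MeasurableSpace A] {q : PMF A}

/-- The worst-case probability of disagreement at the centre of a space-time box of size `n`. -/
def decay (q : PMF A) (f : V → A → (V → S) → S) (n : ℕ) : ℝ≥0∞ :=
  ⨆ (o : Schedule V) (v : V) (i : ℕ), noise (V × ℕ) q (ballDisagree hG f o i n v)

lemma noise_ballDisagree_le (o : Schedule V) (i n : ℕ) (v : V) :
    noise (V × ℕ) q (ballDisagree hG f o i n v) ≤ decay hG q f n :=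
  le_iSup_of_le o (le_iSup₂_of_le v i le_rfl)

lemma decay_le_one (n : ℕ) : decay hG q f n ≤ 1 :=
  iSup_le fun _ => iSup₂_le fun _ _ => prob_le_one

lemma decay_antitone (hf : MonotoneRule f) : Antitone (decay hG q f) := fun _ _ h =>
  iSup_le fun o => iSup₂_le fun v i => (measure_mono
    (disagree_subset_ballDisagree hG hf (ballFinset_mono hG v h) h)).trans
    (noise_ballDisagree_le hG o i _ v)

variable [Fintype S] {ρ : UpDownSpec V S}

/-- A bound on the influence of the boundary of a ball on its centre. -/
def InfluenceBound (ρ : UpDownSpec V S) (g : ℕ → ℝ≥0∞) : Prop :=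
  ∀ w R, Fintype.card S * ENNReal.ofReal
    (2 * tvDist (marginal (ρ.meas (ballFinset hG w R) ⊤) w)
      (marginal (ρ.meas (ballFinset hG w R) ⊥) w)) ≤ g R

variable [Fintype A] [MeasurableSingletonClass A] {hG} {g : ℕ → ℝ≥0∞} {b : ℕ → ℕ}

lemma noise_influence_ball_le (H : HeatBath ρ q f) (hρ : ρ.Monotonic)
    (hg : InfluenceBound hG ρ g) (o : Schedule V) {Λ : Finset V} {w : V} {R : ℕ}
    (hB : ballFinset hG w R ⊆ Λ) (i m n : ℕ) :
    noise (V × ℕ) q (influence f o (ballFinset hG w R) Λ i m n w) ≤ g R :=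
  (noise_influence_le H hρ hB i m n w).trans (hg w R)

lemma measure_biUnion_ball_le (hb : ∀ v r, (ballFinset hG v r).card ≤ b r) {Ω : Type*}
    [MeasurableSpace Ω] (μ : Measure Ω) (v : V) (r : ℕ) (E : V → Set Ω) (x : ℝ≥0∞)
    (h : ∀ w ∈ ballFinset hG v r, μ (E w) ≤ x) :
    μ (⋃ w ∈ ballFinset hG v r, E w) ≤ b r * x := by
  refine (measure_biUnion_finset_le _ _).trans ((Finset.sum_le_card_nsmul _ _ _ h).trans ?_)
  rw [nsmul_eq_mul]
  exact mul_le_mul' (by exact_mod_cast hb v r) le_rfl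

lemma noise_inter_le (q : PMF A) {J K : Finset (V × ℕ)} {E F : Set (V × ℕ → A)}
    (hE : EventOn J E) (hF : EventOn K F) (hJK : Disjoint J K) {x z : ℝ≥0∞}
    (hx : noise (V × ℕ) q E ≤ x) (hz : noise (V × ℕ) q F ≤ z) :
    noise (V × ℕ) q (E ∩ F) ≤ x * z := by
  rw [noise_inter_of_disjoint q hE hF hJK]
  exact mul_le_mul' hx hz

/-- The basic recursion: either the chains agree on the ball of radius `R` after `t` slices, and
only its boundary can cause the disagreement at the centre, or they disagree at one of its sites,
independently of a disagreement at the centre during the last `s` slices. -/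
lemma decay_add_le (H : HeatBath ρ q f) (hρ : ρ.Monotonic) (hg : InfluenceBound hG ρ g)
    (hb : ∀ v r, (ballFinset hG v r).card ≤ b r) {R s : ℕ} (hR : R ≤ s) (t : ℕ) :
    decay hG q f (s + t) ≤ g R + b R * (decay hG q f s * decay hG q f t) := by
  refine iSup_le fun o => iSup₂_le fun v i => ?_
  have hsub : ballDisagree hG f o i (s + t) v ⊆
      influence f o (ballFinset hG v R) (ballFinset hG v (s + t)) i s t v ∪
      ⋃ x ∈ ballFinset hG v R, (ballDisagree hG f o i s v ∩ ballDisagree hG f o (i + s) t x) := by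
    intro y hy
    rcases disagree_subset_influence (B := ballFinset hG v R) i s t v hy with h | h
    · exact Or.inl h
    · obtain ⟨x, hx, h⟩ := Set.mem_iUnion₂.1 h
      refine Or.inr (Set.mem_iUnion₂.2 ⟨x, hx, ?_, ?_⟩)
      · exact disagree_subset_ballDisagree hG H.mono (ballFinset_mono hG v (by omega))
          (by omega) hy
      · exact disagree_subset_ballDisagree hG H.mono (ballFinset_subset hG hx (by omega)) le_rfl h
  refine (measure_mono hsub).trans ((measure_union_le _ _).trans (add_le_add ?_ ?_))
  · exact noise_influence_ball_le H hρ hg o (ballFinset_mono hG v (by omega)) i s t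
  · refine measure_biUnion_ball_le hb _ v R _ _ fun x _ => ?_
    exact noise_inter_le q (eventOn_ballDisagree hG i s v) (eventOn_ballDisagree hG (i + s) t x)
      (disjoint_of_time (by omega)) (noise_ballDisagree_le hG o i s v)
      (noise_ballDisagree_le hG o (i + s) t x)

/-- Two disagreements at distant sites in the same slice require two independent short
disagreements. -/
lemma noise_pair_le (H : HeatBath ρ q f) (hρ : ρ.Monotonic) (hg : InfluenceBound hG ρ g)
    (hb : ∀ v r, (ballFinset hG v r).card ≤ b r) (o : Schedule V) {T t : ℕ} {w w' : V}
    (hw : Disjoint (ballFinset hG w T) (ballFinset hG w' T)) (i : ℕ) :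
    noise (V × ℕ) q (ballDisagree hG f o i T w ∩ ballDisagree hG f o i (T + t) w') ≤
      g T + b T * (decay hG q f T * decay hG q f T * decay hG q f t) := by
  have hsub : ballDisagree hG f o i T w ∩ ballDisagree hG f o i (T + t) w' ⊆
      influence f o (ballFinset hG w' T) (ballFinset hG w' (T + t)) i T t w' ∪
      ⋃ x ∈ ballFinset hG w' T, (ballDisagree hG f o i T w ∩ ballDisagree hG f o i T w' ∩
        ballDisagree hG f o (i + T) t x) := by
    rintro y ⟨hy, hy'⟩
    rcases disagree_subset_influence (B := ballFinset hG w' T) i T t w' hy' with h | h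
    · exact Or.inl h
    · obtain ⟨x, hx, h⟩ := Set.mem_iUnion₂.1 h
      refine Or.inr (Set.mem_iUnion₂.2 ⟨x, hx, ⟨hy, ?_⟩, ?_⟩)
      · exact disagree_subset_ballDisagree hG H.mono (ballFinset_mono hG w' (by omega))
          (by omega) hy'
      · exact disagree_subset_ballDisagree hG H.mono (ballFinset_subset hG hx (by omega)) le_rfl h
  refine (measure_mono hsub).trans ((measure_union_le _ _).trans (add_le_add ?_ ?_))
  · exact noise_influence_ball_le H hρ hg o (ballFinset_mono hG w' (by omega)) i T t
  · refine measure_biUnion_ball_le hb _ w' T _ _ fun x _ => ?_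
    refine noise_inter_le q (J := (ballFinset hG w T ∪ ballFinset hG w' T) ×ˢ Finset.Ico i (i + T))
      (EventOn.inter ((eventOn_ballDisagree hG i T w).mono ?_)
        ((eventOn_ballDisagree hG i T w').mono ?_)) (eventOn_ballDisagree hG (i + T) t x)
      (disjoint_of_time (by omega)) ?_ (noise_ballDisagree_le hG o (i + T) t x)
    · exact box_subset_Ico hG le_rfl le_rfl Finset.subset_union_left
    · exact box_subset_Ico hG le_rfl le_rfl Finset.subset_union_right
    · refine noise_inter_le q (eventOn_ballDisagree hG i T w) (eventOn_ballDisagree hG i T w') ?_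
        (noise_ballDisagree_le hG o i T w) (noise_ballDisagree_le hG o i T w')
      exact Finset.disjoint_product.2 (Or.inl hw)

end Recursion

/-! ### A multi-scale recursion -/

section MultiScale

variable {V A S : Type*} {G : SimpleGraph V} {hG : IsLocallyFinite G}
  [LinearOrder S] [BoundedOrder S] {f : V → A → (V → S) → S}
  {o : Schedule V}

/-- Three disagreements: at `v` after slice `i`, of chains that run for `m` slices, and at `w` and
`w'` after slice `i + m`, of chains that run for `T` and `16T - m` slices. It is used when `w` and
`w'` are at distance greater than `4T` from each other. -/
def tripleDisagree (hG : IsLocallyFinite G) (f : V → A → (V → S) → S) (o : Schedule V)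
    (i m T : ℕ) (v w w' : V) : Set (V × ℕ → A) :=
  ballDisagree hG f o i m v ∩
    (ballDisagree hG f o (i + m) T w ∩ ballDisagree hG f o (i + m) (16 * T - m) w')

/-- The possible origins, in the box of radius `24T` and duration `16T`, of a disagreement at `v`
after slice `i`, given a disagreement after slice `i + m`, with `m ≤ 8T`, at a site `w` at distance
between `8T` and `16T`: it is caused by the boundary of the ball of radius `4T`, or it also passes
through a site `w'` of that ball after slice `i + m`, far away from `w`. -/
def farEvent (hG : IsLocallyFinite G) (f : V → A → (V → S) → S) (o : Schedule V)
    (i m T : ℕ) (v : V) : Set (V × ℕ → A) :=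
  influence f o (ballFinset hG v (4 * T)) (ballFinset hG v (24 * T)) i m (16 * T - m) v ∪
    ⋃ w ∈ ballFinset hG v (16 * T), ⋃ w' ∈ ballFinset hG v (4 * T),
      {y | w ∉ ballFinset hG v (8 * T) ∧ y ∈ tripleDisagree hG f o i m T v w w'}

lemma eventOn_tripleDisagree (i : ℕ) {m T : ℕ} (hm : m ≤ 8 * T) {v w w' : V}
    (hw : w ∈ ballFinset hG v (16 * T)) (hw' : w' ∈ ballFinset hG v (4 * T)) :
    EventOn (ballFinset hG v (24 * T) ×ˢ Finset.Ico i (i + 16 * T))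
      (tripleDisagree hG f o i m T v w w') := by
  refine EventOn.inter ((eventOn_ballDisagree hG i m v).mono ?_) (EventOn.inter
    ((eventOn_ballDisagree hG _ T w).mono ?_) ((eventOn_ballDisagree hG _ _ w').mono ?_))
  · exact box_subset_Ico hG le_rfl (by omega) (ballFinset_mono hG v (by omega))
  · exact box_subset_Ico hG (by omega) (by omega) (ballFinset_subset hG hw (by omega))
  · exact box_subset_Ico hG (by omega) (by omega) (ballFinset_subset hG hw' (by omega))

lemma eventOn_farEvent (i : ℕ) {m T : ℕ} (hm : m ≤ 8 * T) (v : V) :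
    EventOn (ballFinset hG v (24 * T) ×ˢ Finset.Ico i (i + 16 * T))
      (farEvent hG f o i m T v) := by
  intro y y' hy h
  rcases h with h | h
  · left
    refine eventOn_influence _ _ _ _ _ _ y y' ?_ h
    rwa [show m + (16 * T - m) = 16 * T by omega]
  · right
    obtain ⟨w, hw, h⟩ := Set.mem_iUnion₂.1 h
    obtain ⟨w', hw', h⟩ := Set.mem_iUnion₂.1 h
    exact Set.mem_iUnion₂.2 ⟨w, hw, Set.mem_iUnion₂.2 ⟨w', hw', h.1,
      eventOn_tripleDisagree i hm hw hw' y y' hy h.2⟩⟩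

/-- Classification of the ways in which a disagreement can reach `v`. Put `m_j = 8 · 2^j · ℓ` and
consider the sites of disagreement at slice `i + m_j`, for `j ≤ J`. Either one of them is within
distance `m_0` for `j = 0`; or, for the last `j` such that there is none within distance `m_j`, there
is none within the largest distance `m_J` either; or else, for the largest `k` such that there is
none within distance `m_k`, there is one at distance between `m_k` and `m_{k+1}`, while at slice
`i + m_{k+1}` there is one within distance `m_{k+1}`, by the choice of `j`. -/
lemma ballDisagree_subset (hf : MonotoneRule f) {ℓ J n : ℕ} (hn : 16 * (2 ^ J * ℓ) ≤ n)
    (i : ℕ) (v : V) :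
    ballDisagree hG f o i n v ⊆
      (⋃ w ∈ ballFinset hG v (8 * ℓ),
        ballDisagree hG f o i (8 * ℓ) v ∩ ballDisagree hG f o (i + 8 * ℓ) (n - 8 * ℓ) w) ∪
      (⋃ j ∈ Finset.range (J + 1), influence f o (ballFinset hG v (8 * (2 ^ J * ℓ)))
        (ballFinset hG v n) i (8 * (2 ^ j * ℓ)) (n - 8 * (2 ^ j * ℓ)) v) ∪
      ⋃ k ∈ Finset.range J, ⋃ j ∈ Finset.range (k + 1),
        ⋃ x ∈ ballFinset hG v (16 * (2 ^ k * ℓ)),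
          (farEvent hG f o i (8 * (2 ^ j * ℓ)) (2 ^ k * ℓ) v ∩
            ballDisagree hG f o (i + 16 * (2 ^ k * ℓ)) (n - 16 * (2 ^ k * ℓ)) x) := by
  intro y hy
  have hpow : ∀ j k, j ≤ k → 2 ^ j * ℓ ≤ 2 ^ k * ℓ := fun j k h =>
    Nat.mul_le_mul_right _ (Nat.pow_le_pow_right two_pos h)
  have hD : ∀ m ≤ n, y ∈ disagree f o (ballFinset hG v n) i (m + (n - m)) v := fun m hm => by
    rw [Nat.add_sub_of_le hm]; exact hy
  set D : ℕ → V → Prop := fun m w => y ∈ disagree f o (ballFinset hG v n) (i + m) (n - m) w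
    with hDdef
  -- `far j k`: at slice `m_j` there is no disagreement in the ball of radius `m_k`
  set far : ℕ → ℕ → Prop := fun j k => ∀ w ∈ ballFinset hG v (8 * (2 ^ k * ℓ)),
    ¬ D (8 * (2 ^ j * ℓ)) w with hfar
  have hinfl : ∀ j ≤ J, far j J → y ∈ influence f o (ballFinset hG v (8 * (2 ^ J * ℓ)))
      (ballFinset hG v n) i (8 * (2 ^ j * ℓ)) (n - 8 * (2 ^ j * ℓ)) v := fun j hj h =>
    ⟨h, hD _ (by have := hpow j J hj; omega)⟩
  by_cases h0 : far 0 0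
  swap
  · left; left
    simp only [hfar, pow_zero, one_mul] at h0
    push Not at h0
    obtain ⟨w, hw, hDw⟩ := h0
    have := hpow 0 J (Nat.zero_le _)
    rw [pow_zero, one_mul] at this
    refine Set.mem_iUnion₂.2 ⟨w, hw, ?_, ?_⟩
    · exact disagree_subset_ballDisagree hG hf (ballFinset_mono hG v (by omega)) (by omega) hy
    · exact disagree_subset_ballDisagree hG hf (ballFinset_subset hG hw (by omega)) le_rfl hDw
  obtain ⟨j, hjJ, hj, hlast⟩ : ∃ j ≤ J, far j j ∧ ∀ j', j < j' → j' ≤ J → ¬ far j' j' :=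
    ⟨Nat.findGreatest (fun j => far j j) J, Nat.findGreatest_le _,
      Nat.findGreatest_spec (P := fun j => far j j) (Nat.zero_le _) h0,
      fun j' h h' => Nat.findGreatest_is_greatest (P := fun j => far j j) h h'⟩
  obtain ⟨k, hkJ, hjk, hk, hklast⟩ : ∃ k ≤ J, j ≤ k ∧ far j k ∧ (k + 1 ≤ J → ¬ far j (k + 1)) :=
    ⟨Nat.findGreatest (fun k => far j k) J, Nat.findGreatest_le _,
      Nat.le_findGreatest hjJ hj, Nat.findGreatest_spec (P := fun k => far j k) hjJ hj,
      fun h => Nat.findGreatest_is_greatest (Nat.lt_succ_self _) h⟩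
  rcases hkJ.eq_or_lt with rfl | hkJ
  · left; right
    exact Set.mem_iUnion₂.2 ⟨j, by simpa using Nat.lt_succ_of_le hjk, hinfl j hjk hk⟩
  right
  set T := 2 ^ k * ℓ with hT
  set m := 8 * (2 ^ j * ℓ) with hm
  have hmT : m ≤ 8 * T := by have := hpow j k hjk; omega
  have hTJ : 2 * T ≤ 2 ^ J * ℓ := by
    have := hpow (k + 1) J hkJ
    rw [pow_succ, mul_comm (2 ^ k) 2, mul_assoc] at this; exact this
  have hsucc : 8 * (2 ^ (k + 1) * ℓ) = 16 * T := by rw [pow_succ, hT]; ring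
  have hklast' := hklast hkJ
  simp only [hfar, hsucc] at hklast'
  push Not at hklast'
  obtain ⟨w, hw, hDw⟩ := hklast'
  have hw8 : w ∉ ballFinset hG v (8 * T) := fun h => hk w h hDw
  have hnot := hlast (k + 1) (by omega) hkJ
  simp only [hfar, hsucc] at hnot
  push Not at hnot
  obtain ⟨x, hx, hDx⟩ := hnot
  refine Set.mem_iUnion₂.2 ⟨k, Finset.mem_range.2 hkJ, Set.mem_iUnion₂.2
    ⟨j, Finset.mem_range.2 (Nat.lt_succ_of_le hjk), Set.mem_iUnion₂.2 ⟨x, hx, ?_, ?_⟩⟩⟩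
  swap
  · exact disagree_subset_ballDisagree hG hf (ballFinset_subset hG hx (by omega)) le_rfl hDx
  have hloc : y ∈ disagree f o (ballFinset hG v (24 * T)) i (m + (16 * T - m)) v :=
    disagree_anti o hf (ballFinset_mono hG v (by omega)) i (by omega) v hy
  rcases disagree_subset_influence (B := ballFinset hG v (4 * T)) i m (16 * T - m) v hloc with h | h
  · exact Or.inl h
  obtain ⟨w', hw', h⟩ := Set.mem_iUnion₂.1 h
  refine Or.inr (Set.mem_iUnion₂.2 ⟨w, hw, Set.mem_iUnion₂.2 ⟨w', hw', hw8, ?_, ?_, ?_⟩⟩)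
  · exact disagree_subset_ballDisagree hG hf (ballFinset_mono hG v (by omega)) (by omega) hy
  · exact disagree_subset_ballDisagree hG hf (ballFinset_subset hG hw (by omega)) (by omega) hDw
  · exact disagree_subset_ballDisagree hG hf (ballFinset_subset hG hw' (by omega)) le_rfl h

variable [Fintype S] [Fintype A] [MeasurableSpace A] [MeasurableSingletonClass A]
  {ρ : UpDownSpec V S} {q : PMF A} {g : ℕ → ℝ≥0∞} {b : ℕ → ℕ}

lemma noise_tripleDisagree_le (H : HeatBath ρ q f) (hρ : ρ.Monotonic) (hg : InfluenceBound hG ρ g)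
    (hb : ∀ v r, (ballFinset hG v r).card ≤ b r) (i : ℕ) {m T : ℕ} (hm : m ≤ 8 * T) {v w w' : V}
    (hw : w ∉ ballFinset hG v (8 * T)) (hw' : w' ∈ ballFinset hG v (4 * T)) :
    noise (V × ℕ) q (tripleDisagree hG f o i m T v w w') ≤ decay hG q f m *
      (g T + b T * (decay hG q f T * decay hG q f T * decay hG q f (15 * T - m))) := by
  refine noise_inter_le q (K := Finset.univ.biUnion fun c : Bool =>
      if c then box hG w (i + m) T else box hG w' (i + m) (16 * T - m))
    (eventOn_ballDisagree hG i m v) (EventOn.inter ((eventOn_ballDisagree hG _ T w).mono ?_)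
      ((eventOn_ballDisagree hG _ (16 * T - m) w').mono ?_)) ?_
    (noise_ballDisagree_le hG o i m v) ?_
  · intro p hp; exact Finset.mem_biUnion.2 ⟨true, by simp, by simpa using hp⟩
  · intro p hp; exact Finset.mem_biUnion.2 ⟨false, by simp, by simpa using hp⟩
  · rw [Finset.disjoint_biUnion_right]
    rintro (_ | _) -
    · exact disjoint_of_time le_rfl
    · exact disjoint_of_time le_rfl
  · have h := noise_pair_le (o := o) (t := 15 * T - m) H hρ hg hb
      (w := w) (w' := w') (T := T) ?_ (i + m)
    · rwa [show T + (15 * T - m) = 16 * T - m by omega] at h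
    · exact ((ballFinset_disjoint hG hw (s := 5 * T) (t := T) (by omega)).mono_left
        (ballFinset_subset hG hw' (by omega))).symm

/-- The multi-scale recursion. The three terms bound the three cases of `ballDisagree_subset`; the
disagreements that occur in disjoint space-time boxes are independent. In the last term the small
factor `u_T ^ 2`, with `T = 2 ^ k * ℓ`, comes from two simultaneous disagreements at distant
sites. -/
lemma decay_le_multiscale (H : HeatBath ρ q f) (hρ : ρ.Monotonic) (hg : InfluenceBound hG ρ g)
    (hb : ∀ v r, (ballFinset hG v r).card ≤ b r) {ℓ J n : ℕ} (hn : 16 * (2 ^ J * ℓ) ≤ n) :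
    decay hG q f n ≤ b (8 * ℓ) * (decay hG q f (8 * ℓ) * decay hG q f (n - 8 * ℓ)) +
      ∑ _j ∈ Finset.range (J + 1), g (8 * (2 ^ J * ℓ)) +
      ∑ k ∈ Finset.range J, ∑ j ∈ Finset.range (k + 1), b (16 * (2 ^ k * ℓ)) *
        ((g (4 * (2 ^ k * ℓ)) + b (16 * (2 ^ k * ℓ)) * (b (4 * (2 ^ k * ℓ)) *
          (decay hG q f (8 * (2 ^ j * ℓ)) * (g (2 ^ k * ℓ) + b (2 ^ k * ℓ) *
            (decay hG q f (2 ^ k * ℓ) * decay hG q f (2 ^ k * ℓ) *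
              decay hG q f (15 * (2 ^ k * ℓ) - 8 * (2 ^ j * ℓ))))))) *
          decay hG q f (n - 16 * (2 ^ k * ℓ))) := by
  have hpow : ∀ j k, j ≤ k → 2 ^ j * ℓ ≤ 2 ^ k * ℓ := fun j k h =>
    Nat.mul_le_mul_right _ (Nat.pow_le_pow_right two_pos h)
  refine iSup_le fun o => iSup₂_le fun v i => ?_
  refine (measure_mono (ballDisagree_subset H.mono hn i v)).trans
    ((measure_union_le _ _).trans (add_le_add ((measure_union_le _ _).trans
      (add_le_add ?_ ?_)) ?_))
  · refine measure_biUnion_ball_le hb _ v _ _ _ fun w _ => ?_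
    exact noise_inter_le q (eventOn_ballDisagree hG i _ v) (eventOn_ballDisagree hG _ _ w)
      (disjoint_of_time (by omega)) (noise_ballDisagree_le hG o i _ v)
      (noise_ballDisagree_le hG o _ _ w)
  · refine (measure_biUnion_finset_le _ _).trans (Finset.sum_le_sum fun j _ => ?_)
    exact noise_influence_ball_le H hρ hg o (ballFinset_mono hG v (by omega)) i _ _
  · refine (measure_biUnion_finset_le _ _).trans (Finset.sum_le_sum fun k hk => ?_)
    refine (measure_biUnion_finset_le _ _).trans (Finset.sum_le_sum fun j hj => ?_)
    have hm : 8 * (2 ^ j * ℓ) ≤ 8 * (2 ^ k * ℓ) := by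
      have := hpow j k (Nat.lt_succ_iff.1 (Finset.mem_range.1 hj)); omega
    refine measure_biUnion_ball_le hb _ v _ _ _ fun x _ => ?_
    refine noise_inter_le q (eventOn_farEvent i hm v)
      (eventOn_ballDisagree hG _ _ x) (disjoint_of_time (by omega)) ?_
      (noise_ballDisagree_le hG o _ _ x)
    refine (measure_union_le _ _).trans (add_le_add ?_ ?_)
    · exact noise_influence_ball_le H hρ hg o (ballFinset_mono hG v (by omega)) i _ _
    · refine measure_biUnion_ball_le hb _ v _ _ _ fun w _ => ?_
      refine measure_biUnion_ball_le hb _ v _ _ _ fun w' hw' => ?_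
      by_cases hw : w ∈ ballFinset hG v (8 * (2 ^ k * ℓ))
      · simp [hw]
      · refine (measure_mono fun y hy => hy.2).trans ?_
        exact noise_tripleDisagree_le H hρ hg hb i hm hw hw'

end MultiScale

/-! ### Disagreement becomes unlikely -/

section Vanishing

variable {V A S : Type*} {G : SimpleGraph V} {hG : IsLocallyFinite G}
  [LinearOrder S] [BoundedOrder S] {f : V → A → (V → S) → S} [Fintype S] [Fintype A]
  [MeasurableSpace A] [MeasurableSingletonClass A] {ρ : UpDownSpec V S} {q : PMF A}
  {g : ℕ → ℝ≥0∞} {b : ℕ → ℕ}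

/-- In a fixed volume, the disagreement of the extremal chains is eventually no more likely than the
discrepancy between the measures with extremal boundary conditions. -/
lemma noise_disagree_threshold_le (H : HeatBath ρ q f) (hirr : ρ.Irreducible) (o : Schedule V)
    {Λ : Finset V} {b : ℕ} (hb : Λ.card ≤ b) (k i : ℕ) (v : V) (s : S) :
    noise (V × ℕ) q {y | s ≤ run f y (o.path Λ i (k * Fintype.card S ^ b)) ⊤ v ∧
        ¬ s ≤ run f y (o.path Λ i (k * Fintype.card S ^ b)) ⊥ v} ≤
      ENNReal.ofReal (2 * tvDist (marginal (ρ.meas Λ ⊤) v) (marginal (ρ.meas Λ ⊥) v)) +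
        2 * (1 - minProb q ^ (Fintype.card S ^ b * b)) ^ k := by
  set n := k * Fintype.card S ^ b
  set l := o.path Λ i n
  have h1 := H.noise_top_le o (hirr Λ).1.1 (hirr Λ).1.2 hb k i {σ | s ≤ σ v}
  have h2 := H.noise_bot_le o (hirr Λ).2.1 (hirr Λ).2.2 hb k i {σ | ¬ s ≤ σ v}
  have h3 := boundary_threshold_le (ρ := ρ) Λ v s
  set F : Set (V × ℕ → A) := {y | run f y l ⊤ ∈ {σ : V → S | s ≤ σ v}}
  set F' : Set (V × ℕ → A) := {y | run f y l ⊥ ∈ {σ : V → S | ¬ s ≤ σ v}}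
  have hF' : MeasurableSet F' :=
    (eventOn_run_const (f := f) l (J := l.toFinset) (by simp) ⊥ _).measurableSet
  have hun : F ∪ F' = Set.univ := by
    refine Set.eq_univ_of_forall fun y => ?_
    by_cases h : s ≤ run f y l ⊥ v
    · exact Or.inl (h.trans (run_mono H.mono bot_mem_upDownConfig top_mem_upDownConfig bot_le l v))
    · exact Or.inr h
  have h4 := measure_union_add_inter F hF' (μ := noise (V × ℕ) q)
  rw [hun, measure_univ] at h4
  refine (ENNReal.add_le_add_iff_left ENNReal.one_ne_top).1 ?_
  calc 1 + noise (V × ℕ) q (F ∩ F') = noise (V × ℕ) q F + noise (V × ℕ) q F' := h4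
    _ ≤ _ := add_le_add h1 h2
    _ = ((ρ.meas Λ ⊤).toOuterMeasure {σ | s ≤ σ v} +
          (ρ.meas Λ ⊥).toOuterMeasure {σ | ¬ s ≤ σ v}) +
          2 * (1 - minProb q ^ (Fintype.card S ^ b * b)) ^ k := by ring
    _ ≤ _ := by
      rw [← add_assoc]
      exact add_le_add h3 le_rfl

/-- Under weak spatial mixing, disagreement becomes unlikely. No bound on the growth of balls is
needed. -/
lemma tendsto_decay (H : HeatBath ρ q f) (hirr : ρ.Irreducible) (hg : InfluenceBound hG ρ g)
    (hg0 : Tendsto g atTop (𝓝 0)) (hb : ∀ v r, (ballFinset hG v r).card ≤ b r) :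
    Tendsto (decay hG q f) atTop (𝓝 0) := by
  have hanti := decay_antitone hG (q := q) H.mono
  have hbound : ∀ r k, decay hG q f (r + k * Fintype.card S ^ b r) ≤ g r +
      Fintype.card S * (2 * (1 - minProb q ^ (Fintype.card S ^ b r * b r)) ^ k) := by
    intro r k
    refine iSup_le fun o => iSup₂_le fun v i => ?_
    refine (measure_mono (disagree_anti o H.mono (ballFinset_mono hG v (Nat.le_add_right r _)) i
      (Nat.le_add_left _ r) v)).trans ?_
    refine (measure_mono (disagree_subset_threshold H.mono _ _ _ _)).trans ?_
    refine (measure_iUnion_fintype_le _ _).trans ?_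
    refine (Finset.sum_le_card_nsmul _ _ _ fun s _ =>
      noise_disagree_threshold_le H hirr o (hb v r) k i v s).trans ?_
    rw [nsmul_eq_mul, Finset.card_univ, mul_add]
    exact add_le_add (hg v r) le_rfl
  refine ENNReal.tendsto_nhds_zero.2 fun ε hε => ?_
  obtain ⟨r, hr⟩ := ((ENNReal.tendsto_nhds_zero.1 hg0) (ε / 2) (ENNReal.half_pos hε.ne')).exists
  have hlim : Tendsto (fun k : ℕ => (Fintype.card S : ℝ≥0∞) *
      (2 * (1 - minProb q ^ (Fintype.card S ^ b r * b r)) ^ k)) atTop (𝓝 0) := by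
    have h0 : Tendsto (fun k : ℕ => (1 - minProb q ^ (Fintype.card S ^ b r * b r)) ^ k) atTop
        (𝓝 0) := ENNReal.tendsto_pow_atTop_nhds_zero_of_lt_one
      (ENNReal.sub_lt_self ENNReal.one_ne_top one_ne_zero (pow_ne_zero _ minProb_pos.ne'))
    have h1 := ENNReal.Tendsto.const_mul (a := 2) h0 (Or.inr (by simp))
    have h2 := ENNReal.Tendsto.const_mul (a := (Fintype.card S : ℝ≥0∞)) h1 (Or.inr (by simp))
    simpa using h2
  obtain ⟨k, hk⟩ := ((ENNReal.tendsto_nhds_zero.1 hlim) (ε / 2) (ENNReal.half_pos hε.ne')).exists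
  filter_upwards [eventually_ge_atTop (r + k * Fintype.card S ^ b r)] with n hn
  refine (hanti hn).trans ((hbound r k).trans ?_)
  rw [← ENNReal.add_halves ε]
  exact add_le_add hr hk

end Vanishing

/-! ### Solving the recursions -/

section Numerics

open Real

variable {u b : ℕ → ℝ} {K c : ℝ}

lemma sum_succ_mul_pow_le {z : ℝ} (hz0 : 0 ≤ z) (hz : z ≤ 1 / 12) (J : ℕ) :
    ∑ k ∈ Finset.range J, ((k : ℝ) + 1) * z ^ 2 ^ k ≤ 1 / 6 := by
  have hterm : ∀ k ∈ Finset.range J, ((k : ℝ) + 1) * z ^ 2 ^ k ≤ 1 / 12 * (1 / 2 : ℝ) ^ k := by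
    intro k _
    have h1 : k + 1 ≤ 2 ^ k := Nat.lt_two_pow_self
    have h2 : z ^ 2 ^ k ≤ (1 / 12) ^ (k + 1) :=
      (pow_le_pow_of_le_one hz0 (hz.trans (by norm_num)) h1).trans (pow_le_pow_left₀ hz0 hz _)
    calc ((k : ℝ) + 1) * z ^ 2 ^ k ≤ 2 ^ k * (1 / 12) ^ (k + 1) := by
          refine mul_le_mul (by exact_mod_cast h1) h2 (by positivity) (by positivity)
      _ = 1 / 12 * (1 / 6 : ℝ) ^ k := by
          rw [pow_succ, ← mul_assoc, ← mul_pow]; norm_num [mul_comm]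
      _ ≤ 1 / 12 * (1 / 2 : ℝ) ^ k := by gcongr; norm_num
  refine (Finset.sum_le_sum hterm).trans ?_
  rw [← Finset.mul_sum]
  linarith [sum_geometric_two_le J]

/-- The multi-scale recursion turns a sufficiently strong bound at one scale into exponential
decay. -/
lemma exp_decay_of_multiscale (hu0 : ∀ n, 0 ≤ u n) (hu1 : ∀ n, u n ≤ 1) (hanti : Antitone u)
    (hb0 : ∀ n, 0 ≤ b n) (hK : 0 ≤ K) {ℓ : ℕ} (hℓ : 0 < ℓ)
    (hrec : ∀ J n : ℕ, 16 * (2 ^ J * ℓ) ≤ n → u n ≤ b (8 * ℓ) * (u (8 * ℓ) * u (n - 8 * ℓ)) +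
      ∑ _j ∈ Finset.range (J + 1), K * exp (-c * (8 * (2 ^ J * ℓ) : ℕ)) +
      ∑ k ∈ Finset.range J, ∑ j ∈ Finset.range (k + 1), b (16 * (2 ^ k * ℓ)) *
        ((K * exp (-c * (4 * (2 ^ k * ℓ) : ℕ)) + b (16 * (2 ^ k * ℓ)) * (b (4 * (2 ^ k * ℓ)) *
          (u (8 * (2 ^ j * ℓ)) * (K * exp (-c * (2 ^ k * ℓ : ℕ)) + b (2 ^ k * ℓ) *
            (u (2 ^ k * ℓ) * u (2 ^ k * ℓ) * u (15 * (2 ^ k * ℓ) - 8 * (2 ^ j * ℓ))))))) *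
          u (n - 16 * (2 ^ k * ℓ))))
    {l : ℝ} (hl : 0 < l) (hlc : 64 * l ≤ c) (hlℓ : 48 ≤ l * ℓ)
    (hb : ∀ r, ℓ ≤ r → b r ≤ exp (l * r / 128)) (hstart : u ℓ ≤ exp (-32 * l * ℓ))
    (hKn : ∀ n : ℕ, ℓ ≤ n → K * n * exp (-c * n / 8) ≤ 1 / 4) :
    ∀ n, ℓ ≤ n → u n ≤ exp (-l * n) := by
  have hℓ' : (1 : ℝ) ≤ ℓ := by exact_mod_cast hℓ
  have hc : 0 < c := by linarith
  intro n
  induction n using Nat.strong_induction_on with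
  | _ n ih =>
  intro hn
  rcases le_or_gt n (32 * ℓ) with hn32 | hn32
  · refine (hanti hn).trans (hstart.trans (exp_le_exp.2 ?_))
    have : (n : ℝ) ≤ 32 * ℓ := by exact_mod_cast hn32
    nlinarith
  obtain ⟨J, hJ1, hJ2⟩ : ∃ J, 16 * (2 ^ J * ℓ) ≤ n ∧ n < 32 * (2 ^ J * ℓ) := by
    refine ⟨Nat.log 2 (n / (16 * ℓ)), ?_, ?_⟩
    · have h1 : 2 ^ Nat.log 2 (n / (16 * ℓ)) ≤ n / (16 * ℓ) := by
        refine Nat.pow_log_le_self 2 (Nat.div_pos (by omega) (by omega)).ne'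
      calc 16 * (2 ^ Nat.log 2 (n / (16 * ℓ)) * ℓ)
          = 2 ^ Nat.log 2 (n / (16 * ℓ)) * (16 * ℓ) := by ring
        _ ≤ n / (16 * ℓ) * (16 * ℓ) := Nat.mul_le_mul_right _ h1
        _ ≤ n := Nat.div_mul_le_self _ _
    · have h1 : n / (16 * ℓ) < 2 ^ (Nat.log 2 (n / (16 * ℓ)) + 1) :=
        Nat.lt_pow_succ_log_self one_lt_two _
      rw [Nat.div_lt_iff_lt_mul (by omega), pow_succ] at h1
      calc n < _ := h1
        _ = _ := by ring
  have hnR : (0 : ℝ) < n := by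
    have : 0 < n := by omega
    exact_mod_cast this
  have hpow : ∀ j k, j ≤ k → 2 ^ j * ℓ ≤ 2 ^ k * ℓ := fun j k h =>
    Nat.mul_le_mul_right _ (Nat.pow_le_pow_right two_pos h)
  have hℓp : ∀ k, ℓ ≤ 2 ^ k * ℓ := fun k => by simpa using hpow 0 k (Nat.zero_le k)
  refine (hrec J n hJ1).trans ?_
  -- the disagreement that stays near the centre
  have hA : b (8 * ℓ) * (u (8 * ℓ) * u (n - 8 * ℓ)) ≤ 1 / 4 * exp (-l * n) := by
    have h1 := hb (8 * ℓ) (by omega)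
    have h2 : u (8 * ℓ) ≤ exp (-32 * l * ℓ) := (hanti (by omega)).trans hstart
    have h3 := ih (n - 8 * ℓ) (by omega) (by omega)
    have h14 : exp (-(3 : ℝ)) ≤ 1 / 4 := by
      rw [exp_neg, one_div]
      exact inv_anti₀ (by norm_num) (by linarith [add_one_le_exp (3 : ℝ)])
    calc b (8 * ℓ) * (u (8 * ℓ) * u (n - 8 * ℓ))
        ≤ exp (l * (8 * ℓ : ℕ) / 128) * (exp (-32 * l * ℓ) * exp (-l * (n - 8 * ℓ : ℕ))) := by
          gcongr
          · exact mul_nonneg (hu0 _) (hu0 _)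
          · exact hu0 _
      _ = exp (l * (8 * ℓ : ℕ) / 128 + (-32 * l * ℓ + -l * (n - 8 * ℓ : ℕ))) := by
          rw [exp_add, exp_add]
      _ ≤ exp (-3 + -l * n) := by
          refine exp_le_exp.2 ?_
          rw [Nat.cast_sub (by omega)]
          push_cast
          nlinarith
      _ ≤ 1 / 4 * exp (-l * n) := by rw [exp_add]; gcongr
  -- the influence of the boundary at a macroscopic scale
  have hB : ∑ _j ∈ Finset.range (J + 1), K * exp (-c * (8 * (2 ^ J * ℓ) : ℕ)) ≤
      1 / 4 * exp (-l * n) := by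
    rw [Finset.sum_const, Finset.card_range, nsmul_eq_mul]
    have h1 : ((J + 1 : ℕ) : ℝ) ≤ n := by
      have : J + 1 ≤ 2 ^ J := Nat.lt_two_pow_self
      have h2 : 2 ^ J * 1 ≤ 2 ^ J * ℓ := Nat.mul_le_mul_left _ hℓ
      have : J + 1 ≤ n := by omega
      exact_mod_cast this
    have h2 : (n : ℝ) / 4 ≤ (8 * (2 ^ J * ℓ) : ℕ) := by
      have : (n : ℝ) ≤ (32 * (2 ^ J * ℓ) : ℕ) := by exact_mod_cast hJ2.le
      push_cast at this ⊢
      linarith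
    calc ((J + 1 : ℕ) : ℝ) * (K * exp (-c * (8 * (2 ^ J * ℓ) : ℕ)))
        ≤ n * (K * exp (-c * n / 8 + -l * n)) := by
          refine mul_le_mul h1 (mul_le_mul_of_nonneg_left (exp_le_exp.2 ?_) hK) (by positivity)
            (by positivity)
          nlinarith [mul_le_mul_of_nonneg_left h2 hc.le]
      _ = (K * n * exp (-c * n / 8)) * exp (-l * n) := by rw [exp_add]; ring
      _ ≤ 1 / 4 * exp (-l * n) := by gcongr; exact hKn n hn
  -- the intermediate scales
  have hC : ∀ k ∈ Finset.range J, ∀ j ∈ Finset.range (k + 1), b (16 * (2 ^ k * ℓ)) *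
        ((K * exp (-c * (4 * (2 ^ k * ℓ) : ℕ)) + b (16 * (2 ^ k * ℓ)) * (b (4 * (2 ^ k * ℓ)) *
          (u (8 * (2 ^ j * ℓ)) * (K * exp (-c * (2 ^ k * ℓ : ℕ)) + b (2 ^ k * ℓ) *
            (u (2 ^ k * ℓ) * u (2 ^ k * ℓ) * u (15 * (2 ^ k * ℓ) - 8 * (2 ^ j * ℓ))))))) *
          u (n - 16 * (2 ^ k * ℓ))) ≤ 3 * exp (-l * ℓ / 16) ^ 2 ^ k * exp (-l * n) := by
    intro k hk j hj
    have hkJ := hpow (k + 1) J (Finset.mem_range.1 hk)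
    rw [pow_succ, mul_assoc, mul_left_comm, mul_comm] at hkJ
    have hjk := hpow j k (Nat.lt_succ_iff.1 (Finset.mem_range.1 hj))
    have hTℓ := hℓp k
    have hmℓ := hℓp j
    have hz : exp (-l * ℓ / 16) ^ 2 ^ k = exp (-l * (2 ^ k * ℓ : ℕ) / 16) := by
      rw [← exp_nat_mul]; congr 1; push_cast; ring
    rw [hz]
    set T := 2 ^ k * ℓ
    set m := 2 ^ j * ℓ
    have hT48 : 48 ≤ l * T := hlℓ.trans (by gcongr)
    have hcT : 64 * (l * T) ≤ c * T := by
      have : (0 : ℝ) ≤ T := by positivity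
      nlinarith
    have hKT : K ≤ exp (c * T / 8) := by
      have h1 := hKn T hTℓ
      have h2 : (1 : ℝ) ≤ T := hℓ'.trans (by exact_mod_cast hTℓ)
      have h3 : K * exp (-c * T / 8) ≤ K * T * exp (-c * T / 8) := by
        refine mul_le_mul_of_nonneg_right ?_ (exp_pos _).le
        nlinarith
      have h4 : K * exp (-c * T / 8) ≤ 1 := by linarith
      rwa [show -c * T / 8 = -(c * T / 8) by ring, exp_neg, ← div_eq_mul_inv,
        div_le_one (exp_pos _)] at h4
    have hb16 : b (16 * T) ≤ exp (l * T / 8) :=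
      (hb (16 * T) (by omega)).trans (exp_le_exp.2 (by push_cast; linarith))
    have hb4 : b (4 * T) ≤ exp (l * T / 32) :=
      (hb (4 * T) (by omega)).trans (exp_le_exp.2 (by push_cast; linarith))
    have hb1 : b T ≤ exp (l * T / 128) := hb T hTℓ
    have huT : u T ≤ exp (-l * T) := ih T (by omega) hTℓ
    have hum : u (8 * m) ≤ exp (-8 * (l * m)) :=
      (ih (8 * m) (by omega) (by omega)).trans (exp_le_exp.2 (by push_cast; linarith))
    have hut : u (15 * T - 8 * m) ≤ exp (-15 * (l * T) + 8 * (l * m)) :=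
      (ih (15 * T - 8 * m) (by omega) (by omega)).trans (exp_le_exp.2 (by
        rw [Nat.cast_sub (by omega)]; push_cast; linarith))
    have hun : u (n - 16 * T) ≤ exp (-l * n + 16 * (l * T)) :=
      (ih (n - 16 * T) (by omega) (by omega)).trans (exp_le_exp.2 (by
        rw [Nat.cast_sub (by omega)]; push_cast; linarith))
    have e1 : K * exp (-c * (4 * T : ℕ)) ≤ exp (-3 * (c * T)) := by
      calc K * exp (-c * (4 * T : ℕ)) ≤ exp (c * T / 8) * exp (-c * (4 * T : ℕ)) := by gcongr
        _ = exp (c * T / 8 + -c * (4 * T : ℕ)) := (exp_add _ _).symm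
        _ ≤ _ := exp_le_exp.2 (by push_cast; nlinarith)
    have e2 : K * exp (-c * T) ≤ exp (-(c * T) / 2) := by
      calc K * exp (-c * T) ≤ exp (c * T / 8) * exp (-c * T) := by gcongr
        _ = exp (c * T / 8 + -c * T) := (exp_add _ _).symm
        _ ≤ _ := exp_le_exp.2 (by nlinarith)
    have e3 : u (8 * m) * (K * exp (-c * T) + b T * (u T * u T * u (15 * T - 8 * m))) ≤
        exp (-(c * T) / 2) + exp (l * T / 128 - 17 * (l * T)) := by
      rw [mul_add]
      refine add_le_add ?_ ?_
      · calc u (8 * m) * (K * exp (-c * T)) ≤ 1 * exp (-(c * T) / 2) :=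
            mul_le_mul (hu1 _) e2 (by positivity) zero_le_one
          _ = _ := one_mul _
      · calc u (8 * m) * (b T * (u T * u T * u (15 * T - 8 * m)))
            ≤ exp (-8 * (l * m)) * (exp (l * T / 128) * (exp (-l * T) * exp (-l * T) *
                exp (-15 * (l * T) + 8 * (l * m)))) := by
              have := hu0 T
              have := hu0 (15 * T - 8 * m)
              have := hb0 T
              gcongr
          _ = exp (l * T / 128 - 17 * (l * T)) := by
              rw [← exp_add, ← exp_add, ← exp_add, ← exp_add]; congr 1; ring
    calc b (16 * T) * ((K * exp (-c * (4 * T : ℕ)) + b (16 * T) * (b (4 * T) *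
          (u (8 * m) * (K * exp (-c * T) + b T * (u T * u T * u (15 * T - 8 * m)))))) *
          u (n - 16 * T))
        ≤ exp (l * T / 8) * ((exp (-3 * (c * T)) + exp (l * T / 8) * (exp (l * T / 32) *
          (exp (-(c * T) / 2) + exp (l * T / 128 - 17 * (l * T))))) *
          exp (-l * n + 16 * (l * T))) := by
          have := hu0 T
          have := hu0 (15 * T - 8 * m)
          have := hu0 (8 * m)
          have := hu0 (n - 16 * T)
          have := hb0 T
          have := hb0 (4 * T)
          have := hb0 (16 * T)
          gcongr
      _ = exp (l * T / 8 + -3 * (c * T) + 16 * (l * T)) * exp (-l * n) +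
          exp (l * T / 8 + l * T / 8 + l * T / 32 + -(c * T) / 2 + 16 * (l * T)) * exp (-l * n) +
          exp (l * T / 8 + l * T / 8 + l * T / 32 + (l * T / 128 - 17 * (l * T)) + 16 * (l * T)) *
            exp (-l * n) := by
          simp only [exp_add]; ring
      _ ≤ exp (-l * T / 16) * exp (-l * n) + exp (-l * T / 16) * exp (-l * n) +
          exp (-l * T / 16) * exp (-l * n) := by
          gcongr <;> linarith
      _ = 3 * exp (-l * T / 16) * exp (-l * n) := by ring
  have hz : exp (-l * ℓ / 16) ≤ 1 / 12 := by
    calc exp (-l * ℓ / 16) ≤ exp (-3) := exp_le_exp.2 (by linarith)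
      _ ≤ 1 / 12 := by
        rw [exp_neg, one_div]
        refine inv_anti₀ (by norm_num) ?_
        have h3 := exp_one_gt_d9
        have h4 : exp 3 = exp 1 * exp 1 * exp 1 := by rw [← exp_add, ← exp_add]; norm_num
        rw [h4]
        nlinarith [mul_pos (exp_pos 1) (exp_pos 1)]
  have hC' : ∑ k ∈ Finset.range J, ∑ j ∈ Finset.range (k + 1), b (16 * (2 ^ k * ℓ)) *
        ((K * exp (-c * (4 * (2 ^ k * ℓ) : ℕ)) + b (16 * (2 ^ k * ℓ)) * (b (4 * (2 ^ k * ℓ)) *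
          (u (8 * (2 ^ j * ℓ)) * (K * exp (-c * (2 ^ k * ℓ : ℕ)) + b (2 ^ k * ℓ) *
            (u (2 ^ k * ℓ) * u (2 ^ k * ℓ) * u (15 * (2 ^ k * ℓ) - 8 * (2 ^ j * ℓ))))))) *
          u (n - 16 * (2 ^ k * ℓ))) ≤ 1 / 2 * exp (-l * n) := by
    calc _ ≤ ∑ k ∈ Finset.range J, ∑ j ∈ Finset.range (k + 1),
          3 * exp (-l * ℓ / 16) ^ 2 ^ k * exp (-l * n) :=
        Finset.sum_le_sum fun k hk => Finset.sum_le_sum fun j hj => hC k hk j hj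
      _ = 3 * (∑ k ∈ Finset.range J, ((k : ℝ) + 1) * exp (-l * ℓ / 16) ^ 2 ^ k) *
          exp (-l * n) := by
        rw [Finset.mul_sum, Finset.sum_mul]
        refine Finset.sum_congr rfl fun k _ => ?_
        rw [Finset.sum_const, Finset.card_range, nsmul_eq_mul]
        push_cast; ring
      _ ≤ 3 * (1 / 6) * exp (-l * n) := by
        gcongr
        exact sum_succ_mul_pow_le (exp_pos _).le hz J
      _ = _ := by ring
  linarith

/-- Iterating the basic recursion along dyadic scales. -/
lemma doubling (hu0 : ∀ n, 0 ≤ u n) (hb1 : ∀ n, 1 ≤ b n)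
    (hrec : ∀ R s t : ℕ, R ≤ s → u (s + t) ≤ K * exp (-c * R) + b R * (u s * u t))
    (hc : 0 < c) {k₀ : ℕ} {x : ℕ → ℝ} (h0 : u (2 ^ k₀) ≤ exp (-x 0))
    (hKx : ∀ j, K ≤ exp (x j)) (hR : ∀ j, ⌈3 * x j / c⌉₊ ≤ 2 ^ (k₀ + j))
    (hx : ∀ j, log 2 + log (b ⌈3 * x j / c⌉₊) ≤ 2 * x j - x (j + 1)) (j : ℕ) :
    u (2 ^ (k₀ + j)) ≤ exp (-x j) := by
  induction j with
  | zero => exact h0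
  | succ j ih =>
    set R := ⌈3 * x j / c⌉₊
    have h1 := hrec R _ (2 ^ (k₀ + j)) (hR j)
    have hbR := hb1 R
    have h2 : K * exp (-c * R) ≤ exp (-2 * x j) := by
      have h3 : 3 * x j ≤ c * R := by
        have := (div_le_iff₀ hc).1 (Nat.le_ceil (3 * x j / c))
        rwa [mul_comm c]
      calc K * exp (-c * R) ≤ exp (x j) * exp (-3 * x j) := by
            exact mul_le_mul (hKx j) (exp_le_exp.2 (by linarith)) (exp_pos _).le (exp_pos _).le
        _ = exp (-2 * x j) := by rw [← exp_add]; congr 1; ring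
    rw [← add_assoc, pow_succ, mul_two]
    calc u (2 ^ (k₀ + j) + 2 ^ (k₀ + j))
        ≤ exp (-2 * x j) + b R * (exp (-x j) * exp (-x j)) := by
          refine h1.trans ?_
          have := hu0 (2 ^ (k₀ + j))
          gcongr
      _ = (1 + b R) * exp (-2 * x j) := by rw [← exp_add]; ring_nf
      _ ≤ (2 * b R) * exp (-2 * x j) := by gcongr; linarith
      _ = exp (log 2 + log (b R) + -2 * x j) := by
          rw [exp_add, exp_add, exp_log two_pos, exp_log (by linarith)]
      _ ≤ exp (-x (j + 1)) := exp_le_exp.2 (by linarith [hx j])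

end Numerics

section Growth

open Real

variable {u b : ℕ → ℝ} {K c : ℝ}

lemma ceil_le_four_mul {x : ℝ} (hc : 0 < c) (hx : c ≤ x) : (⌈3 * x / c⌉₊ : ℝ) ≤ 4 * x / c := by
  have h1 : 1 ≤ x / c := (one_le_div hc).2 hx
  have h2 := (Nat.ceil_lt_add_one (a := 3 * x / c) (by have := hc.trans_le hx; positivity)).le
  have e : 4 * x / c = 3 * x / c + x / c := by ring
  linarith

/-- If balls grow subexponentially, the solutions of the recursion beat every stretched
exponential. -/
lemma stretched_decay (hu0 : ∀ n, 0 ≤ u n) (hanti : Antitone u) (hlim : Tendsto u atTop (𝓝 0))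
    (hb1 : ∀ n, 1 ≤ b n)
    (hrec : ∀ R s t : ℕ, R ≤ s → u (s + t) ≤ K * exp (-c * R) + b R * (u s * u t))
    (hc : 0 < c) (hb : ∀ η > 0, ∀ᶠ r : ℕ in atTop, log (b r) ≤ η * r) {ε : ℝ} (hε : 0 < ε)
    (hε1 : ε < 1) : ∀ᶠ n : ℕ in atTop, u n ≤ exp (-(n : ℝ) ^ (1 - ε)) := by
  -- `u (2 ^ (k₀ + j)) ≤ exp (-X D ^ j)` is proved by doubling; `D < 2` leaves room for the growth
  -- of balls, and `D ^ j` is the power `1 - ε / 2` of `2 ^ j`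
  set D : ℝ := 2 ^ (1 - ε / 2)
  have hD1 : 1 ≤ D := one_le_rpow one_le_two (by linarith)
  have hD2 : D < 2 := by
    conv_rhs => rw [← rpow_one 2]
    exact rpow_lt_rpow_of_exponent_lt one_lt_two (by linarith)
  obtain ⟨R₀, hR₀⟩ := eventually_atTop.1 (hb (c * (2 - D) / 8)
    (by have := sub_pos.2 hD2; positivity))
  obtain ⟨X, hX⟩ : ∃ X : ℝ, c ≤ X ∧ K ≤ exp X ∧ log 2 ≤ (2 - D) / 2 * X ∧ c * R₀ ≤ 3 * X := by
    have h1 : ∀ᶠ X : ℝ in atTop, c ≤ X := eventually_ge_atTop c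
    have h2 : ∀ᶠ X : ℝ in atTop, K ≤ exp X := tendsto_exp_atTop.eventually_ge_atTop K
    have h3 : ∀ᶠ X : ℝ in atTop, log 2 ≤ (2 - D) / 2 * X :=
      (tendsto_id.const_mul_atTop (by linarith)).eventually_ge_atTop _
    have h4 : ∀ᶠ X : ℝ in atTop, c * R₀ ≤ 3 * X :=
      (tendsto_id.const_mul_atTop (by norm_num)).eventually_ge_atTop _
    exact (h1.and (h2.and (h3.and h4))).exists
  obtain ⟨hcX, hKX, hlX, hRX⟩ := hX
  have hXpos : 0 < X := hc.trans_le hcX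
  have htwo : Tendsto (fun k : ℕ => 2 ^ k) atTop atTop :=
    tendsto_pow_atTop_atTop_of_one_lt one_lt_two
  obtain ⟨k₀, hk₀, hk₀'⟩ : ∃ k₀ : ℕ, u (2 ^ k₀) ≤ exp (-X) ∧ 4 * X / c ≤ 2 ^ k₀ := by
    have h1 := (hlim.comp htwo).eventually_le_const (exp_pos (-X))
    have h2 : ∀ᶠ k : ℕ in atTop, 4 * X / c ≤ 2 ^ k :=
      (tendsto_pow_atTop_atTop_of_one_lt one_lt_two).eventually_ge_atTop _
    exact (h1.and h2).exists
  have hxX : ∀ j : ℕ, X ≤ X * D ^ j := fun j => le_mul_of_one_le_right hXpos.le (one_le_pow₀ hD1)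
  have key := doubling (x := fun j => X * D ^ j) (k₀ := k₀) hu0 hb1 hrec hc (by simpa using hk₀)
    (fun j => hKX.trans (exp_le_exp.2 (hxX j))) (fun j => ?_) (fun j => ?_)
  · have hpow : ∀ᶠ n : ℕ in atTop, (2 ^ (k₀ + 1) : ℝ) ^ (1 - ε / 2) / X ≤ (n : ℝ) ^ (ε / 2) :=
      ((tendsto_rpow_atTop (by linarith)).comp tendsto_natCast_atTop_atTop).eventually_ge_atTop _
    filter_upwards [hpow, eventually_ge_atTop (2 ^ k₀)] with n hn hnk
    have hn0 : n ≠ 0 := by have := Nat.pos_of_neZero (2 ^ k₀); omega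
    obtain ⟨j, hj⟩ : ∃ j, Nat.log 2 n = k₀ + j :=
      Nat.exists_eq_add_of_le ((Nat.le_log_iff_pow_le one_lt_two hn0).2 hnk)
    have h1 : 2 ^ (k₀ + j) ≤ n := hj ▸ Nat.pow_log_le_self 2 hn0
    have h2 : n < 2 ^ (k₀ + j + 1) := hj ▸ Nat.lt_pow_succ_log_self one_lt_two n
    refine (hanti h1).trans ((key j).trans (exp_le_exp.2 (neg_le_neg ?_)))
    have h3 : (n : ℝ) ≤ 2 ^ (k₀ + 1) * 2 ^ j := by
      rw [← pow_add, show k₀ + 1 + j = k₀ + j + 1 by ring]; exact_mod_cast h2.le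
    have hDj : D ^ j = ((2 : ℝ) ^ j) ^ (1 - ε / 2) := by
      rw [← rpow_natCast, ← rpow_natCast, ← rpow_mul zero_le_two, ← rpow_mul zero_le_two, mul_comm]
    have hnpos : (0 : ℝ) < n := by exact_mod_cast Nat.pos_of_ne_zero hn0
    have h4 : (n : ℝ) ^ (1 - ε / 2) ≤ (2 ^ (k₀ + 1) : ℝ) ^ (1 - ε / 2) * D ^ j := by
      rw [hDj, ← mul_rpow (by positivity) (by positivity)]
      exact rpow_le_rpow hnpos.le h3 (by linarith)
    have h5 : (n : ℝ) ^ (1 - ε / 2) = (n : ℝ) ^ (1 - ε) * (n : ℝ) ^ (ε / 2) := by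
      rw [← rpow_add hnpos]; ring_nf
    have hM : (0 : ℝ) < (2 ^ (k₀ + 1) : ℝ) ^ (1 - ε / 2) := by positivity
    rw [div_le_iff₀ hXpos] at hn
    have h6 : (n : ℝ) ^ (1 - ε) * (2 ^ (k₀ + 1) : ℝ) ^ (1 - ε / 2) ≤
        (X * D ^ j) * (2 ^ (k₀ + 1) : ℝ) ^ (1 - ε / 2) := by
      calc (n : ℝ) ^ (1 - ε) * (2 ^ (k₀ + 1) : ℝ) ^ (1 - ε / 2)
          ≤ (n : ℝ) ^ (1 - ε) * ((n : ℝ) ^ (ε / 2) * X) := by gcongr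
        _ = (n : ℝ) ^ (1 - ε / 2) * X := by rw [h5]; ring
        _ ≤ ((2 ^ (k₀ + 1) : ℝ) ^ (1 - ε / 2) * D ^ j) * X := by gcongr
        _ = _ := by ring
    exact le_of_mul_le_mul_right h6 hM
  · have h1 := ceil_le_four_mul hc (hcX.trans (hxX j))
    have h2 : 4 * (X * D ^ j) / c ≤ 2 ^ (k₀ + j) := by
      calc 4 * (X * D ^ j) / c = 4 * X / c * D ^ j := by ring
        _ ≤ 2 ^ k₀ * 2 ^ j := by gcongr
        _ = _ := (pow_add _ _ _).symm
    exact_mod_cast h1.trans h2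
  · have h1 := ceil_le_four_mul hc (hcX.trans (hxX j))
    have h2 := hR₀ ⌈3 * (X * D ^ j) / c⌉₊ (by
      have : (R₀ : ℝ) ≤ 3 * (X * D ^ j) / c := by
        rw [le_div_iff₀ hc]; linarith [hxX j]
      exact_mod_cast this.trans (Nat.le_ceil _))
    have h3 : c * (2 - D) / 8 * (⌈3 * (X * D ^ j) / c⌉₊ : ℝ) ≤ (2 - D) / 2 * (X * D ^ j) := by
      calc _ ≤ c * (2 - D) / 8 * (4 * (X * D ^ j) / c) := by
            have := sub_pos.2 hD2
            gcongr
        _ = _ := by field_simp; ring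
    have h4 : (2 - D) / 2 * X ≤ (2 - D) / 2 * (X * D ^ j) :=
      mul_le_mul_of_nonneg_left (hxX j) (by linarith)
    rw [pow_succ]
    linarith

/-- If balls grow slower than `exp (o(r / log r))`, the solutions of the two recursions decay
exponentially. -/
lemma exp_decay (hu0 : ∀ n, 0 ≤ u n) (hu1 : ∀ n, u n ≤ 1) (hanti : Antitone u)
    (hlim : Tendsto u atTop (𝓝 0)) (hb1 : ∀ n, 1 ≤ b n) (hK : 0 ≤ K)
    (hrec : ∀ R s t : ℕ, R ≤ s → u (s + t) ≤ K * exp (-c * R) + b R * (u s * u t))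
    (hmulti : ∀ ℓ J n : ℕ, 16 * (2 ^ J * ℓ) ≤ n →
      u n ≤ b (8 * ℓ) * (u (8 * ℓ) * u (n - 8 * ℓ)) +
      ∑ _j ∈ Finset.range (J + 1), K * exp (-c * (8 * (2 ^ J * ℓ) : ℕ)) +
      ∑ k ∈ Finset.range J, ∑ j ∈ Finset.range (k + 1), b (16 * (2 ^ k * ℓ)) *
        ((K * exp (-c * (4 * (2 ^ k * ℓ) : ℕ)) + b (16 * (2 ^ k * ℓ)) * (b (4 * (2 ^ k * ℓ)) *
          (u (8 * (2 ^ j * ℓ)) * (K * exp (-c * (2 ^ k * ℓ : ℕ)) + b (2 ^ k * ℓ) *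
            (u (2 ^ k * ℓ) * u (2 ^ k * ℓ) * u (15 * (2 ^ k * ℓ) - 8 * (2 ^ j * ℓ))))))) *
          u (n - 16 * (2 ^ k * ℓ))))
    (hc : 0 < c) (hb : ∀ η > 0, ∀ᶠ r : ℕ in atTop, log (b r) ≤ η * (r / log r)) :
    ∃ C l : ℝ, 0 < C ∧ 0 < l ∧ ∀ n : ℕ, u n ≤ C * exp (-l * n) := by
  have htwo : Tendsto (fun k : ℕ => 2 ^ k) atTop atTop :=
    tendsto_pow_atTop_atTop_of_one_lt one_lt_two
  obtain ⟨R₀, hR₀⟩ := eventually_atTop.1 (hb (c / 32) (by positivity))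
  -- `k ≤ δ 2 ^ k` and `k ^ 2 ≤ 2 ^ k` for large `k`, and similar comparisons
  have hsmall : ∀ δ > 0, ∀ᶠ k : ℕ in atTop, (k : ℝ) ≤ δ * 2 ^ k := by
    intro δ hδ
    have := (tendsto_pow_const_div_const_pow_of_one_lt 1
      (r := (2 : ℝ)) one_lt_two).eventually_le_const hδ
    filter_upwards [this] with k hk
    rwa [div_le_iff₀ (by positivity), pow_one] at hk
  have hev : ∀ᶠ k : ℕ in atTop, 1 ≤ k ∧ K * k ≤ 2 ^ k ∧ c * k ≤ 2 ^ k ∧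
      ((k : ℝ) + 1) * k ≤ 2 ^ k ∧ c * exp (k / 4) * k ≤ 3 * 2 ^ k ∧ (R₀ : ℝ) ≤ exp (k / 4) := by
    have hr : (1 : ℝ) < 2 / exp (1 / 4) := by
      rw [one_lt_div (exp_pos _)]
      have h1 : exp (1 / 4) < 2 := by
        have : exp (1 / 4) ≤ exp (log 2) := by
          exact exp_le_exp.2 (by linarith [log_two_gt_d9])
        rw [exp_log two_pos] at this
        refine lt_of_le_of_ne this fun h => ?_
        have h2 : (1 / 4 : ℝ) = log 2 := by rw [← h, log_exp]
        linarith [log_two_gt_d9]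
      exact h1
    have h3 := (tendsto_pow_const_div_const_pow_of_one_lt 1 hr).eventually_le_const
      (show (0 : ℝ) < 3 / c by positivity)
    have h2 := (tendsto_pow_const_div_const_pow_of_one_lt 2
      (r := (2 : ℝ)) one_lt_two).eventually_le_const (show (0 : ℝ) < 1 / 2 by norm_num)
    have h4 : Tendsto (fun k : ℕ => exp ((k : ℝ) / 4)) atTop atTop :=
      tendsto_exp_atTop.comp (tendsto_natCast_atTop_atTop.atTop_div_const (by norm_num))
    have hK' := hsmall (1 / (K + 1)) (by positivity)
    have hc' := hsmall (1 / c) (by positivity)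
    filter_upwards [eventually_ge_atTop 1, h3, h2, h4.eventually_ge_atTop (R₀ : ℝ), hK', hc']
      with k k1 k3 k2 k4 kK kc
    have k1' : (1 : ℝ) ≤ k := by exact_mod_cast k1
    refine ⟨k1, ?_, ?_, ?_, ?_, k4⟩
    · have : (K + 1) * (k : ℝ) ≤ 2 ^ k := by
        calc (K + 1) * (k : ℝ) ≤ (K + 1) * (1 / (K + 1) * 2 ^ k) := by gcongr
          _ = _ := by field_simp
      nlinarith
    · calc c * (k : ℝ) ≤ c * (1 / c * 2 ^ k) := by gcongr
        _ = _ := by field_simp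
    · rw [div_le_iff₀ (by positivity)] at k2
      nlinarith
    · rw [div_pow, ← exp_nat_mul, div_le_iff₀ (by positivity), pow_one] at k3
      have e : exp ((k : ℝ) * (1 / 4)) = exp (k / 4) := by congr 1; ring
      rw [e] at k3
      calc c * exp (k / 4) * k ≤ c * exp (k / 4) * (3 / c * (2 ^ k / exp (k / 4))) := by gcongr
        _ = 3 * 2 ^ k := by field_simp
  obtain ⟨k₁, hk₁⟩ := eventually_atTop.1 hev
  have hk₁pos : (1 : ℝ) ≤ k₁ := by exact_mod_cast (hk₁ k₁ le_rfl).1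
  obtain ⟨k₀, hk₀, hk₀', hk₀k₁⟩ : ∃ k₀ : ℕ, u (2 ^ k₀) ≤ exp (-2 ^ k₁) ∧
      4 * 2 ^ k₁ / c ≤ 2 ^ k₀ ∧ k₁ ≤ k₀ := by
    have h1 := (hlim.comp htwo).eventually_le_const (exp_pos (-2 ^ k₁))
    have h2 : ∀ᶠ k : ℕ in atTop, 4 * 2 ^ k₁ / c ≤ 2 ^ k :=
      (tendsto_pow_atTop_atTop_of_one_lt one_lt_two).eventually_ge_atTop _
    exact (h1.and (h2.and (eventually_ge_atTop k₁))).exists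
  -- doubling yields `u (2 ^ (k₀ + j)) ≤ exp (-x j)`, where `x j` falls short of the scale only by
  -- the factor `k₁ + j`, essentially the logarithm of the scale: `2 x j - x (j + 1)` is about
  -- `2 x j / (k₁ + j)`, which leaves room for the growth of balls
  set x : ℕ → ℝ := fun j => 2 ^ (k₁ + j) * k₁ / (k₁ + j) with hx
  have hden : ∀ j : ℕ, (0 : ℝ) < k₁ + j := fun j => by positivity
  have hxlow : ∀ j : ℕ, 2 ^ (k₁ + j) ≤ x j * (k₁ + j) := fun j => by
    rw [hx]; dsimp only
    rw [div_mul_cancel₀ _ (hden j).ne']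
    exact le_mul_of_one_le_right (by positivity) hk₁pos
  have hxup : ∀ j : ℕ, x j ≤ 2 ^ (k₁ + j) := fun j => by
    rw [hx]; dsimp only
    rw [div_le_iff₀ (hden j)]
    gcongr
    linarith [(Nat.cast_nonneg j : (0 : ℝ) ≤ j)]
  have hfacts : ∀ j : ℕ, K ≤ x j ∧ c ≤ x j ∧ (k₁ : ℝ) + j + 1 ≤ x j ∧
      c * exp ((k₁ + j) / 4) ≤ 3 * x j ∧ (R₀ : ℝ) ≤ exp (((k₁ : ℝ) + j) / 4) := by
    intro j
    obtain ⟨-, h1, h2, h3, h4, h5⟩ := hk₁ (k₁ + j) (by omega)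
    have h := hxlow j
    push_cast at h1 h2 h3 h4 h5
    refine ⟨?_, ?_, ?_, ?_, h5⟩
    · exact le_of_mul_le_mul_right (h1.trans h) (hden j)
    · exact le_of_mul_le_mul_right (h2.trans h) (hden j)
    · exact le_of_mul_le_mul_right (h3.trans h) (hden j)
    · refine le_of_mul_le_mul_right (h4.trans ?_) (hden j)
      linarith
  have key := doubling (x := x) (k₀ := k₀) hu0 hb1 hrec hc
    (hk₀.trans_eq (by simp only [hx, add_zero, Nat.cast_zero]; field_simp))
    (fun j => (hfacts j).1.trans (by linarith [add_one_le_exp (x j)])) (fun j => ?_) (fun j => ?_)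
  rotate_left
  · have h1 := ceil_le_four_mul hc (hfacts j).2.1
    have h2 : 4 * x j / c ≤ 2 ^ (k₀ + j) := by
      calc 4 * x j / c ≤ 4 * 2 ^ (k₁ + j) / c := by gcongr; exact hxup j
        _ = 4 * 2 ^ k₁ / c * 2 ^ j := by rw [pow_add]; ring
        _ ≤ 2 ^ k₀ * 2 ^ j := by gcongr
        _ = _ := (pow_add _ _ _).symm
    exact_mod_cast h1.trans h2
  · obtain ⟨-, hcx, hkx, hex, hR⟩ := hfacts j
    set R := ⌈3 * x j / c⌉₊ with hRdef
    have h1 : (R : ℝ) ≤ 4 * x j / c := ceil_le_four_mul hc hcx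
    have h2 : exp ((k₁ + j) / 4) ≤ R := by
      refine le_trans ?_ (Nat.le_ceil _)
      rwa [le_div_iff₀ hc, mul_comm]
    have h3 := hR₀ R (by exact_mod_cast hR.trans h2)
    have h4 : ((k₁ : ℝ) + j) / 4 ≤ log R := by
      rw [le_log_iff_exp_le ((exp_pos _).trans_le h2)]; exact h2
    have hk := hden j
    have hx0 : 0 < x j := hc.trans_le hcx
    have h5 : log (b R) ≤ x j / (2 * (k₁ + j)) := by
      refine h3.trans ?_
      calc c / 32 * ((R : ℝ) / log R) ≤ c / 32 * ((4 * x j / c) / ((k₁ + j) / 4)) := by gcongr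
        _ = x j / (2 * (k₁ + j)) := by field_simp; ring
    have h1k : (1 : ℝ) ≤ k₁ + j := by linarith [(Nat.cast_nonneg j : (0 : ℝ) ≤ j)]
    have h6 : x j / (2 * (k₁ + j)) ≤ x j / (k₁ + j + 1) := by gcongr; linarith
    have h7 : log 2 ≤ x j / (k₁ + j + 1) := by
      rw [le_div_iff₀ (by linarith)]
      nlinarith [log_two_lt_d9]
    have h8 : 2 * x j - x (j + 1) = 2 * (x j / (k₁ + j + 1)) := by
      simp only [hx]
      push_cast
      rw [← add_assoc, pow_succ]
      field_simp
      ring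
    linarith
  -- the scale at which the multi-scale recursion takes over
  set β : ℝ := 2 ^ k₁ * k₁ / (32 * 2 ^ k₀) with hβ
  have hβpos : 0 < β := by positivity
  obtain ⟨N, hN⟩ := eventually_atTop.1 (hb (β * log 2 / 128) (by
    have := log_pos one_lt_two; positivity))
  have hKlim : ∀ᶠ n : ℕ in atTop, K * n * exp (-c * n / 8) ≤ 1 / 4 := by
    have h1 : Tendsto (fun y : ℝ => y ^ 1 * exp (-y)) atTop (𝓝 0) :=
      tendsto_pow_mul_exp_neg_atTop_nhds_zero 1
    have h2 : Tendsto (fun n : ℕ => c / 8 * (n : ℝ)) atTop atTop :=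
      tendsto_natCast_atTop_atTop.const_mul_atTop (by positivity)
    have h3 := ((h1.comp h2).const_mul (K * (8 / c))).eventually_le_const
      (show K * (8 / c) * 0 < 1 / 4 by norm_num)
    filter_upwards [h3] with n hn
    refine le_trans (le_of_eq ?_) hn
    simp only [Function.comp, pow_one]
    rw [show -(c / 8 * (n : ℝ)) = -c * n / 8 by ring]
    field_simp
  obtain ⟨N', hN'⟩ := eventually_atTop.1 hKlim
  have hlarge : ∀ᶠ j : ℕ in atTop, N ≤ 2 ^ j ∧ N' ≤ 2 ^ j ∧ 64 * β / c ≤ (j : ℝ) ∧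
      48 / β * (k₁ + j) ≤ 2 ^ (k₀ + j) := by
    have h3 : ∀ᶠ j : ℕ in atTop, 48 / β * (k₁ + j) ≤ 2 ^ (k₀ + j) := by
      have h := (tendsto_add_atTop_nat k₀).eventually (hsmall (β / 48) (by positivity))
      filter_upwards [h] with j hj
      have h1 : ((k₁ : ℝ) + j) ≤ (j + k₀ : ℕ) := by
        push_cast
        have : (k₁ : ℝ) ≤ k₀ := by exact_mod_cast hk₀k₁
        linarith
      calc 48 / β * (k₁ + j) ≤ 48 / β * (β / 48 * 2 ^ (j + k₀)) := by
            gcongr; exact h1.trans hj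
        _ = 2 ^ (k₀ + j) := by rw [add_comm j]; field_simp
    exact (htwo.eventually_ge_atTop N).and ((htwo.eventually_ge_atTop N').and
      ((tendsto_natCast_atTop_atTop.eventually_ge_atTop _).and h3))
  obtain ⟨j, hjN, hjN', hjc, hj48⟩ := hlarge.exists
  have h2j : 2 ^ j ≤ 2 ^ (k₀ + j) := Nat.pow_le_pow_right two_pos (by omega)
  set l : ℝ := β / (k₁ + j) with hl
  have hlpos : 0 < l := div_pos hβpos (hden j)
  have hfinal := exp_decay_of_multiscale (ℓ := 2 ^ (k₀ + j)) hu0 hu1 hanti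
    (fun n => zero_le_one.trans (hb1 n)) hK (by positivity) (fun J n => hmulti _ J n) hlpos
    ?_ ?_ ?_ ?_ (fun n hn => hN' n (by omega))
  · refine ⟨exp (l * 2 ^ (k₀ + j)), l, exp_pos _, hlpos, fun n => ?_⟩
    rw [← exp_add]
    rcases le_total (2 ^ (k₀ + j)) n with h | h
    · refine (hfinal n h).trans (exp_le_exp.2 ?_)
      have : (0 : ℝ) ≤ l * 2 ^ (k₀ + j) := by positivity
      linarith
    · refine (hu1 n).trans (one_le_exp ?_)
      have : (n : ℝ) ≤ 2 ^ (k₀ + j) := by exact_mod_cast h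
      nlinarith
  · rw [hl, ← mul_div_assoc, div_le_iff₀ (hden j)]
    rw [div_le_iff₀ hc] at hjc
    nlinarith
  · rw [hl, div_mul_eq_mul_div, le_div_iff₀ (hden j)]
    push_cast
    calc 48 * ((k₁ : ℝ) + j) = β * (48 / β * (k₁ + j)) := by field_simp
      _ ≤ β * 2 ^ (k₀ + j) := by gcongr
  · intro r hr
    have hb0 : 0 < b r := zero_lt_one.trans_le (hb1 r)
    rw [← log_le_iff_le_exp hb0]
    refine (hN r (by omega)).trans ?_
    have hr' : (2 : ℝ) ^ (k₀ + j) ≤ r := by exact_mod_cast hr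
    have hlog2 := log_pos one_lt_two
    have h1 : ((k₁ : ℝ) + j) * log 2 ≤ log r := by
      have h2 := log_le_log (by positivity) hr'
      rw [log_pow] at h2
      refine le_trans ?_ h2
      push_cast
      gcongr
    calc β * log 2 / 128 * ((r : ℝ) / log r)
        ≤ β * log 2 / 128 * ((r : ℝ) / ((k₁ + j) * log 2)) := by
          have := hden j
          gcongr
      _ = l * r / 128 := by rw [hl]; field_simp
  · refine (key j).trans (exp_le_exp.2 (le_of_eq ?_))
    simp only [hx, hl, hβ]
    push_cast
    have := hden j
    field_simp
    ring

end Growth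

/-! ### The growth of balls -/

section QuasiTransitive

variable {V Γ : Type*} [Group Γ] [MulAction Γ V] {G : SimpleGraph V}

lemma edist_smul (haut : ActsByAutomorphisms Γ G) (γ : Γ) (u v : V) :
    G.edist (γ • u) (γ • v) = G.edist u v := by
  have key : ∀ (γ : Γ) (u v : V), G.edist (γ • u) (γ • v) ≤ G.edist u v := by
    intro γ u v
    by_cases h : G.edist u v = ⊤
    · rw [h]; exact le_top
    · obtain ⟨p, hp⟩ := SimpleGraph.exists_walk_of_edist_ne_top h
      rw [← hp]
      refine (SimpleGraph.edist_le
        (p.map ⟨fun x => γ • x, fun {a b} hab => (haut γ a b).2 hab⟩)).trans ?_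
      rw [SimpleGraph.Walk.length_map]
  refine le_antisymm (key γ u v) ?_
  simpa using key γ⁻¹ (γ • u) (γ • v)

lemma smul_mem_closedBall (haut : ActsByAutomorphisms Γ G) (γ : Γ) {u v : V} {r : ℕ} :
    γ • u ∈ closedBall G (γ • v) r ↔ u ∈ closedBall G v r := by
  simp [closedBall, edist_smul haut]

lemma ncard_closedBall_smul (haut : ActsByAutomorphisms Γ G) (γ : Γ) (v : V) (r : ℕ) :
    (closedBall G (γ • v) r).ncard = (closedBall G v r).ncard := by
  rw [← Set.ncard_image_of_injective (closedBall G v r) (MulAction.injective γ)]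
  congr 1
  ext u
  constructor
  · intro hu
    refine ⟨γ⁻¹ • u, ?_, by simp⟩
    rw [← smul_mem_closedBall haut γ]; simpa using hu
  · rintro ⟨w, hw, rfl⟩
    exact (smul_mem_closedBall haut γ).2 hw

lemma bddAbove_ncard_closedBall (haut : ActsByAutomorphisms Γ G) (hqt : QuasiTransitive Γ V)
    (r : ℕ) : BddAbove (Set.range fun v => (closedBall G v r).ncard) := by
  have : Finite (MulAction.orbitRel.Quotient Γ V) := hqt
  refine ((Set.finite_range fun x : MulAction.orbitRel.Quotient Γ V =>
    (closedBall G x.out r).ncard).subset ?_).bddAbove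
  rintro - ⟨v, rfl⟩
  refine ⟨Quotient.mk _ v, ?_⟩
  have h : (MulAction.orbitRel Γ V).r (Quotient.out (Quotient.mk (MulAction.orbitRel Γ V) v)) v :=
    Quotient.mk_out v
  obtain ⟨γ, hγ⟩ := h
  dsimp only at hγ ⊢
  rw [← hγ]
  exact ncard_closedBall_smul haut γ v r

lemma card_ballFinset_le_growth (hG : IsLocallyFinite G) (haut : ActsByAutomorphisms Γ G)
    (hqt : QuasiTransitive Γ V) (v : V) (r : ℕ) : (ballFinset hG v r).card ≤ growth G r := by
  rw [ballFinset, ← Set.ncard_eq_toFinset_card _ (closedBall_finite hG v r)]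
  exact le_ciSup (bddAbove_ncard_closedBall haut hqt r) v

lemma one_le_growth [Nonempty V] (hG : IsLocallyFinite G) (haut : ActsByAutomorphisms Γ G)
    (hqt : QuasiTransitive Γ V) (r : ℕ) : 1 ≤ growth G r := by
  obtain ⟨v⟩ := ‹Nonempty V›
  exact (Finset.card_pos.2 ⟨v, self_mem_ballFinset hG v r⟩).trans_le
    (card_ballFinset_le_growth hG haut hqt v r)

end QuasiTransitive

/-! ### Decay under weak spatial mixing -/

section WeakSpatialMixing

variable {V A S : Type*} {G : SimpleGraph V} {hG : IsLocallyFinite G}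
  [LinearOrder S] [BoundedOrder S] {f : V → A → (V → S) → S} [MeasurableSpace A] {q : PMF A}

lemma coe_toNNReal_decay (n : ℕ) :
    decay hG q f n = ((decay hG q f n).toNNReal : ℝ≥0∞) :=
  (ENNReal.coe_toNNReal (ne_top_of_le_ne_top ENNReal.one_ne_top (decay_le_one hG n))).symm

variable [Fintype S] [Fintype A] [MeasurableSingletonClass A] {ρ : UpDownSpec V S} {b : ℕ → ℕ}

lemma influenceBound_of_mixing {C c : ℝ}
    (h : ∀ (v : V) (r : ℕ), tvDist (marginal (ρ.meas (ballFinset hG v r) ⊤) v)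
      (marginal (ρ.meas (ballFinset hG v r) ⊥) v) ≤ C * Real.exp (-c * r)) :
    InfluenceBound hG ρ fun R => ENNReal.ofReal (Fintype.card S * (2 * C) * Real.exp (-c * R)) := by
  intro w R
  rw [← ENNReal.ofReal_natCast, ← ENNReal.ofReal_mul (Nat.cast_nonneg _)]
  refine ENNReal.ofReal_le_ofReal ?_
  rw [mul_assoc, mul_assoc]
  have := h w R
  gcongr

lemma tendsto_decay_of_mixing (H : HeatBath ρ q f) (hirr : ρ.Irreducible)
    (hb : ∀ v r, (ballFinset hG v r).card ≤ b r) (hW : ρ.WeakSpatialMixing hG) :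
    Tendsto (decay hG q f) atTop (𝓝 0) := by
  obtain ⟨C, c, hC, hc, h⟩ := hW
  refine tendsto_decay H hirr (influenceBound_of_mixing h) ?_ hb
  rw [← ENNReal.ofReal_zero]
  refine ENNReal.tendsto_ofReal ?_
  have h1 : Tendsto (fun R : ℕ => c * (R : ℝ)) atTop atTop :=
    tendsto_natCast_atTop_atTop.const_mul_atTop hc
  have h2 := (Real.tendsto_exp_neg_atTop_nhds_zero.comp h1).const_mul
    (Fintype.card S * (2 * C) : ℝ)
  simpa [Function.comp_def] using h2

/-- The recursions, as inequalities between real numbers. -/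
lemma toReal_decay_recursions (H : HeatBath ρ q f) (hρ : ρ.Monotonic)
    (hb : ∀ v r, (ballFinset hG v r).card ≤ b r) {K c : ℝ} (hK : 0 ≤ K)
    (hg : InfluenceBound hG ρ fun R => ENNReal.ofReal (K * Real.exp (-c * R))) :
    (∀ R s t : ℕ, R ≤ s → (decay hG q f (s + t)).toReal ≤ K * Real.exp (-c * R) +
      (b R : ℝ) * ((decay hG q f s).toReal * (decay hG q f t).toReal)) ∧
    ∀ ℓ J n : ℕ, 16 * (2 ^ J * ℓ) ≤ n →
      (decay hG q f n).toReal ≤ (b (8 * ℓ) : ℝ) *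
        ((decay hG q f (8 * ℓ)).toReal * (decay hG q f (n - 8 * ℓ)).toReal) +
      ∑ _j ∈ Finset.range (J + 1), K * Real.exp (-c * (8 * (2 ^ J * ℓ) : ℕ)) +
      ∑ k ∈ Finset.range J, ∑ j ∈ Finset.range (k + 1), (b (16 * (2 ^ k * ℓ)) : ℝ) *
        ((K * Real.exp (-c * (4 * (2 ^ k * ℓ) : ℕ)) + (b (16 * (2 ^ k * ℓ)) : ℝ) *
          ((b (4 * (2 ^ k * ℓ)) : ℝ) * ((decay hG q f (8 * (2 ^ j * ℓ))).toReal *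
            (K * Real.exp (-c * (2 ^ k * ℓ : ℕ)) + (b (2 ^ k * ℓ) : ℝ) *
            ((decay hG q f (2 ^ k * ℓ)).toReal * (decay hG q f (2 ^ k * ℓ)).toReal *
              (decay hG q f (15 * (2 ^ k * ℓ) - 8 * (2 ^ j * ℓ))).toReal))))) *
          (decay hG q f (n - 16 * (2 ^ k * ℓ))).toReal) := by
  -- in `ℝ≥0` the casts commute with all operations involved
  set u : ℕ → ℝ≥0 := fun n => (decay hG q f n).toNNReal
  set g : ℕ → ℝ≥0 := fun R => (K * Real.exp (-c * R)).toNNReal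
  have hu : ∀ n, decay hG q f n = (u n : ℝ≥0∞) := coe_toNNReal_decay
  have hu' : ∀ n, (decay hG q f n).toReal = (u n : ℝ) := fun n => by rw [hu]; rfl
  have hg' : InfluenceBound hG ρ fun R => (g R : ℝ≥0∞) := hg
  have hgK : ∀ R : ℕ, K * Real.exp (-c * R) = (g R : ℝ) := fun R =>
    (Real.coe_toNNReal _ (by positivity)).symm
  simp only [hu', hgK]
  constructor
  · intro R s t hR
    have h := decay_add_le (hG := hG) (R := R) (s := s) H hρ hg' hb hR t
    simp only [hu] at h
    exact_mod_cast h
  · intro ℓ J n hn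
    have h := decay_le_multiscale (hG := hG) (J := J) H hρ hg' hb hn
    simp only [hu] at h
    exact_mod_cast h

lemma stretched_decay_of_mixing (H : HeatBath ρ q f) (hρ : ρ.Monotonic) (hirr : ρ.Irreducible)
    (hb : ∀ v r, (ballFinset hG v r).card ≤ b r) (hb1 : ∀ r, 1 ≤ b r)
    (hW : ρ.WeakSpatialMixing hG)
    (hgrowth : (fun r : ℕ => Real.log (b r)) =o[atTop] (fun r : ℕ => (r : ℝ))) {ε : ℝ}
    (hε : 0 < ε) (hε1 : ε < 1) :
    ∀ᶠ n : ℕ in atTop, decay hG q f n ≤ ENNReal.ofReal (Real.exp (-(n : ℝ) ^ (1 - ε))) := by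
  have hlim := tendsto_decay_of_mixing H hirr hb hW
  obtain ⟨C, c, hC, hc, h⟩ := hW
  have hrec := toReal_decay_recursions (hG := hG) H hρ hb
    (K := Fintype.card S * (2 * C)) (c := c) (by positivity) (influenceBound_of_mixing h)
  have hfin : ∀ n, decay hG q f n ≠ ⊤ := fun n => by rw [coe_toNNReal_decay]; simp
  have key := stretched_decay (u := fun n => (decay hG q f n).toReal) (b := fun n => (b n : ℝ))
    (fun n => ENNReal.toReal_nonneg)
    (fun m n hmn => ENNReal.toReal_mono (hfin m) (decay_antitone hG H.mono hmn))
    ((ENNReal.tendsto_toReal ENNReal.zero_ne_top).comp hlim)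
    (fun n => by exact_mod_cast hb1 n) hrec.1 hc (fun η hη => ?_) hε hε1
  · filter_upwards [key] with n hn
    rw [← ENNReal.ofReal_toReal (hfin n)]
    exact ENNReal.ofReal_le_ofReal hn
  · filter_upwards [hgrowth.bound hη] with r hr
    simpa using (le_abs_self _).trans hr

lemma exp_decay_of_mixing (H : HeatBath ρ q f) (hρ : ρ.Monotonic) (hirr : ρ.Irreducible)
    (hb : ∀ v r, (ballFinset hG v r).card ≤ b r) (hb1 : ∀ r, 1 ≤ b r)
    (hW : ρ.WeakSpatialMixing hG)
    (hgrowth : (fun r : ℕ => Real.log (b r)) =o[atTop] (fun r : ℕ => (r : ℝ) / Real.log r)) :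
    ∃ C l : ℝ, 0 < C ∧ 0 < l ∧ ∀ n : ℕ,
      decay hG q f n ≤ ENNReal.ofReal (C * Real.exp (-l * n)) := by
  have hlim := tendsto_decay_of_mixing H hirr hb hW
  obtain ⟨C, c, hC, hc, h⟩ := hW
  have hrec := toReal_decay_recursions (hG := hG) H hρ hb
    (K := Fintype.card S * (2 * C)) (c := c) (by positivity) (influenceBound_of_mixing h)
  have hfin : ∀ n, decay hG q f n ≠ ⊤ := fun n => by rw [coe_toNNReal_decay]; simp
  have hbound : ∀ η > 0, ∀ᶠ r : ℕ in atTop, Real.log (b r) ≤ η * ((r : ℝ) / Real.log r) := by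
    intro η hη
    filter_upwards [hgrowth.bound hη, eventually_ge_atTop 1] with r hr hr1
    have h1 : (1 : ℝ) ≤ r := by exact_mod_cast hr1
    refine (le_abs_self _).trans (hr.trans_eq ?_)
    rw [Real.norm_of_nonneg (div_nonneg (by linarith) (Real.log_nonneg h1))]
  obtain ⟨C', l, hC', hl, key⟩ := exp_decay (u := fun n => (decay hG q f n).toReal)
    (b := fun n => (b n : ℝ)) (fun n => ENNReal.toReal_nonneg)
    (fun n => ENNReal.toReal_mono ENNReal.one_ne_top (decay_le_one hG n))
    (fun m n hmn => ENNReal.toReal_mono (hfin m) (decay_antitone hG H.mono hmn))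
    ((ENNReal.tendsto_toReal ENNReal.zero_ne_top).comp hlim)
    (fun n => by exact_mod_cast hb1 n) (by positivity) hrec.1 hrec.2 hc hbound
  refine ⟨C', l, hC', hl, fun n => ?_⟩
  rw [← ENNReal.ofReal_toReal (hfin n)]
  exact ENNReal.ofReal_le_ofReal (key n)

end WeakSpatialMixing

/-! ### A monotone coupling of finitely many laws -/

section Quantile

lemma toOuterMeasure_le_one {α : Type*} (p : PMF α) (E : Set α) : p.toOuterMeasure E ≤ 1 :=
  (p.toOuterMeasure.mono (Set.subset_univ E)).trans_eq
    (toOuterMeasure_eq_one p (Set.subset_univ _))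

variable {S : Type*} [LinearOrder S] [Fintype S]

/-- The distribution function of a law on a finite linear order. -/
def cdf (m : PMF S) (s : S) : ℝ := ∑ t with t ≤ s, (m t).toReal

lemma cdf_eq (m : PMF S) (s : S) : cdf m s = (m.toOuterMeasure (Set.Iic s)).toReal := by
  rw [PMF.toOuterMeasure_apply_fintype, ENNReal.toReal_sum, cdf, Finset.sum_filter]
  · refine Finset.sum_congr rfl fun t _ => ?_
    by_cases h : t ≤ s <;> simp [h]
  · intro t _
    by_cases h : t ≤ s <;> simp [h, m.apply_ne_top]

lemma cdf_eq_add (m : PMF S) (s : S) : cdf m s = (m s).toReal + ∑ t with t < s, (m t).toReal := by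
  have e : (Finset.univ.filter fun t => t ≤ s) = insert s (Finset.univ.filter fun t => t < s) := by
    ext t; simp [le_iff_eq_or_lt]
  rw [cdf, e, Finset.sum_insert (by simp)]

lemma StochLE.cdf_le {m m' : PMF S} (h : StochLE m m') (s : S) : cdf m' s ≤ cdf m s := by
  rw [cdf_eq, cdf_eq]
  set E : Set S := Set.Iic s
  exact ENNReal.toReal_mono (ne_top_of_le_ne_top ENNReal.one_ne_top (toOuterMeasure_le_one m E))
    (h.dual E fun a b hab ha => le_trans (α := S) hab ha)

variable [BoundedOrder S]

/-- The quantile function: the least `s` at which the distribution function reaches `x`. -/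
def quantile (m : PMF S) (x : ℝ) : S := (Finset.univ.filter fun s => x ≤ cdf m s).inf id

lemma cdf_top (m : PMF S) : cdf m ⊤ = 1 := by
  rw [cdf_eq, Set.Iic_top, toOuterMeasure_eq_one m (Set.subset_univ _), ENNReal.toReal_one]

lemma StochLE.quantile_le {m m' : PMF S} (h : StochLE m m') (x : ℝ) :
    quantile m x ≤ quantile m' x :=
  Finset.inf_mono fun s hs => by
    simp only [Finset.mem_filter, Finset.mem_univ, true_and] at hs ⊢
    exact hs.trans (h.cdf_le s)

lemma quantile_eq_iff (m : PMF S) {x : ℝ} (hx0 : 0 < x) (hx1 : x ≤ 1) (s : S) :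
    quantile m x = s ↔ ∑ t with t < s, (m t).toReal < x ∧ x ≤ cdf m s := by
  have hmono : ∀ t t', t < t' → cdf m t ≤ ∑ t'' with t'' < t', (m t'').toReal := by
    intro t t' h
    refine Finset.sum_le_sum_of_subset_of_nonneg (fun a ha => ?_) fun _ _ _ => ENNReal.toReal_nonneg
    simp only [Finset.mem_filter, Finset.mem_univ, true_and] at ha ⊢
    exact ha.trans_lt h
  constructor
  · intro hs
    have hne : (Finset.univ.filter fun s => x ≤ cdf m s).Nonempty :=
      ⟨⊤, by simpa [cdf_top] using hx1⟩
    obtain ⟨t, ht, he⟩ := Finset.exists_mem_eq_inf _ hne id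
    have hts : t = s := he.symm.trans hs
    subst hts
    simp only [Finset.mem_filter, Finset.mem_univ, true_and] at ht
    refine ⟨?_, ht⟩
    by_contra! hle
    have hne' : (Finset.univ.filter fun t' => t' < t).Nonempty := by
      by_contra hemp
      rw [Finset.not_nonempty_iff_eq_empty.1 hemp, Finset.sum_empty] at hle
      linarith
    set t' := (Finset.univ.filter fun t' => t' < t).max' hne' with ht'
    have h1 : t' < t := (Finset.mem_filter.1 (Finset.max'_mem _ hne')).2
    have h2 : ∑ t'' with t'' < t, (m t'').toReal ≤ cdf m t' := by
      refine Finset.sum_le_sum_of_subset_of_nonneg (fun a ha => ?_)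
        fun _ _ _ => ENNReal.toReal_nonneg
      simp only [Finset.mem_filter, Finset.mem_univ, true_and]
      exact Finset.le_max' _ _ ha
    have h3 : quantile m x ≤ t' := Finset.inf_le (f := id)
      (Finset.mem_filter.2 ⟨Finset.mem_univ _, hle.trans h2⟩)
    rw [hs] at h3
    exact absurd h1 (not_lt.2 h3)
  · rintro ⟨h1, h2⟩
    refine le_antisymm (Finset.inf_le (f := id) (by simpa using h2)) (Finset.le_inf fun t ht => ?_)
    simp only [Finset.mem_filter, Finset.mem_univ, true_and] at ht
    by_contra! hlt
    exact absurd ht (not_le.2 ((hmono t s hlt).trans_lt h1))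

lemma quantile_preimage (m : PMF S) (s : S) :
    (Set.Ioc (0 : ℝ) 1) ∩ quantile m ⁻¹' {s} =
      Set.Ioc (∑ t with t < s, (m t).toReal) (cdf m s) := by
  ext x
  constructor
  · rintro ⟨hx, h⟩
    exact (quantile_eq_iff m hx.1 hx.2 s).1 h
  · intro hx
    have h0 : 0 < x := lt_of_le_of_lt (Finset.sum_nonneg fun _ _ => ENNReal.toReal_nonneg) hx.1
    have h1 : x ≤ 1 := hx.2.trans (by
      rw [cdf_eq]
      exact ENNReal.toReal_mono ENNReal.one_ne_top (toOuterMeasure_le_one m _))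
    exact ⟨⟨h0, h1⟩, (quantile_eq_iff m h0 h1 s).2 hx⟩

/-- The uniform law on the unit interval. -/
def unitLaw : Measure ℝ := volume.restrict (Set.Ioc 0 1)

instance : IsProbabilityMeasure unitLaw := ⟨by simp [unitLaw]⟩

lemma unitLaw_quantile (m : PMF S) (s : S) : unitLaw (quantile m ⁻¹' {s}) = m s := by
  rw [unitLaw, Measure.restrict_apply' measurableSet_Ioc, Set.inter_comm, quantile_preimage,
    Real.volume_Ioc, cdf_eq_add, add_sub_cancel_right, ENNReal.ofReal_toReal (m.apply_ne_top s)]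

/-- Selections of a state for every law of a family, monotone for stochastic domination. -/
abbrev MonotoneSelection (M : Set (PMF S)) : Type _ :=
  {a : M → S // ∀ m m' : M, StochLE (m : PMF S) m' → a m ≤ a m'}

/-- The selection of the quantiles at level `x`. -/
def quantileSelection (M : Set (PMF S)) (x : ℝ) : MonotoneSelection M :=
  ⟨fun m => quantile m x, fun _ _ h => h.quantile_le x⟩

/-- Finitely many laws on a finite linear order can be coupled monotonically by a finite noise. -/
lemma exists_law_selection {M : Set (PMF S)} (hM : M.Finite) :
    ∃ q : PMF (MonotoneSelection M), ∀ m : M, q.map (fun a => a.1 m) = m := by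
  have := hM.to_subtype
  have : Finite (MonotoneSelection M) := inferInstance
  let : MeasurableSpace (MonotoneSelection M) := ⊤
  have hmeas1 : ∀ m : PMF S, ∀ s, MeasurableSet (Set.Ioc (0 : ℝ) 1 ∩ quantile m ⁻¹' {s}) :=
    fun m s => by rw [quantile_preimage]; exact measurableSet_Ioc
  have hae : AEMeasurable (quantileSelection M) unitLaw := by
    let : MeasurableSpace S := ⊤
    refine ⟨fun x => if x ∈ Set.Ioc (0 : ℝ) 1 then quantileSelection M x else
      quantileSelection M 2, ?_, ?_⟩
    · refine measurable_to_countable' fun a => ?_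
      have h1 : MeasurableSet (Set.Ioc (0 : ℝ) 1 ∩ quantileSelection M ⁻¹' {a}) := by
        have e : Set.Ioc (0 : ℝ) 1 ∩ quantileSelection M ⁻¹' {a} =
            Set.Ioc (0 : ℝ) 1 ∩ ⋂ m : M, (Set.Ioc (0 : ℝ) 1 ∩ quantile m ⁻¹' {a.1 m}) := by
          ext x
          simp only [Set.mem_inter_iff, Set.mem_preimage, Set.mem_singleton_iff, Set.mem_iInter]
          constructor
          · rintro ⟨hx, rfl⟩
            exact ⟨hx, fun m => ⟨hx, rfl⟩⟩
          · rintro ⟨hx, h⟩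
            exact ⟨hx, Subtype.ext (funext fun m => (h m).2)⟩
        rw [e]
        exact measurableSet_Ioc.inter (MeasurableSet.iInter fun m => hmeas1 m _)
      have e2 : (fun x => if x ∈ Set.Ioc (0 : ℝ) 1 then quantileSelection M x else
          quantileSelection M 2) ⁻¹' {a} = (Set.Ioc (0 : ℝ) 1 ∩ quantileSelection M ⁻¹' {a}) ∪
          ((Set.Ioc (0 : ℝ) 1)ᶜ ∩ {_x | quantileSelection M 2 = a}) := by
        ext x
        by_cases hx : x ∈ Set.Ioc (0 : ℝ) 1 <;> simp only [Set.mem_preimage, hx, if_true, if_false,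
          Set.mem_union, Set.mem_inter_iff, Set.mem_singleton_iff, Set.mem_compl_iff, true_and,
          not_true, not_false_iff, false_and, or_false, false_or]
        rfl
      rw [e2]
      exact h1.union (measurableSet_Ioc.compl.inter (MeasurableSet.const _))
    · rw [unitLaw]
      refine (ae_restrict_iff' measurableSet_Ioc).2 (Eventually.of_forall fun x hx => ?_)
      simp only [hx, if_true]
  have hprob : IsProbabilityMeasure (unitLaw.map (quantileSelection M)) :=
    Measure.isProbabilityMeasure_map hae
  refine ⟨(unitLaw.map (quantileSelection M)).toPMF, fun m => ?_⟩
  ext s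
  rw [← PMF.toOuterMeasure_apply_singleton, PMF.toOuterMeasure_map_apply,
    ← PMF.toMeasure_apply_eq_toOuterMeasure_apply _ MeasurableSpace.measurableSet_top,
    Measure.toPMF_toMeasure,
    Measure.map_apply_of_aemeasurable hae MeasurableSpace.measurableSet_top, ← unitLaw_quantile]
  rfl

end Quantile

section Coupling

variable {V S : Type*} [LinearOrder S] [BoundedOrder S] (ρ : UpDownSpec V S)

/-- The single-site conditional laws of a specification. -/
def siteLaws : Set (PMF S) :=
  {p : PMF S | ∃ v, ∃ τ ∈ upDownConfig V S, p = marginal (ρ.meas {v} τ) v}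

/-- The update rule that reads off the state selected for the conditional law of the spin. -/
def selectionRule (v : V) (a : MonotoneSelection (siteLaws ρ)) (σ : V → S) : S :=
  if h : marginal (ρ.meas {v} σ) v ∈ siteLaws ρ then a.1 ⟨_, h⟩ else σ v

variable {ρ}

lemma selectionRule_eq (v : V) (a : MonotoneSelection (siteLaws ρ)) {σ : V → S}
    (hσ : σ ∈ upDownConfig V S) :
    selectionRule ρ v a σ = a.1 ⟨marginal (ρ.meas {v} σ) v, v, σ, hσ, rfl⟩ :=
  dif_pos _

lemma heatBath_selectionRule (hρ : ρ.Monotonic) {q : PMF (MonotoneSelection (siteLaws ρ))}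
    (hq : ∀ m : siteLaws ρ, q.map (fun a => a.1 m) = m) :
    HeatBath ρ q (selectionRule ρ) where
  mono v a σ hσ σ' hσ' hle := by
    rw [selectionRule_eq v a hσ, selectionRule_eq v a hσ']
    refine a.2 _ _ fun E hE => ?_
    rw [marginal_apply, marginal_apply]
    exact hρ {v} σ hσ σ' hσ' hle _ fun η η' h hη => hE (h v) hη
  law v σ hσ := by
    simp_rw [selectionRule_eq v _ hσ]
    exact hq ⟨_, v, σ, hσ, rfl⟩

lemma translate_mem_upDownConfig {Γ : Type*} [Group Γ] [MulAction Γ V] (γ : Γ) {σ : V → S}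
    (hσ : σ ∈ upDownConfig V S) : translate γ σ ∈ upDownConfig V S := by
  rcases hσ with h | h
  · exact Or.inl (h.preimage (f := fun v : V => γ⁻¹ • v) (MulAction.injective γ⁻¹).injOn)
  · exact Or.inr (h.preimage (f := fun v : V => γ⁻¹ • v) (MulAction.injective γ⁻¹).injOn)

/-- The update rule inherits the invariance of the specification. -/
lemma selectionRule_translate {Γ : Type*} [Group Γ] [MulAction Γ V] (hinv : ρ.Invariant Γ) (γ : Γ)
    (v : V) (a : MonotoneSelection (siteLaws ρ)) {σ : V → S} (hσ : σ ∈ upDownConfig V S) :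
    selectionRule ρ (γ • v) a (translate γ σ) = selectionRule ρ v a σ := by
  rw [selectionRule_eq v a hσ, selectionRule_eq (γ • v) a (translate_mem_upDownConfig γ hσ)]
  refine congrArg a.1 (Subtype.ext ?_)
  change marginal (ρ.meas {γ • v} (translate γ σ)) (γ • v) = marginal (ρ.meas {v} σ) v
  have h := hinv γ {v} σ hσ
  have e : translateFinset γ {v} = {γ • v} := by
    simp [translateFinset]
  rw [e] at h
  rw [← h, marginal, marginal, PMF.map_comp]
  congr 1
  funext ω
  simp [translate]

end Coupling

/-! ### Schedules from injective keys -/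

section Keys

variable {V L : Type*} [LinearOrder L]

/-- Update the sites of every slice in the increasing order of their keys. -/
def Schedule.ofKey (key : ℕ → V → L) (hkey : ∀ i, Function.Injective (key i)) : Schedule V where
  order i Λ := letI := LinearOrder.lift' (key i) (hkey i); Λ.sort (· ≤ ·)
  nodup i Λ := Finset.sort_nodup _ _
  mem_order i Λ v := Finset.mem_sort _
  filter_order i Λ Λ' h := by
    let _ := LinearOrder.lift' (key i) (hkey i)
    refine List.Perm.eq_of_pairwise' (r := (· ≤ ·)) (Finset.pairwise_sort _ _)
      ((Finset.pairwise_sort _ _).filter _) ?_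
    refine (List.perm_ext_iff_of_nodup (Finset.sort_nodup _ _)
      ((Finset.sort_nodup _ _).filter _)).2 fun v => ?_
    simp only [Finset.mem_sort, List.mem_filter, decide_eq_true_eq]
    exact ⟨fun hv => ⟨h hv, hv⟩, fun hv => hv.2⟩

variable {key : ℕ → V → L} {hkey : ∀ i, Function.Injective (key i)}

lemma Schedule.pairwise_ofKey (i : ℕ) (Λ : Finset V) :
    ((Schedule.ofKey key hkey).order i Λ).Pairwise fun u w => key i u ≤ key i w :=
  let _ := LinearOrder.lift' (key i) (hkey i)
  Finset.pairwise_sort Λ (· ≤ ·)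

lemma Schedule.ofKey_order_eq_iff (i : ℕ) (Λ : Finset V) (l : List V) :
    (Schedule.ofKey key hkey).order i Λ = l ↔
      l.Nodup ∧ (∀ v, v ∈ l ↔ v ∈ Λ) ∧ l.Pairwise fun u w => key i u ≤ key i w := by
  constructor
  · rintro rfl
    exact ⟨Schedule.nodup _ _ _, fun v => Schedule.mem_order _ _ _ _, Schedule.pairwise_ofKey i Λ⟩
  · rintro ⟨h1, h2, h3⟩
    refine List.Perm.eq_of_pairwise (fun a b _ _ h h' => hkey i (le_antisymm h h'))
      (Schedule.pairwise_ofKey i Λ) h3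
      ((List.perm_ext_iff_of_nodup (Schedule.nodup _ _ _) h1).2 fun v => ?_)
    rw [Schedule.mem_order, h2]

end Keys

/-! ### A local random order -/

lemma lex_le_of_lt {a c : ℕ → ℕ} {m n r : ℕ} (h : ∀ j < r, a j = c j) (hr : a r ≠ c r) :
    toLex (toLex a, m) ≤ toLex (toLex c, n) ↔ a r < c r := by
  rw [Prod.Lex.toLex_le_toLex]
  constructor
  · rintro (⟨j, hj, hlt⟩ | ⟨he, -⟩)
    · have hlt' : a j < c j := hlt
      rcases lt_trichotomy j r with hjr | rfl | hjr
      · exact absurd (h j hjr) hlt'.ne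
      · exact hlt'
      · exact absurd (hj r hjr) hr
    · exact absurd (congrFun (toLex.injective he) r) hr
  · exact fun hlt => Or.inl ⟨r, h, hlt⟩

/-- The lexicographic order of two sequences that differ before `k` is determined by their first
`k` terms. -/
lemma lex_le_congr {a c a' c' : ℕ → ℕ} {m n m' n' k : ℕ} (ha : ∀ r < k, a r = a' r)
    (hc : ∀ r < k, c r = c' r) (h : ∃ r < k, a r ≠ c r) :
    toLex (toLex a, m) ≤ toLex (toLex c, n) ↔ toLex (toLex a', m') ≤ toLex (toLex c', n') := by
  have hex : ∃ r, a r ≠ c r := ⟨h.choose, h.choose_spec.2⟩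
  set r := Nat.find hex with hr
  have hrk : r < k := (Nat.find_min' hex h.choose_spec.2).trans_lt h.choose_spec.1
  have h1 : ∀ j < r, a j = c j := fun j hj => not_not.1 (Nat.find_min hex hj)
  have h2 : a r ≠ c r := Nat.find_spec hex
  rw [lex_le_of_lt h1 h2, lex_le_of_lt (r := r), ha r hrk, hc r hrk]
  · intro j hj
    rw [← ha j (hj.trans hrk), ← hc j (hj.trans hrk), h1 j hj]
  · rwa [← ha r hrk, ← hc r hrk]

section RandomOrder

variable {V : Type*} {G : SimpleGraph V} (hG : IsLocallyFinite G)

/-- The sphere of radius `r` around `v` as a finite set. -/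
def sphereFinset (v : V) (r : ℕ) : Finset V := (ballFinset hG v r).filter fun u => G.edist v u = r

lemma mem_sphereFinset {u v : V} {r : ℕ} : u ∈ sphereFinset hG v r ↔ G.edist v u = r := by
  simp only [sphereFinset, Finset.mem_filter, mem_ballFinset, and_iff_right_iff_imp]
  exact fun h => h.le

/-- The `r`-th binary digit of the label of `v` in slice `i`: the parity of the bits on the sphere
of radius `r` around `v`. -/
def digit (b : V × ℕ → ZMod 2) (i : ℕ) (v : V) (r : ℕ) : ZMod 2 :=
  ∑ w ∈ sphereFinset hG v r, b (w, i)

variable {hG} in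
lemma digit_congr {b b' : V × ℕ → ZMod 2} {i r : ℕ} {v : V}
    (h : ∀ w ∈ ballFinset hG v r, b (w, i) = b' (w, i)) : digit hG b i v r = digit hG b' i v r :=
  Finset.sum_congr rfl fun w hw => h w (Finset.mem_of_mem_filter w hw)

/-- The bits for which the labels of all vertices are distinct in every slice. -/
def distinctLabels (hG : IsLocallyFinite G) : Set (V × ℕ → ZMod 2) :=
  {b | ∀ i, ∀ u v, u ≠ v → ∃ r, digit hG b i u r ≠ digit hG b i v r}

variable {hG} in
lemma measurable_digit (i : ℕ) (v : V) (r : ℕ) :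
    Measurable fun b : V × ℕ → ZMod 2 => digit hG b i v r :=
  Finset.measurable_sum _ fun w _ => measurable_pi_apply (w, i)

variable {hG} in
lemma measurableSet_digit_rel (R : ZMod 2 → ZMod 2 → Prop) (i : ℕ) (u v : V) (r : ℕ) :
    MeasurableSet {b | R (digit hG b i u r) (digit hG b i v r)} :=
  ((measurable_digit i u r).prodMk (measurable_digit i v r))
    (Set.toFinite {p : ZMod 2 × ZMod 2 | R p.1 p.2}).measurableSet

variable {hG} in
/-- Two vertices are rarely tied for long. -/
lemma noise_tie_le (hsphere : SphereCondition G) {u v : V} (huv : u ≠ v) (i k : ℕ) :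
    noise (V × ℕ) (PMF.uniformOfFintype (ZMod 2))
      {b | ∀ r < k, digit hG b i u r = digit hG b i v r} ≤ (1 / 2) ^ k := by
  set q := PMF.uniformOfFintype (ZMod 2)
  induction k with
  | zero => simp
  | succ k ih =>
    obtain ⟨w, hwv, hwu⟩ := Set.not_subset.1 (hsphere u v huv k)
    have hwv' : w ∈ sphereFinset hG v k := (mem_sphereFinset hG).2 hwv
    have hwu' : ∀ r ≤ k, w ∉ sphereFinset hG u r := fun r hr h => hwu (by
      change G.edist u w ≤ k
      rw [(mem_sphereFinset hG).1 h]
      exact_mod_cast hr)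
    have hwv'' : ∀ r < k, w ∉ sphereFinset hG v r := fun r hr h => by
      have h1 := (mem_sphereFinset hG).1 h
      rw [(mem_sphereFinset hG).1 hwv'] at h1
      have : k = r := by exact_mod_cast h1
      omega
    set E : Set (V × ℕ → ZMod 2) := {b | ∀ r < k, digit hG b i u r = digit hG b i v r}
    set J : Finset (V × ℕ) := ((Finset.range (k + 1)).biUnion fun r =>
      (sphereFinset hG u r ∪ sphereFinset hG v r) ×ˢ {i}).erase (w, i)
    have hJu : ∀ r ≤ k, ∀ x ∈ sphereFinset hG u r, (x, i) ∈ J := fun r hr x hx => by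
      refine Finset.mem_erase.2 ⟨fun e => hwu' r hr ((Prod.mk.inj e).1 ▸ hx),
        Finset.mem_biUnion.2 ⟨r, Finset.mem_range.2 (by omega), by simp [hx]⟩⟩
    have hJv : ∀ r ≤ k, ∀ x ∈ sphereFinset hG v r, x ≠ w → (x, i) ∈ J := fun r hr x hx hne => by
      refine Finset.mem_erase.2 ⟨fun e => hne (Prod.mk.inj e).1,
        Finset.mem_biUnion.2 ⟨r, Finset.mem_range.2 (by omega), by simp [hx]⟩⟩
    have hE : EventOn J E := by
      intro b b' hb h r hr
      have e1 : digit hG b i u r = digit hG b' i u r :=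
        Finset.sum_congr rfl fun x hx => hb _ (hJu r hr.le x hx)
      have e2 : digit hG b i v r = digit hG b' i v r :=
        Finset.sum_congr rfl fun x hx => hb _ (hJv r hr.le x hx fun e => hwv'' r hr (e ▸ hx))
      rw [← e1, ← e2]
      exact h r hr
    set X : (V × ℕ → ZMod 2) → ZMod 2 := fun b =>
      digit hG b i u k - ∑ x ∈ (sphereFinset hG v k).erase w, b (x, i)
    have hX : ∀ a, EventOn J {b | X b = a} := by
      intro a b b' hb h
      change X b = a at h
      change X b' = a
      rw [← h]
      refine congrArg₂ (· - ·) (Finset.sum_congr rfl fun x hx => (hb _ (hJu k le_rfl x hx)).symm)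
        (Finset.sum_congr rfl fun x hx => ?_)
      obtain ⟨hne, hx⟩ := Finset.mem_erase.1 hx
      exact (hb _ (hJv k le_rfl x hx hne)).symm
    rw [noise_eq_sum_coord q (J := J) (i := (w, i)) (Finset.notMem_erase _ _)
      (F := fun a => E ∩ {b | X b = a}) (fun a => hE.inter (hX a))]
    · have hq : ∀ a : ZMod 2, q a = 1 / 2 := fun a => by
        simp [q, PMF.uniformOfFintype_apply, ZMod.card]
      simp_rw [hq]
      rw [← Finset.mul_sum, pow_succ, mul_comm]
      refine mul_le_mul' ?_ le_rfl
      refine le_trans ?_ ih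
      rw [← measure_biUnion_finset]
      · exact measure_mono (Set.iUnion₂_subset fun a _ => Set.inter_subset_left)
      · intro a _ a' _ hne
        exact Set.disjoint_left.2 fun b hb hb' => hne (hb.2.symm.trans hb'.2)
      · exact fun a _ => (hE.inter (hX a)).measurableSet
    · intro b
      have hsum : digit hG b i v k =
          b (w, i) + ∑ x ∈ (sphereFinset hG v k).erase w, b (x, i) :=
        (Finset.add_sum_erase _ (fun x => b (x, i)) hwv').symm
      have hXeq : X b = b (w, i) ↔ digit hG b i u k = digit hG b i v k := by
        rw [hsum]; exact sub_eq_iff_eq_add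
      constructor
      · intro h
        exact ⟨fun r hr => h r (by omega), hXeq.2 (h k (by omega))⟩
      · rintro ⟨h1, h2⟩ r hr
        rcases Nat.lt_succ_iff_lt_or_eq.1 hr with hr | rfl
        · exact h1 r hr
        · exact hXeq.1 h2

variable [Countable V]

/-- An arbitrary injective numbering of the vertices, used to break ties. -/
def tieBreak (V : Type*) [Countable V] : V → ℕ := (exists_injective_nat V).choose

/-- The sites are compared by their labels, in lexicographic order. -/
def orderKey (b : V × ℕ → ZMod 2) (i : ℕ) (v : V) : Lex (ℕ → ℕ) ×ₗ ℕ :=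
  toLex (toLex fun r => (digit hG b i v r).val, tieBreak V v)

lemma orderKey_injective (b : V × ℕ → ZMod 2) (i : ℕ) : Function.Injective (orderKey hG b i) :=
  fun _ _ h => (exists_injective_nat V).choose_spec (Prod.mk.inj (toLex.injective h)).2

/-- The schedule in which the sites are ordered by the labels computed from the bits `b`. -/
def randomSchedule (b : V × ℕ → ZMod 2) : Schedule V :=
  Schedule.ofKey (orderKey hG b) (orderKey_injective hG b)

variable {hG}

lemma orderKey_le_congr {b b' : V × ℕ → ZMod 2} {i i' k : ℕ} {u v u' v' : V}
    (hu : ∀ r < k, digit hG b i u r = digit hG b' i' u' r)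
    (hv : ∀ r < k, digit hG b i v r = digit hG b' i' v' r)
    (h : ∃ r < k, digit hG b i u r ≠ digit hG b i v r) :
    orderKey hG b i u ≤ orderKey hG b i v ↔ orderKey hG b' i' u' ≤ orderKey hG b' i' v' := by
  refine lex_le_congr (fun r hr => by rw [hu r hr]) (fun r hr => by rw [hv r hr]) ?_
  obtain ⟨r, hr, hne⟩ := h
  exact ⟨r, hr, fun e => hne (ZMod.val_injective 2 e)⟩

/-- If the labels of the sites of `Λ` are distinct before level `k`, then the order of `Λ` depends
only on the bits within distance `k`. -/
lemma randomSchedule_order_congr {b b' : V × ℕ → ZMod 2} {i k : ℕ} {Λ : Finset V}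
    (hb : ∀ v ∈ Λ, ∀ w ∈ ballFinset hG v k, b (w, i) = b' (w, i))
    (h : ∀ u ∈ Λ, ∀ v ∈ Λ, u ≠ v → ∃ r < k, digit hG b i u r ≠ digit hG b i v r) :
    (randomSchedule hG b).order i Λ = (randomSchedule hG b').order i Λ := by
  have hd : ∀ v ∈ Λ, ∀ r < k, digit hG b i v r = digit hG b' i v r := fun v hv r hr =>
    digit_congr fun w hw => hb v hv w (ballFinset_mono hG v hr.le hw)
  refine (Schedule.ofKey_order_eq_iff _ _ _).2 ⟨Schedule.nodup _ _ _, fun v =>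
    Schedule.mem_order _ _ _ _, ?_⟩
  refine (Schedule.pairwise_ofKey i Λ).imp_of_mem fun hu hv hle => ?_
  rename_i u v
  have hu' : u ∈ Λ := (Schedule.mem_order _ _ _ _).1 hu
  have hv' : v ∈ Λ := (Schedule.mem_order _ _ _ _).1 hv
  by_cases huv : u = v
  · rw [huv]
  · by_contra hle'
    have h2 := h u hu' v hv' huv
    rw [orderKey_le_congr (b' := b') (i' := i) (hd u hu') (hd v hv') h2] at hle'
    exact hle' hle

lemma measurableSet_distinctLabels : MeasurableSet (distinctLabels hG) := by
  simp only [distinctLabels, Set.ofPred_forall, Set.ofPred_exists]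
  exact MeasurableSet.iInter fun i => MeasurableSet.iInter fun u => MeasurableSet.iInter fun v =>
    MeasurableSet.iInter fun _ => MeasurableSet.iUnion fun r =>
      measurableSet_digit_rel (· ≠ ·) i u v r

lemma noise_distinctLabels_compl (hsphere : SphereCondition G) :
    noise (V × ℕ) (PMF.uniformOfFintype (ZMod 2)) (distinctLabels hG)ᶜ = 0 := by
  have hsub : (distinctLabels hG)ᶜ ⊆ ⋃ i : ℕ, ⋃ u : V, ⋃ v : V, ⋃ _ : u ≠ v,
      {b | ∀ r, digit hG b i u r = digit hG b i v r} := by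
    intro b hb
    simp only [distinctLabels, Set.mem_compl_iff] at hb
    change ¬ ∀ i, ∀ u v, u ≠ v → ∃ r, digit hG b i u r ≠ digit hG b i v r at hb
    push Not at hb
    obtain ⟨i, u, v, huv, h⟩ := hb
    simp only [Set.mem_iUnion]
    exact ⟨i, u, v, huv, h⟩
  refine measure_mono_null hsub ?_
  refine measure_iUnion_null fun i => measure_iUnion_null fun u => measure_iUnion_null fun v =>
    measure_iUnion_null fun huv => ?_
  have hle : ∀ k : ℕ, noise (V × ℕ) (PMF.uniformOfFintype (ZMod 2))
      {b | ∀ r, digit hG b i u r = digit hG b i v r} ≤ (1 / 2 : ℝ≥0∞) ^ k := by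
    intro k
    refine le_trans (measure_mono fun b hb => ?_) (noise_tie_le (hG := hG) hsphere huv i k)
    exact fun r _ => hb r
  refine le_antisymm (ge_of_tendsto' (ENNReal.tendsto_pow_atTop_nhds_zero_of_lt_one ?_) hle) bot_le
  simp

lemma measurableSet_orderKey_le (i : ℕ) (u v : V) :
    MeasurableSet {b | orderKey hG b i u ≤ orderKey hG b i v} := by
  have e : {b | orderKey hG b i u ≤ orderKey hG b i v} =
      (⋃ r, ((⋂ j, ⋂ _ : j < r, {b | digit hG b i u j = digit hG b i v j}) ∩
        {b | (digit hG b i u r).val < (digit hG b i v r).val})) ∪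
      ((⋂ j, {b | digit hG b i u j = digit hG b i v j}) ∩
        {_b | tieBreak V u ≤ tieBreak V v}) := by
    ext b
    change orderKey hG b i u ≤ orderKey hG b i v ↔ _
    rw [orderKey, orderKey, Prod.Lex.toLex_le_toLex]
    simp only [Set.mem_union, Set.mem_iUnion, Set.mem_inter_iff, Set.mem_iInter]
    refine or_congr ?_ (and_congr ?_ Iff.rfl)
    · refine exists_congr fun r => and_congr (forall₂_congr fun j _ => ?_) Iff.rfl
      exact (ZMod.val_injective 2).eq_iff
    · rw [toLex.injective.eq_iff, funext_iff]
      exact forall_congr' fun j => (ZMod.val_injective 2).eq_iff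
  rw [e]
  refine MeasurableSet.union (MeasurableSet.iUnion fun r => ?_) ?_
  · exact (MeasurableSet.iInter fun j => MeasurableSet.iInter fun _ =>
      measurableSet_digit_rel (· = ·) i u v j).inter
      (measurableSet_digit_rel (fun x y => x.val < y.val) i u v r)
  · exact (MeasurableSet.iInter fun j => measurableSet_digit_rel (· = ·) i u v j).inter
      (MeasurableSet.const _)

lemma measurableSet_pairwise_orderKey (i : ℕ) (l : List V) :
    MeasurableSet {b | l.Pairwise fun u v => orderKey hG b i u ≤ orderKey hG b i v} := by
  induction l with
  | nil => simp
  | cons u l ih =>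
    simp only [List.pairwise_cons, Set.ofPred_and]
    refine MeasurableSet.inter ?_ ih
    have e : {b | ∀ v ∈ l, orderKey hG b i u ≤ orderKey hG b i v} =
        ⋂ v ∈ l.toFinset, {b | orderKey hG b i u ≤ orderKey hG b i v} := by
      ext b; simp
    rw [e]
    exact Finset.measurableSet_biInter _ fun v _ => measurableSet_orderKey_le i u v

lemma measurableSet_order_eq (i : ℕ) (Λ : Finset V) (l : List V) :
    MeasurableSet {b | (randomSchedule hG b).order i Λ = l} := by
  simp only [randomSchedule, Schedule.ofKey_order_eq_iff, Set.ofPred_and]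
  exact (MeasurableSet.const _).inter ((MeasurableSet.const _).inter
    (measurableSet_pairwise_orderKey i l))

lemma measurableSet_path_eq (Λ : Finset V) (i n : ℕ) (l : List (V × ℕ)) :
    MeasurableSet {b | (randomSchedule hG b).path Λ i n = l} := by
  induction n generalizing i l with
  | zero => simp only [Schedule.path]; exact MeasurableSet.const _
  | succ n ih =>
    have e : {b | (randomSchedule hG b).path Λ i (n + 1) = l} =
        ⋃ l₁ : List V, ⋃ l₂ : List (V × ℕ), {b | (randomSchedule hG b).order i Λ = l₁} ∩
          ({b | (randomSchedule hG b).path Λ (i + 1) n = l₂} ∩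
            {_b | l₁.map (fun v => (v, i)) ++ l₂ = l}) := by
      ext b
      simp only [Set.mem_iUnion, Set.mem_inter_iff]
      constructor
      · intro h
        exact ⟨_, _, rfl, rfl, h⟩
      · rintro ⟨l₁, l₂, h₁, h₂, h⟩
        change _ = l₁ at h₁
        change _ = l₂ at h₂
        change _ = l at h
        change Schedule.path _ Λ i (n + 1) = l
        rw [Schedule.path, h₁, h₂, h]
    rw [e]
    exact MeasurableSet.iUnion fun l₁ => MeasurableSet.iUnion fun l₂ =>
      (measurableSet_order_eq i Λ l₁).inter ((ih (i + 1) l₂).inter (MeasurableSet.const _))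

end RandomOrder

/-! ### Equivariance -/

section Equivariance

variable {V Γ : Type*} [Group Γ] [MulAction Γ V] {G : SimpleGraph V} {hG : IsLocallyFinite G}

/-- The action of a group on space-time noise, by translations in space. -/
def shift {X : Type*} (γ : Γ) (y : V × ℕ → X) : V × ℕ → X := fun p => y (γ⁻¹ • p.1, p.2)

lemma shift_apply {X : Type*} (γ : Γ) (y : V × ℕ → X) (v : V) (i : ℕ) :
    shift γ y (γ • v, i) = y (v, i) := by simp [shift]

lemma translateFinset_ballFinset (haut : ActsByAutomorphisms Γ G) (γ : Γ) (v : V) (r : ℕ) :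
    translateFinset γ (ballFinset hG v r) = ballFinset hG (γ • v) r := by
  ext u
  simp only [translateFinset, Finset.mem_map_equiv, mem_ballFinset]
  rw [← edist_smul haut γ v]
  simp

lemma digit_shift (haut : ActsByAutomorphisms Γ G) (γ : Γ) (b : V × ℕ → ZMod 2) (i : ℕ) (v : V)
    (r : ℕ) : digit hG (shift γ b) i (γ • v) r = digit hG b i v r := by
  symm
  refine Finset.sum_bij (fun w _ => γ • w) (fun w hw => ?_) (fun w _ w' _ h => ?_)
    (fun w hw => ⟨γ⁻¹ • w, ?_, by simp⟩) (fun w _ => (shift_apply γ b w i).symm)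
  · rw [mem_sphereFinset] at hw ⊢
    rwa [edist_smul haut]
  · exact MulAction.injective γ h
  · rw [mem_sphereFinset] at hw ⊢
    rw [← edist_smul haut γ]
    simpa using hw

lemma shift_mem_distinctLabels (haut : ActsByAutomorphisms Γ G) (γ : Γ) {b : V × ℕ → ZMod 2}
    (hb : b ∈ distinctLabels hG) : shift γ b ∈ distinctLabels hG := by
  intro i u v huv
  obtain ⟨r, hr⟩ := hb i (γ⁻¹ • u) (γ⁻¹ • v) fun h => huv (MulAction.injective γ⁻¹ h)
  refine ⟨r, ?_⟩
  rw [← digit_shift haut γ b i (γ⁻¹ • u), ← digit_shift haut γ b i (γ⁻¹ • v)] at hr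
  simpa using hr

lemma run_shift {A S : Type*} [Top S] [Bot S] {f : V → A → (V → S) → S}
    (hf : ∀ (γ : Γ) v a, ∀ σ ∈ upDownConfig V S, f (γ • v) a (translate γ σ) = f v a σ) (γ : Γ)
    (a : V × ℕ → A) (l : List (V × ℕ)) {σ : V → S} (hσ : ∀ l, run f a l σ ∈ upDownConfig V S) :
    run f (shift γ a) (l.map fun p => (γ • p.1, p.2)) (translate γ σ) =
      translate γ (run f a l σ) := by
  induction l with
  | nil => rfl
  | cons p l ih =>
    rw [List.map_cons, run_cons, ih, run_cons, siteUpdate, siteUpdate, hf γ _ _ _ (hσ l),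
      shift_apply]
    funext v
    by_cases hv : v = γ • p.1
    · subst hv
      simp [translate]
    · have hv' : γ⁻¹ • v ≠ p.1 := fun e => hv (by rw [← e]; simp)
      simp [translate, hv, hv']

variable [Countable V]

lemma randomSchedule_order_shift (haut : ActsByAutomorphisms Γ G) (γ : Γ) {b : V × ℕ → ZMod 2}
    (hb : b ∈ distinctLabels hG) (i : ℕ) (Λ : Finset V) :
    (randomSchedule hG (shift γ b)).order i (translateFinset γ Λ) =
      ((randomSchedule hG b).order i Λ).map (γ • ·) := by
  refine (Schedule.ofKey_order_eq_iff _ _ _).2 ⟨?_, fun v => ?_, ?_⟩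
  · exact (Schedule.nodup _ _ _).map (MulAction.injective γ)
  · simp only [List.mem_map, Schedule.mem_order, translateFinset, Finset.mem_map]
    rfl
  · refine List.pairwise_map.2 ((Schedule.pairwise_ofKey i Λ).imp fun {u v} hle => ?_)
    by_cases huv : u = v
    · rw [huv]
    · obtain ⟨r, hr⟩ := hb i u v huv
      exact (orderKey_le_congr (k := r + 1) (fun j _ => (digit_shift haut γ b i u j).symm)
        (fun j _ => (digit_shift haut γ b i v j).symm) ⟨r, Nat.lt_succ_self r, hr⟩).1 hle

lemma randomSchedule_path_shift (haut : ActsByAutomorphisms Γ G) (γ : Γ) {b : V × ℕ → ZMod 2}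
    (hb : b ∈ distinctLabels hG) (i n : ℕ) (Λ : Finset V) :
    (randomSchedule hG (shift γ b)).path (translateFinset γ Λ) i n =
      ((randomSchedule hG b).path Λ i n).map fun p => (γ • p.1, p.2) := by
  induction n generalizing i with
  | zero => rfl
  | succ n ih =>
    rw [Schedule.path, Schedule.path, ih, randomSchedule_order_shift haut γ hb, List.map_append,
      List.map_map, List.map_map]
    rfl

end Equivariance

/-! ### Splitting the noise -/

section Split

variable {ι A B V T : Type*}

/-- The law of a pair of independent symbols. -/
def pairLaw (q : PMF A) (q' : PMF B) : PMF (A × B) := q.bind fun a => q'.map (Prod.mk a)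

lemma pairLaw_apply (q : PMF A) (q' : PMF B) (x : A × B) :
    pairLaw q q' x = q x.1 * q' x.2 := by
  obtain ⟨a, b⟩ := x
  rw [pairLaw, PMF.bind_apply, tsum_eq_single a, PMF.map_apply, tsum_eq_single b]
  · simp
  · intro b' hb'; simp [hb'.symm]
  · intro a' ha'
    rw [PMF.map_apply]
    simp [ha'.symm]

/-- Read off two space-time noises from a process with values in a finite alphabet encoding
pairs. -/
def splitNoise (e : A × B ≃ T) (y : V → ℕ → T) : (V × ℕ → A) × (V × ℕ → B) :=
  (fun p => (e.symm (y p.1 p.2)).1, fun p => (e.symm (y p.1 p.2)).2)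

variable [MeasurableSpace A] [MeasurableSpace B] [MeasurableSpace T] [MeasurableSingletonClass T]
  [Finite T]

lemma measurable_splitNoise (e : A × B ≃ T) : Measurable (splitNoise (V := V) e) := by
  have h : ∀ p : V × ℕ, Measurable fun y : V → ℕ → T => y p.1 p.2 := fun p =>
    (measurable_pi_apply p.2).comp (measurable_pi_apply p.1)
  refine Measurable.prodMk (measurable_pi_lambda _ fun p => ?_) (measurable_pi_lambda _ fun p => ?_)
  · exact (measurable_of_finite fun x : T => (e.symm x).1).comp (h p)
  · exact (measurable_of_finite fun x : T => (e.symm x).2).comp (h p)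

variable [Fintype A] [MeasurableSingletonClass A] [Fintype B] [MeasurableSingletonClass B]

/-- Two independent noises can be viewed as a single noise of pairs. -/
lemma map_noise_prod (q : PMF A) (q' : PMF B) :
    ((noise ι q).prod (noise ι q')).map (fun z i => (z.1 i, z.2 i)) =
      noise ι (pairLaw q q') := by
  have hmeas : Measurable fun (z : (ι → A) × (ι → B)) (i : ι) => (z.1 i, z.2 i) :=
    measurable_pi_lambda _ fun i => ((measurable_pi_apply i).comp measurable_fst).prodMk
      ((measurable_pi_apply i).comp measurable_snd)
  obtain ⟨a₀, -⟩ := q.support_nonempty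
  obtain ⟨b₀, -⟩ := q'.support_nonempty
  refine Measure.eq_infinitePi _ fun s t ht => ?_
  have hcyl : ∀ c : ι → A × B, MeasurableSet {y : ι → A × B | ∀ i ∈ s, y i = c i} := fun c =>
    EventOn.measurableSet (J := s) fun y y' hy h i hi => (hy i hi).symm.trans (h i hi)
  have hval : ∀ c : ι → A × B, ((noise ι q).prod (noise ι q')).map (fun z i => (z.1 i, z.2 i))
      {y | ∀ i ∈ s, y i = c i} = ∏ i ∈ s, pairLaw q q' (c i) := by
    intro c
    rw [Measure.map_apply hmeas (hcyl c)]
    have e : (fun (z : (ι → A) × (ι → B)) (i : ι) => (z.1 i, z.2 i)) ⁻¹'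
        {y | ∀ i ∈ s, y i = c i} =
        {a | ∀ i ∈ s, a i = (c i).1} ×ˢ {b | ∀ i ∈ s, b i = (c i).2} := by
      ext z
      simp only [Set.mem_preimage, Set.mem_prod]
      change (∀ i ∈ s, (z.1 i, z.2 i) = c i) ↔ (∀ i ∈ s, z.1 i = (c i).1) ∧
        ∀ i ∈ s, z.2 i = (c i).2
      simp only [Prod.ext_iff]
      exact ⟨fun h => ⟨fun i hi => (h i hi).1, fun i hi => (h i hi).2⟩,
        fun h i hi => ⟨h.1 i hi, h.2 i hi⟩⟩
    rw [e, Measure.prod_prod, noise_cylinder q s fun i => (c i).1,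
      noise_cylinder q' s fun i => (c i).2, ← Finset.prod_mul_distrib]
    exact Finset.prod_congr rfl fun i _ => (pairLaw_apply q q' (c i)).symm
  -- decompose the box into cylinders
  set C : Finset (s → A × B) := Fintype.piFinset fun i : s => (t i).toFinset
  set ext : (s → A × B) → ι → A × B := fun c i => if h : i ∈ s then c ⟨i, h⟩ else (a₀, b₀)
  have hext : ∀ (c : s → A × B) (i : s), ext c i = c i := fun c i => dif_pos i.2
  have hbox : Set.pi (s : Set ι) t = ⋃ c ∈ C, {y | ∀ i ∈ s, y i = ext c i} := by
    ext y
    simp only [Set.mem_pi, Finset.mem_coe, Set.mem_iUnion, C, Fintype.mem_piFinset,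
      Set.mem_toFinset]
    constructor
    · exact fun h => ⟨fun i => y i, fun i => h i i.2,
        fun i hi => (hext (fun j => y j) ⟨i, hi⟩).symm⟩
    · rintro ⟨c, hc, hy⟩ i hi
      rw [hy i hi, hext c ⟨i, hi⟩]
      exact hc ⟨i, hi⟩
  rw [hbox, measure_biUnion_finset]
  · simp_rw [hval]
    have h1 : ∀ c : s → A × B, ∏ i ∈ s, pairLaw q q' (ext c i) = ∏ i : s, pairLaw q q' (c i) := by
      intro c
      rw [← Finset.prod_coe_sort]
      exact Finset.prod_congr rfl fun i _ => by rw [hext]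
    simp_rw [h1]
    rw [← Finset.prod_univ_sum, ← Finset.prod_coe_sort s]
    refine Finset.prod_congr rfl fun i _ => ?_
    rw [PMF.toMeasure_apply_fintype, ← Finset.sum_indicator_subset _ (Finset.subset_univ _)]
    refine Finset.sum_congr rfl fun x _ => ?_
    simp [Set.indicator]
  · intro c _ c' _ hne
    refine Set.disjoint_left.2 fun y hy hy' => hne (funext fun i => ?_)
    rw [← hext c i, ← hext c' i, ← hy i i.2, ← hy' i i.2]
  · exact fun c _ => hcyl _

lemma map_splitNoise (q : PMF A) (q' : PMF B) (e : A × B ≃ T) :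
    (iidLaw V ((pairLaw q q').map e)).map (splitNoise e) =
      (noise (V × ℕ) q).prod (noise (V × ℕ) q') := by
  set p := (pairLaw q q').map e
  have h1 : (iidLaw V p).map (MeasurableEquiv.curry V ℕ T).symm =
      Measure.infinitePi fun _ : V × ℕ => p.toMeasure :=
    Measure.infinitePi_map_curry_symm fun _ _ => p.toMeasure
  have hpe : p.toMeasure.map e.symm = (pairLaw q q').toMeasure := by
    rw [PMF.toMeasure_map (⇑e.symm) p (measurable_of_finite _), PMF.map_comp,
      Equiv.symm_comp_self, PMF.map_id]
  have h2 : (Measure.infinitePi fun _ : V × ℕ => p.toMeasure).map (fun y x => e.symm (y x)) =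
      noise (V × ℕ) (pairLaw q q') := by
    rw [Measure.infinitePi_map_pi (f := fun _ => e.symm) _ fun _ => measurable_of_finite _]
    simp_rw [hpe]
    rfl
  have hd : Measurable fun (y : V × ℕ → T) (x : V × ℕ) => e.symm (y x) :=
    measurable_pi_lambda _ fun x => (measurable_of_finite _).comp (measurable_pi_apply x)
  have hunzip : Measurable fun y : V × ℕ → A × B =>
      ((fun x => (y x).1 : V × ℕ → A), (fun x => (y x).2 : V × ℕ → B)) :=
    (measurable_pi_lambda _ fun x => measurable_fst.comp (measurable_pi_apply x)).prodMk
      (measurable_pi_lambda _ fun x => measurable_snd.comp (measurable_pi_apply x))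
  have hzip : Measurable fun (z : (V × ℕ → A) × (V × ℕ → B)) (x : V × ℕ) => (z.1 x, z.2 x) :=
    measurable_pi_lambda _ fun x => ((measurable_pi_apply x).comp measurable_fst).prodMk
      ((measurable_pi_apply x).comp measurable_snd)
  have hcomp : splitNoise (V := V) e = (fun y : V × ℕ → A × B =>
      ((fun x => (y x).1 : V × ℕ → A), (fun x => (y x).2 : V × ℕ → B))) ∘
      (fun (y : V × ℕ → T) (x : V × ℕ) => e.symm (y x)) ∘ (MeasurableEquiv.curry V ℕ T).symm := rfl
  rw [hcomp, ← Measure.map_map hunzip (hd.comp (MeasurableEquiv.measurable _)),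
    ← Measure.map_map hd (MeasurableEquiv.measurable _), h1, h2, ← map_noise_prod,
    Measure.map_map hunzip hzip]
  exact Measure.map_id

end Split

/-! ### Coupling from the past -/

section LeastValue

variable {S : Type*} [LinearOrder S] [OrderTop S] [Fintype S]

/-- The least value of a sequence in a finite linear order; for an antitone sequence this is its
eventual value. -/
def leastValue (x : ℕ → S) : S := (Finset.univ.filter fun s => ∃ n, x n ≤ s).inf id

lemma leastValue_le (x : ℕ → S) (n : ℕ) : leastValue x ≤ x n :=
  Finset.inf_le (f := id) (by simpa using ⟨n, le_rfl⟩)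

lemma exists_le_leastValue (x : ℕ → S) : ∃ n, x n ≤ leastValue x := by
  obtain ⟨s, hs, h⟩ := Finset.exists_mem_eq_inf (Finset.univ.filter fun s => ∃ n, x n ≤ s)
    ⟨⊤, by simp⟩ id
  rw [leastValue, h]
  exact (Finset.mem_filter.1 hs).2

lemma exists_forall_ge_eq_leastValue {x : ℕ → S} (hx : Antitone x) :
    ∃ N, ∀ n ≥ N, x n = leastValue x := by
  obtain ⟨N, hN⟩ := exists_le_leastValue x
  exact ⟨N, fun n hn => le_antisymm ((hx hn).trans hN) (leastValue_le x n)⟩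

end LeastValue

lemma exists_subset_ballFinset {V : Type*} {G : SimpleGraph V} {hG : IsLocallyFinite G}
    (hconn : G.Connected) (v : V) (Λ : Finset V) :
    ∃ m, Λ ⊆ ballFinset hG v m := by
  refine ⟨Λ.sup fun w => G.dist v w, fun w hw => (mem_ballFinset hG).2 ?_⟩
  rw [← (hconn.preconnected v w).coe_dist_eq_edist]
  exact_mod_cast Finset.le_sup (f := fun w => G.dist v w) hw

section Limits

variable {V A S : Type*} [Countable V] {G : SimpleGraph V} (hG : IsLocallyFinite G)
  [LinearOrder S] [BoundedOrder S] (f : V → A → (V → S) → S)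

/-- The state after slice `0` of the chain in `Λ` started from the maximal state `n` slices
earlier; the sites are updated in the order given by the second component of the noise. -/
def topChain (z : (V × ℕ → A) × (V × ℕ → ZMod 2)) (Λ : Finset V) (n : ℕ) : V → S :=
  run f z.1 ((randomSchedule hG z.2).path Λ 0 n) ⊤

variable {hG f} in
lemma topChain_anti (hf : MonotoneRule f) (z : (V × ℕ → A) × (V × ℕ → ZMod 2)) {Λ Λ' : Finset V}
    (h : Λ ⊆ Λ') {n n' : ℕ} (hn : n ≤ n') : topChain hG f z Λ' n' ≤ topChain hG f z Λ n :=
  run_path_top_anti _ hf h 0 hn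

variable {hG f} in
lemma topChain_apply_of_notMem (z : (V × ℕ → A) × (V × ℕ → ZMod 2)) {Λ : Finset V} {v : V}
    (hv : v ∉ Λ) (n : ℕ) : topChain hG f z Λ n v = ⊤ :=
  run_apply_of_notMem (fun p hp (e : p.1 = v) => hv (e ▸ (Schedule.mem_path _).1 hp |>.1)) _

variable [Fintype S]

/-- The state at time zero of the chain in `Λ` started from the maximal state in the infinite
past. -/
def volumeLimit (Λ : Finset V) (z : (V × ℕ → A) × (V × ℕ → ZMod 2)) (v : V) : S :=
  leastValue fun n => topChain hG f z Λ n v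

/-- The limit of the chains started from the maximal state, as the volume exhausts the graph and
the starting time recedes. -/
def topLimit (z : (V × ℕ → A) × (V × ℕ → ZMod 2)) (v : V) : S :=
  leastValue fun n => topChain hG f z (ballFinset hG v n) n v

variable {hG f}

lemma topLimit_le (z : (V × ℕ → A) × (V × ℕ → ZMod 2)) (v : V) (n : ℕ) :
    topLimit hG f z v ≤ topChain hG f z (ballFinset hG v n) n v :=
  leastValue_le _ n

lemma exists_topChain_eq_topLimit (hf : MonotoneRule f) (z : (V × ℕ → A) × (V × ℕ → ZMod 2))
    (v : V) : ∃ N, ∀ n ≥ N, topChain hG f z (ballFinset hG v n) n v = topLimit hG f z v :=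
  exists_forall_ge_eq_leastValue fun _ _ h =>
    topChain_anti hf z (ballFinset_mono hG v h) h v

lemma exists_topChain_eq_volumeLimit (hf : MonotoneRule f) (Λ : Finset V)
    (z : (V × ℕ → A) × (V × ℕ → ZMod 2)) :
    ∃ N, ∀ n ≥ N, topChain hG f z Λ n = volumeLimit hG f Λ z := by
  have h : ∀ v, ∃ N, ∀ n ≥ N, topChain hG f z Λ n v = volumeLimit hG f Λ z v := fun v =>
    exists_forall_ge_eq_leastValue fun _ _ h => topChain_anti hf z subset_rfl h v
  choose N hN using h
  refine ⟨Λ.sup N, fun n hn => funext fun v => ?_⟩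
  by_cases hv : v ∈ Λ
  · exact hN v n ((Finset.le_sup hv).trans hn)
  · rw [← hN v (N v) le_rfl, topChain_apply_of_notMem z hv, topChain_apply_of_notMem z hv]

lemma eventually_volumeLimit_eq (hconn : G.Connected) (hf : MonotoneRule f)
    (z : (V × ℕ → A) × (V × ℕ → ZMod 2)) (v : V) :
    ∀ᶠ Λ : Finset V in atTop, volumeLimit hG f Λ z v = topLimit hG f z v := by
  obtain ⟨N, hN⟩ := exists_topChain_eq_topLimit (hG := hG) hf z v
  filter_upwards [eventually_ge_atTop (ballFinset hG v N)] with Λ hΛ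
  obtain ⟨M, hM⟩ := exists_topChain_eq_volumeLimit (hG := hG) hf Λ z
  obtain ⟨m, hm⟩ := exists_subset_ballFinset (hG := hG) hconn v Λ
  refine le_antisymm ?_ ?_
  · rw [← hN N le_rfl]
    exact (leastValue_le _ N).trans (topChain_anti hf z hΛ le_rfl v)
  · rw [← hM M le_rfl]
    exact (topLimit_le z v (max m M)).trans (topChain_anti hf z
      (hm.trans (ballFinset_mono hG v (le_max_left m M))) (le_max_right m M) v)

lemma setOf_volumeLimit_eq (hf : MonotoneRule f) (Λ : Finset V) {N : ℕ} (hN : 0 < N)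
    (E : Set (V → S)) : {z : (V × ℕ → A) × (V × ℕ → ZMod 2) | volumeLimit hG f Λ z ∈ E} =
      ⋃ K : ℕ, ⋂ k ≥ K, {z | topChain hG f z Λ (k * N) ∈ E} := by
  ext z
  obtain ⟨M, hM⟩ := exists_topChain_eq_volumeLimit (hG := hG) hf Λ z
  simp only [Set.mem_iUnion, Set.mem_iInter]
  constructor
  · intro h
    refine ⟨M, fun k hk => ?_⟩
    change topChain hG f z Λ (k * N) ∈ E
    rwa [hM _ (hk.trans (Nat.le_mul_of_pos_right k hN))]
  · rintro ⟨K, h⟩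
    have h' : topChain hG f z Λ (max K M * N) ∈ E := h _ (le_max_left K M)
    rwa [hM _ ((le_max_right K M).trans (Nat.le_mul_of_pos_right _ hN))] at h'

end Limits

section LimitLaw

variable {V A S : Type*} [Countable V] {G : SimpleGraph V} {hG : IsLocallyFinite G}
  [LinearOrder S] [BoundedOrder S] {f : V → A → (V → S) → S}
  [Fintype A] [MeasurableSpace A] [MeasurableSingletonClass A]

lemma measurableSet_topChain (Λ : Finset V) (n : ℕ) (E : Set (V → S)) :
    MeasurableSet {z : (V × ℕ → A) × (V × ℕ → ZMod 2) | topChain hG f z Λ n ∈ E} := by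
  have e : {z : (V × ℕ → A) × (V × ℕ → ZMod 2) | topChain hG f z Λ n ∈ E} =
      ⋃ l : List (V × ℕ), {a | run f a l ⊤ ∈ E} ×ˢ {b | (randomSchedule hG b).path Λ 0 n = l} := by
    ext z
    simp only [Set.mem_iUnion, Set.mem_prod]
    constructor
    · exact fun h => ⟨_, h, rfl⟩
    · rintro ⟨l, h, h'⟩
      change (randomSchedule hG z.2).path Λ 0 n = l at h'
      change run f z.1 ((randomSchedule hG z.2).path Λ 0 n) ⊤ ∈ E
      rwa [h']
  rw [e]
  exact MeasurableSet.iUnion fun l => (eventOn_run_const l (J := l.toFinset) (by simp) _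
    _).measurableSet.prod (measurableSet_path_eq Λ 0 n l)

variable [Fintype S]

lemma measurableSet_volumeLimit (hf : MonotoneRule f) (Λ : Finset V) (E : Set (V → S)) :
    MeasurableSet {z : (V × ℕ → A) × (V × ℕ → ZMod 2) | volumeLimit hG f Λ z ∈ E} := by
  rw [setOf_volumeLimit_eq hf Λ one_pos E]
  exact MeasurableSet.iUnion fun K => MeasurableSet.iInter fun k => MeasurableSet.iInter fun _ =>
    measurableSet_topChain Λ _ E

lemma measurableSet_topLimit (hf : MonotoneRule f) (v : V) (s : S) :
    MeasurableSet {z : (V × ℕ → A) × (V × ℕ → ZMod 2) | topLimit hG f z v = s} := by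
  have e : {z : (V × ℕ → A) × (V × ℕ → ZMod 2) | topLimit hG f z v = s} =
      ⋃ K : ℕ, ⋂ k ≥ K, {z | topChain hG f z (ballFinset hG v k) k ∈ {σ | σ v = s}} := by
    ext z
    obtain ⟨M, hM⟩ := exists_topChain_eq_topLimit (hG := hG) hf z v
    simp only [Set.mem_iUnion, Set.mem_iInter]
    constructor
    · intro h
      exact ⟨M, fun k hk => (hM k hk).trans h⟩
    · rintro ⟨K, h⟩
      exact (hM _ (le_max_right K M)).symm.trans (h _ (le_max_left K M))
  rw [e]
  exact MeasurableSet.iUnion fun K => MeasurableSet.iInter fun k => MeasurableSet.iInter fun _ =>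
    measurableSet_topChain _ _ _

variable {ρ : UpDownSpec V S} {q : PMF A} {ν : Measure (V × ℕ → ZMod 2)} [IsProbabilityMeasure ν]

lemma prod_topChain_le (H : HeatBath ρ q f) {Λ : Finset V}
    (htop : (⊤ : V → S) ∈ (ρ.meas Λ ⊤).support)
    (hconn : ((hammingGraph V S).induce (ρ.meas Λ ⊤).support).Connected) (k : ℕ)
    (E : Set (V → S)) :
    ((noise (V × ℕ) q).prod ν)
        {z | topChain hG f z Λ (k * Fintype.card S ^ Λ.card) ∈ E} ≤
      (ρ.meas Λ ⊤).toOuterMeasure E +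
        (1 - minProb q ^ (Fintype.card S ^ Λ.card * Λ.card)) ^ k := by
  rw [Measure.prod_apply_symm (measurableSet_topChain Λ _ E)]
  refine (lintegral_mono fun b => H.noise_top_le (randomSchedule hG b) htop hconn le_rfl k 0
    E).trans ?_
  simp

/-- The chain in `Λ` started from the maximal state in the infinite past has law `ρ_Λ^⊤`. -/
lemma prod_volumeLimit (H : HeatBath ρ q f) {Λ : Finset V}
    (htop : (⊤ : V → S) ∈ (ρ.meas Λ ⊤).support)
    (hconn : ((hammingGraph V S).induce (ρ.meas Λ ⊤).support).Connected) (E : Set (V → S)) :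
    ((noise (V × ℕ) q).prod ν) {z | volumeLimit hG f Λ z ∈ E} =
      (ρ.meas Λ ⊤).toOuterMeasure E := by
  set P := (noise (V × ℕ) q).prod ν
  have hle : ∀ E : Set (V → S), P {z | volumeLimit hG f Λ z ∈ E} ≤
      (ρ.meas Λ ⊤).toOuterMeasure E := by
    intro E
    rw [setOf_volumeLimit_eq H.mono Λ (N := Fintype.card S ^ Λ.card)
      (pow_pos (Fintype.card_pos_iff.2 ⟨⊤⟩) _) E]
    have hmon : Monotone fun K : ℕ => ⋂ k ≥ K, {z : (V × ℕ → A) × (V × ℕ → ZMod 2) |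
        topChain hG f z Λ (k * Fintype.card S ^ Λ.card) ∈ E} :=
      fun K K' h => Set.iInter₂_mono' fun k hk => ⟨k, h.trans hk, le_rfl⟩
    rw [hmon.measure_iUnion]
    refine iSup_le fun K => ?_
    have hlim : Tendsto (fun k => (ρ.meas Λ ⊤).toOuterMeasure E +
        (1 - minProb q ^ (Fintype.card S ^ Λ.card * Λ.card)) ^ k) atTop
        (𝓝 ((ρ.meas Λ ⊤).toOuterMeasure E + 0)) := by
      refine tendsto_const_nhds.add (ENNReal.tendsto_pow_atTop_nhds_zero_of_lt_one ?_)
      exact ENNReal.sub_lt_self ENNReal.one_ne_top one_ne_zero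
        (ENNReal.pow_pos (minProb_pos (q := q)) _).ne'
    rw [add_zero] at hlim
    refine ge_of_tendsto hlim ?_
    filter_upwards [eventually_ge_atTop K] with k hk
    exact (measure_mono (Set.iInter₂_subset k hk)).trans (prod_topChain_le H htop hconn k E)
  refine le_antisymm (hle E) ?_
  have h1 : P {z | volumeLimit hG f Λ z ∈ E} + P {z | volumeLimit hG f Λ z ∈ Eᶜ} = 1 := by
    have := measure_add_measure_compl (μ := P) (measurableSet_volumeLimit (hG := hG) H.mono Λ E)
    rwa [measure_univ] at this
  have h2 : (ρ.meas Λ ⊤).toOuterMeasure E + (ρ.meas Λ ⊤).toOuterMeasure Eᶜ = 1 := by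
    let _ : MeasurableSpace (V → S) := ⊤
    rw [← PMF.toMeasure_apply_eq_toOuterMeasure_apply _ MeasurableSpace.measurableSet_top,
      ← PMF.toMeasure_apply_eq_toOuterMeasure_apply _ MeasurableSpace.measurableSet_top,
      measure_add_measure_compl MeasurableSpace.measurableSet_top, measure_univ]
  have h3 : (ρ.meas Λ ⊤).toOuterMeasure Eᶜ ≠ ⊤ :=
    ((toOuterMeasure_le_one _ _).trans_lt ENNReal.one_lt_top).ne
  refine (ENNReal.add_le_add_iff_right h3).1 ?_
  rw [h2, ← h1]
  exact add_le_add le_rfl (hle Eᶜ)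

end LimitLaw

/-! ### Weak limits -/

section WeakLimit

lemma measurable_config {V S Ω : Type*} [Finite S] [MeasurableSpace S] [MeasurableSpace Ω]
    {Φ : Ω → V → S} (h : ∀ v s, MeasurableSet {z | Φ z v = s}) : Measurable Φ :=
  measurable_pi_lambda _ fun v => measurable_to_countable' fun s => h v s

variable {V S Ω : Type*} [Countable V] [Fintype S] [TopologicalSpace S]
  [DiscreteTopology S] [MeasurableSpace S] [DiscreteMeasurableSpace S] [MeasurableSpace Ω]

/-- Weak convergence from a coupling in which the spin at every site is eventually constant. -/
lemma tendsto_toProb_of_coupling [Top S] [Bot S] (ρ : UpDownSpec V S) (τ : V → S) (P : Measure Ω)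
    [IsProbabilityMeasure P] {X : Finset V → Ω → V → S}
    (hX : ∀ Λ, ∀ E : Set (V → S), MeasurableSet {z | X Λ z ∈ E})
    (hlaw : ∀ Λ, ∀ E : Set (V → S), P {z | X Λ z ∈ E} = (ρ.meas Λ τ).toOuterMeasure E)
    {Φ : Ω → V → S} (hΦ : Measurable Φ)
    (hlim : ∀ z v, ∀ᶠ Λ : Finset V in atTop, X Λ z v = Φ z v)
    {μ : ProbabilityMeasure (V → S)} (hμ : (μ : Measure (V → S)) = P.map Φ) :
    Tendsto (fun Λ : Finset V => ρ.toProb Λ τ) atTop (𝓝 μ) := by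
  have hXm : ∀ Λ, Measurable (X Λ) := fun Λ E _ => hX Λ E
  have hmap : ∀ Λ, (ρ.toProb Λ τ : Measure (V → S)) = P.map (X Λ) := by
    intro Λ
    ext E hE
    rw [Measure.map_apply (hXm Λ) hE]
    exact (PMF.toMeasure_apply_eq_toOuterMeasure_apply _ hE).trans (hlaw Λ E).symm
  rw [ProbabilityMeasure.tendsto_iff_forall_integral_tendsto]
  intro g
  have hg : Measurable g := g.continuous.measurable
  have e1 : ∀ Λ, ∫ ω, g ω ∂(ρ.toProb Λ τ : Measure (V → S)) = ∫ z, g (X Λ z) ∂P := fun Λ => by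
    rw [hmap, integral_map (hXm Λ).aemeasurable hg.aestronglyMeasurable]
  rw [hμ, integral_map hΦ.aemeasurable hg.aestronglyMeasurable]
  simp_rw [e1]
  refine tendsto_integral_filter_of_dominated_convergence (fun _ => ‖g‖)
    (Eventually.of_forall fun Λ => (hg.comp (hXm Λ)).aestronglyMeasurable)
    (Eventually.of_forall fun Λ => ae_of_all _ fun z => g.norm_coe_le_norm _)
    (integrable_const _) (ae_of_all _ fun z => ?_)
  refine (g.continuous.tendsto (Φ z)).comp (tendsto_pi_nhds.2 fun v => ?_)
  exact tendsto_const_nhds.congr' ((hlim z v).mono fun Λ h => h.symm)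

end WeakLimit

section BotLimit

variable {V A S : Type*} [Countable V] {G : SimpleGraph V} {hG : IsLocallyFinite G}
  [LinearOrder S] [BoundedOrder S] [Fintype S] {f : V → A → (V → S) → S}

variable (hG f) in
/-- The limit of the chains started from the minimal state. -/
def botLimit (z : (V × ℕ → A) × (V × ℕ → ZMod 2)) : V → S := topLimit (S := Sᵒᵈ) hG f z

lemma exists_botChain_eq_botLimit (hf : MonotoneRule f) (z : (V × ℕ → A) × (V × ℕ → ZMod 2))
    (v : V) : ∃ N, ∀ n ≥ N,
      run f z.1 ((randomSchedule hG z.2).path (ballFinset hG v n) 0 n) ⊥ v = botLimit hG f z v :=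
  exists_topChain_eq_topLimit (S := Sᵒᵈ) hf.dual z v

lemma botLimit_le_topLimit (hf : MonotoneRule f) (z : (V × ℕ → A) × (V × ℕ → ZMod 2)) (v : V) :
    botLimit hG f z v ≤ topLimit hG f z v := by
  obtain ⟨N, hN⟩ := exists_topChain_eq_topLimit (hG := hG) hf z v
  obtain ⟨M, hM⟩ := exists_botChain_eq_botLimit (hG := hG) hf z v
  rw [← hN _ (le_max_left N M), ← hM _ (le_max_right N M)]
  exact run_mono hf bot_mem_upDownConfig top_mem_upDownConfig bot_le _ v

variable [Fintype A] [MeasurableSpace A] [MeasurableSingletonClass A]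

lemma measurableSet_botLimit (hf : MonotoneRule f) (v : V) (s : S) :
    MeasurableSet {z : (V × ℕ → A) × (V × ℕ → ZMod 2) | botLimit hG f z v = s} :=
  measurableSet_topLimit (S := Sᵒᵈ) hf.dual v s

end BotLimit

section Limits

variable {V A S : Type*} [Countable V] {G : SimpleGraph V} {hG : IsLocallyFinite G}
  [LinearOrder S] [BoundedOrder S] [Fintype S] {f : V → A → (V → S) → S}
  [Fintype A] [MeasurableSpace A] [MeasurableSingletonClass A]
  [TopologicalSpace S] [DiscreteTopology S] [MeasurableSpace S] [DiscreteMeasurableSpace S]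
  {ρ : UpDownSpec V S} {q : PMF A} {ν : Measure (V × ℕ → ZMod 2)} [IsProbabilityMeasure ν]

lemma tendsto_toProb_top (hconn : G.Connected) (H : HeatBath ρ q f) (hirr : ρ.Irreducible)
    {μ : ProbabilityMeasure (V → S)}
    (hμ : (μ : Measure (V → S)) = ((noise (V × ℕ) q).prod ν).map (topLimit hG f)) :
    Tendsto (fun Λ : Finset V => ρ.toProb Λ ⊤) atTop (𝓝 μ) :=
  tendsto_toProb_of_coupling ρ ⊤ ((noise (V × ℕ) q).prod ν)
    (fun Λ E => measurableSet_volumeLimit H.mono Λ E)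
    (fun Λ E => prod_volumeLimit H (hirr Λ).1.1 (hirr Λ).1.2 E)
    (measurable_config fun v s => measurableSet_topLimit H.mono v s)
    (eventually_volumeLimit_eq hconn H.mono) hμ

lemma tendsto_toProb_bot (hconn : G.Connected) (H : HeatBath ρ q f) (hirr : ρ.Irreducible)
    {μ : ProbabilityMeasure (V → S)}
    (hμ : (μ : Measure (V → S)) = ((noise (V × ℕ) q).prod ν).map (botLimit hG f)) :
    Tendsto (fun Λ : Finset V => ρ.toProb Λ ⊥) atTop (𝓝 μ) :=
  tendsto_toProb_of_coupling ρ ⊥ ((noise (V × ℕ) q).prod ν)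
    (X := fun Λ => volumeLimit (S := Sᵒᵈ) hG f Λ)
    (fun Λ E => measurableSet_volumeLimit (S := Sᵒᵈ) H.mono.dual Λ E)
    (fun Λ E => prod_volumeLimit (S := Sᵒᵈ) H.dual (hirr Λ).2.1 (hirr Λ).2.2 E)
    (measurable_config fun v s => measurableSet_botLimit H.mono v s)
    (eventually_volumeLimit_eq (S := Sᵒᵈ) hconn H.mono.dual) hμ

end Limits

/-- Ordered random variables with the same law on a finite linear order coincide almost surely. -/
lemma ae_eq_of_le_of_map_eq {Ω S : Type*} [MeasurableSpace Ω] [LinearOrder S] [Finite S]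
    (P : Measure Ω) [IsFiniteMeasure P] {X Y : Ω → S}
    (hX : ∀ s, MeasurableSet {z | X z = s}) (hY : ∀ s, MeasurableSet {z | Y z = s})
    (hle : ∀ z, X z ≤ Y z) (h : ∀ s, P {z | X z = s} = P {z | Y z = s}) :
    ∀ᵐ z ∂P, X z = Y z := by
  have := Fintype.ofFinite S
  have hU : ∀ (Z : Ω → S), (∀ s, MeasurableSet {z | Z z = s}) → ∀ s,
      {z | s < Z z} = ⋃ t ∈ Finset.univ.filter (s < ·), {z | Z z = t} := by
    intro Z _ s
    ext z
    simp
  have hm : ∀ (Z : Ω → S), (∀ s, MeasurableSet {z | Z z = s}) → ∀ s,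
      MeasurableSet {z | s < Z z} := by
    intro Z hZ s
    rw [hU Z hZ s]
    exact Finset.measurableSet_biUnion _ fun t _ => hZ t
  have hlt : ∀ (Z : Ω → S), (∀ s, MeasurableSet {z | Z z = s}) → ∀ s,
      P {z | s < Z z} = ∑ t with s < t, P {z | Z z = t} := by
    intro Z hZ s
    rw [hU Z hZ s, measure_biUnion_finset (fun a _ b _ hab => Set.disjoint_left.2
      fun z hz hz' => hab (hz.symm.trans hz')) fun t _ => hZ t]
  have hs : ∀ s, P ({z | s < Y z} \ {z | s < X z}) = 0 := by
    intro s
    have hsub : {z | s < X z} ⊆ {z | s < Y z} := fun z (hz : s < X z) => hz.trans_le (hle z)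
    rw [measure_sdiff hsub (hm X hX s).nullMeasurableSet
      (measure_ne_top _ _), hlt X hX, hlt Y hY]
    simp_rw [h]
    exact tsub_self _
  refine measure_mono_null (t := ⋃ s, ({z | s < Y z} \ {z | s < X z})) (fun z hz => ?_)
    (measure_iUnion_null hs)
  exact Set.mem_iUnion.2 ⟨X z, lt_of_le_of_ne (hle z) hz, lt_irrefl _⟩

/-! ### The coding and its space-time radius -/

lemma Schedule.path_congr {V : Type*} {o o' : Schedule V} {Λ : Finset V} {i n : ℕ}
    (h : ∀ j, i ≤ j → j < i + n → o.order j Λ = o'.order j Λ) : o.path Λ i n = o'.path Λ i n := by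
  induction n generalizing i with
  | zero => rfl
  | succ n ih =>
    rw [Schedule.path, Schedule.path, h i le_rfl (by omega),
      ih fun j hj hj' => h j (by omega) (by omega)]

lemma spaceTimeRadius_le {V T S : Type*} {G : SimpleGraph V} {φ : (V → ℕ → T) → V → S}
    {v : V} {y : V → ℕ → T} {r : ℕ}
    (h : DeterminedAt G φ v y r) : spaceTimeRadius G φ v y ≤ r := iInf₂_le r h

/-- The bits for which the labels of the vertices of the ball of radius `n` around `v` are
distinguished by their first `k` digits in each of the slices `0, …, n - 1`. -/
def labelsSeparated {V : Type*} {G : SimpleGraph V} (hG : IsLocallyFinite G) (v : V)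
    (n k : ℕ) : Set (V × ℕ → ZMod 2) :=
  {b | ∀ i ∈ Finset.range n, ∀ u ∈ ballFinset hG v n, ∀ w ∈ ballFinset hG v n, u ≠ w →
    ∃ r < k, digit hG b i u r ≠ digit hG b i w r}

section Determination

variable {V A S T : Type*} [Countable V] {G : SimpleGraph V} {hG : IsLocallyFinite G}
  [LinearOrder S] [BoundedOrder S] [Fintype S] {f : V → A → (V → S) → S}

lemma topLimit_eq_of_notMem_ballDisagree (hf : MonotoneRule f)
    {z : (V × ℕ → A) × (V × ℕ → ZMod 2)} {v : V} {n : ℕ}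
    (h : z.1 ∉ ballDisagree hG f (randomSchedule hG z.2) 0 n v) :
    topLimit hG f z v = topChain hG f z (ballFinset hG v n) n v := by
  refine le_antisymm (topLimit_le z v n) ?_
  obtain ⟨N, hN⟩ := exists_topChain_eq_topLimit (hG := hG) hf z v
  rw [← hN (max N n) (le_max_left N n)]
  have hn : n ≤ max N n := le_max_right N n
  refine (not_not.1 h : topChain hG f z (ballFinset hG v n) n v = _).le.trans
    ((run_path_bot_mono (randomSchedule hG z.2) hf (ballFinset_mono hG v hn) 0 hn v).trans ?_)
  exact run_mono hf bot_mem_upDownConfig top_mem_upDownConfig bot_le _ v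

variable (hG f) in
/-- The coding: the noise is split into the symbols that drive the updates and the bits that
determine their order, and the limit of the chains started from the maximal state is returned. -/
def codingMap (e : A × ZMod 2 ≃ T) (y : V → ℕ → T) : V → S := topLimit hG f (splitNoise e y)

/-- The spin at `v` is determined once the extremal chains in a ball agree at `v` and the order of
the updates in that ball is known. -/
lemma determinedAt_codingMap (hf : MonotoneRule f) (e : A × ZMod 2 ≃ T) {y : V → ℕ → T} {v : V}
    {n k : ℕ}
    (h : (splitNoise e y).1 ∉ ballDisagree hG f (randomSchedule hG (splitNoise e y).2) 0 n v)
    (hk : (splitNoise e y).2 ∈ labelsSeparated hG v n k) :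
    DeterminedAt G (codingMap hG f e) v y (n + k) := by
  intro y' hy'
  have hz : ∀ w ∈ ballFinset hG v (n + k), ∀ i ≤ n + k,
      (splitNoise e y').1 (w, i) = (splitNoise e y).1 (w, i) ∧
      (splitNoise e y').2 (w, i) = (splitNoise e y).2 (w, i) := by
    intro w hw i hi
    have := hy' w ((mem_ballFinset hG).1 hw) i hi
    simp [splitNoise, this]
  have hpath : (randomSchedule hG (splitNoise e y).2).path (ballFinset hG v n) 0 n =
      (randomSchedule hG (splitNoise e y').2).path (ballFinset hG v n) 0 n := by
    refine Schedule.path_congr fun j _ hj => ?_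
    refine randomSchedule_order_congr (k := k) (fun u hu w hw => ?_)
      (hk j (Finset.mem_range.2 (by omega)))
    exact (hz w (ballFinset_subset hG hu le_rfl hw) j (by omega)).2.symm
  have hrun : ∀ ξ : V → S, run f (splitNoise e y').1
      ((randomSchedule hG (splitNoise e y').2).path (ballFinset hG v n) 0 n) ξ =
      run f (splitNoise e y).1
      ((randomSchedule hG (splitNoise e y).2).path (ballFinset hG v n) 0 n) ξ := by
    intro ξ
    rw [← hpath]
    refine run_congr (fun p hp => ?_) ξ
    obtain ⟨hp1, -, hp2⟩ := (Schedule.mem_path _).1 hp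
    exact (hz p.1 (ballFinset_mono hG v (by omega) hp1) p.2 (by omega)).1
  have h' : (splitNoise e y').1 ∉
      ballDisagree hG f (randomSchedule hG (splitNoise e y').2) 0 n v := by
    change ¬ (run f _ _ (⊤ : V → S) v ≠ run f _ _ (⊥ : V → S) v)
    rw [hrun, hrun]
    exact h
  rw [codingMap, codingMap, topLimit_eq_of_notMem_ballDisagree hf h,
    topLimit_eq_of_notMem_ballDisagree hf h', topChain, topChain, hrun]

lemma spaceTimeRadius_codingMap_ne_top (hf : MonotoneRule f) (e : A × ZMod 2 ≃ T)
    {y : V → ℕ → T} {v : V} (hb : (splitNoise e y).2 ∈ distinctLabels hG)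
    (h : ∃ n, (splitNoise e y).1 ∉
      ballDisagree hG f (randomSchedule hG (splitNoise e y).2) 0 n v) :
    spaceTimeRadius G (codingMap hG f e) v y ≠ ⊤ := by
  obtain ⟨n, hn⟩ := h
  have hk : ∀ᶠ k in atTop, (splitNoise e y).2 ∈ labelsSeparated hG v n k := by
    refine (eventually_all_finset _).2 fun i _ => (eventually_all_finset _).2 fun u _ =>
      (eventually_all_finset _).2 fun w _ => ?_
    by_cases huw : u = w
    · exact Eventually.of_forall fun k h => absurd huw h
    · obtain ⟨r, hr⟩ := hb i u w huw
      filter_upwards [eventually_gt_atTop r] with k hk _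
      exact ⟨r, hk, hr⟩
  obtain ⟨k, hk⟩ := hk.exists
  exact ne_top_of_le_ne_top (ENat.natCast_ne_top _)
    (spaceTimeRadius_le (determinedAt_codingMap hf e hn hk))

lemma topLimit_shift {Γ : Type*} [Group Γ] [MulAction Γ V] (haut : ActsByAutomorphisms Γ G)
    (hf : ∀ (γ : Γ) v a, ∀ σ ∈ upDownConfig V S, f (γ • v) a (translate γ σ) = f v a σ) (γ : Γ)
    {z : (V × ℕ → A) × (V × ℕ → ZMod 2)} (hb : z.2 ∈ distinctLabels hG) :
    topLimit hG f (shift γ z.1, shift γ z.2) = translate γ (topLimit hG f z) := by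
  funext v
  refine congrArg leastValue (funext fun n => ?_)
  have hball : ballFinset hG v n = translateFinset γ (ballFinset hG (γ⁻¹ • v) n) := by
    rw [translateFinset_ballFinset haut, smul_inv_smul]
  rw [topChain, hball, randomSchedule_path_shift haut γ hb]
  exact congrFun (run_shift hf γ z.1 _ fun l => run_mem top_mem_upDownConfig l) v

end Determination

/-- The law of the bits that determine the order of the updates. -/
abbrev bitLaw : PMF (ZMod 2) := PMF.uniformOfFintype (ZMod 2)

section Noise

variable {V A S T : Type*} {G : SimpleGraph V} {hG : IsLocallyFinite G} [MeasurableSpace A]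
  {q : PMF A}

lemma ae_distinctLabels [Countable V] (hsphere : SphereCondition G) :
    ∀ᵐ z ∂(noise (V × ℕ) q).prod (noise (V × ℕ) bitLaw), z.2 ∈ distinctLabels hG :=
  Measure.quasiMeasurePreserving_snd.ae (noise_distinctLabels_compl hsphere)

variable [Fintype A] [MeasurableSingletonClass A] [Finite T] [MeasurableSpace T]
  [MeasurableSingletonClass T]

lemma ae_splitNoise (e : A × ZMod 2 ≃ T) {p : (V × ℕ → A) × (V × ℕ → ZMod 2) → Prop}
    (h : ∀ᵐ z ∂(noise (V × ℕ) q).prod (noise (V × ℕ) bitLaw), p z) :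
    ∀ᵐ y ∂iidLaw V ((pairLaw q bitLaw).map e), p (splitNoise e y) := by
  rw [← map_splitNoise q bitLaw e] at h
  exact ae_of_ae_map (measurable_splitNoise e).aemeasurable h

lemma noise_labelsSeparated_compl_le (hsphere : SphereCondition G) {b : ℕ → ℕ}
    (hb : ∀ v r, (ballFinset hG v r).card ≤ b r) (v : V) (n k : ℕ) :
    noise (V × ℕ) bitLaw (labelsSeparated hG v n k)ᶜ ≤ n * (b n * (b n * (1 / 2) ^ k)) := by
  have hsub : (labelsSeparated hG v n k)ᶜ ⊆ ⋃ i ∈ Finset.range n, ⋃ u ∈ ballFinset hG v n,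
      ⋃ w ∈ ballFinset hG v n, {x | u ≠ w ∧ ∀ r < k, digit hG x i u r = digit hG x i w r} := by
    intro x hx
    change ¬ ∀ i ∈ Finset.range n, ∀ u ∈ ballFinset hG v n, ∀ w ∈ ballFinset hG v n, u ≠ w →
      ∃ r < k, digit hG x i u r ≠ digit hG x i w r at hx
    push Not at hx
    obtain ⟨i, hi, u, hu, w, hw, h⟩ := hx
    exact Set.mem_iUnion₂.2 ⟨i, hi, Set.mem_iUnion₂.2 ⟨u, hu, Set.mem_iUnion₂.2 ⟨w, hw, h⟩⟩⟩
  refine (measure_mono hsub).trans ((measure_biUnion_finset_le _ _).trans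
    ((Finset.sum_le_card_nsmul _ _ ((b n : ℝ≥0∞) * (b n * (1 / 2) ^ k)) fun i _ => ?_).trans ?_))
  · refine measure_biUnion_ball_le hb _ v n _ _ fun u _ => ?_
    refine measure_biUnion_ball_le hb _ v n _ _ fun w _ => ?_
    by_cases huw : u = w
    · simp [huw]
    · exact (measure_mono fun x hx => hx.2).trans (noise_tie_le (hG := hG) hsphere huw i k)
  · simp

variable [Countable V] [LinearOrder S] [BoundedOrder S] {f : V → A → (V → S) → S}

/-- The probability that a ball does not determine the spin at its centre. -/
lemma prod_ballDisagree_le {ν : Measure (V × ℕ → ZMod 2)} [IsProbabilityMeasure ν] (n : ℕ)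
    (v : V) : ((noise (V × ℕ) q).prod ν)
      {z | z.1 ∈ ballDisagree hG f (randomSchedule hG z.2) 0 n v} ≤ decay hG q f n := by
  have e : {z : (V × ℕ → A) × (V × ℕ → ZMod 2) |
      z.1 ∈ ballDisagree hG f (randomSchedule hG z.2) 0 n v} =
      ⋃ l : List (V × ℕ), {a | run f a l (⊤ : V → S) v ≠ run f a l (⊥ : V → S) v} ×ˢ
        {b | (randomSchedule hG b).path (ballFinset hG v n) 0 n = l} := by
    ext z
    simp only [Set.mem_iUnion, Set.mem_prod]
    constructor
    · exact fun h => ⟨_, h, rfl⟩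
    · rintro ⟨l, h, h'⟩
      change (randomSchedule hG z.2).path _ 0 n = l at h'
      subst h'
      exact h
  have hm : MeasurableSet {z : (V × ℕ → A) × (V × ℕ → ZMod 2) |
      z.1 ∈ ballDisagree hG f (randomSchedule hG z.2) 0 n v} := by
    rw [e]
    refine MeasurableSet.iUnion fun l => MeasurableSet.prod ?_ (measurableSet_path_eq _ 0 n l)
    refine EventOn.measurableSet (J := l.toFinset) fun a a' ha h => ?_
    change run f a' l (⊤ : V → S) v ≠ run f a' l (⊥ : V → S) v
    rw [← run_congr fun p hp => ha p (by simpa using hp),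
      ← run_congr fun p hp => ha p (by simpa using hp)]
    exact h
  rw [Measure.prod_apply_symm hm]
  refine (lintegral_mono fun b => noise_ballDisagree_le hG (randomSchedule hG b) 0 n v).trans ?_
  simp

lemma ae_exists_notMem_ballDisagree_of_tendsto
    (h : Tendsto (decay hG q f) atTop (𝓝 0)) (v : V) :
    ∀ᵐ z ∂(noise (V × ℕ) q).prod (noise (V × ℕ) bitLaw),
      ∃ n, z.1 ∉ ballDisagree hG f (randomSchedule hG z.2) 0 n v := by
  refine le_antisymm (ge_of_tendsto' h fun n => ?_) bot_le
  refine (measure_mono fun z hz => ?_).trans (prod_ballDisagree_le (ν := noise (V × ℕ) bitLaw) n v)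
  by_contra hn
  exact hz ⟨n, hn⟩

end Noise

section Coding

variable {V A S T Γ : Type*} [Countable V] {G : SimpleGraph V} {hG : IsLocallyFinite G}
  [LinearOrder S] [BoundedOrder S] [Fintype S] {f : V → A → (V → S) → S}
  [Fintype A] [MeasurableSpace A] [MeasurableSingletonClass A]
  [Finite T] [MeasurableSpace T] [MeasurableSingletonClass T]

variable {q : PMF A}

lemma isCoding_codingMap [Group Γ] [MulAction Γ V] [MeasurableSpace S]
    (haut : ActsByAutomorphisms Γ G) (hsphere : SphereCondition G) (hmon : MonotoneRule f)
    (hf : ∀ (γ : Γ) v a, ∀ σ ∈ upDownConfig V S, f (γ • v) a (translate γ σ) = f v a σ)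
    (e : A × ZMod 2 ≃ T) :
    IsCoding Γ (iidLaw V ((pairLaw q bitLaw).map e))
      (((noise (V × ℕ) q).prod (noise (V × ℕ) bitLaw)).map (topLimit hG f))
      (codingMap hG f e) where
  measurable := (measurable_config fun v s => measurableSet_topLimit hmon v s).comp
    (measurable_splitNoise e)
  map_eq := by
    rw [← map_splitNoise q bitLaw e, Measure.map_map
      (measurable_config fun v s => measurableSet_topLimit hmon v s) (measurable_splitNoise e)]
    rfl
  equivariant := by
    refine ⟨{y | (splitNoise e y).2 ∈ distinctLabels hG}, ?_,
      ae_splitNoise (q := q) e (p := fun z => z.2 ∈ distinctLabels hG) (ae_distinctLabels hsphere),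
      ?_, ?_⟩
    · exact (measurable_snd.comp (measurable_splitNoise e)) measurableSet_distinctLabels
    · exact fun γ y hy => shift_mem_distinctLabels haut γ hy
    · exact fun γ y hy => topLimit_shift haut hf γ (z := splitNoise e y) hy

lemma spaceTimeFinitary_codingMap (hsphere : SphereCondition G) (hf : MonotoneRule f)
    (e : A × ZMod 2 ≃ T)
    (h : ∀ v, ∀ᵐ z ∂(noise (V × ℕ) q).prod (noise (V × ℕ) bitLaw),
      ∃ n, z.1 ∉ ballDisagree hG f (randomSchedule hG z.2) 0 n v) :
    SpaceTimeFinitary G (iidLaw V ((pairLaw q bitLaw).map e)) (codingMap hG f e) := by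
  intro v
  filter_upwards [ae_splitNoise e (h v), ae_splitNoise (q := q) e
    (p := fun z => z.2 ∈ distinctLabels hG) (ae_distinctLabels hsphere)] with y h1 h2
  exact spaceTimeRadius_codingMap_ne_top hf e h2 h1

/-- If the two limits have the same law, then they coincide, and they are reached in finite
space-time balls. -/
lemma ae_exists_notMem_ballDisagree_of_map_eq [MeasurableSpace S] [MeasurableSingletonClass S]
    (hf : MonotoneRule f) {P : Measure ((V × ℕ → A) × (V × ℕ → ZMod 2))} [IsProbabilityMeasure P]
    (h : P.map (topLimit hG f) = P.map (botLimit hG f)) (v : V) :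
    ∀ᵐ z ∂P, ∃ n, z.1 ∉ ballDisagree hG f (randomSchedule hG z.2) 0 n v := by
  have hs : ∀ s, P {z | botLimit hG f z v = s} = P {z | topLimit hG f z v = s} := by
    intro s
    have hE : MeasurableSet {σ : V → S | σ v = s} :=
      (measurable_pi_apply v : Measurable fun σ : V → S => σ v) (measurableSet_singleton s)
    have h1 := congrArg (fun μ => μ {σ : V → S | σ v = s}) h
    rw [Measure.map_apply (measurable_config fun v s => measurableSet_topLimit hf v s) hE,
      Measure.map_apply (measurable_config fun v s => measurableSet_botLimit hf v s) hE] at h1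
    exact h1.symm
  filter_upwards [ae_eq_of_le_of_map_eq P (fun s => measurableSet_botLimit (hG := hG) hf v s)
    (fun s => measurableSet_topLimit hf v s) (fun z => botLimit_le_topLimit hf z v) hs] with z hz
  obtain ⟨N, hN⟩ := exists_topChain_eq_topLimit (hG := hG) hf z v
  obtain ⟨M, hM⟩ := exists_botChain_eq_botLimit (hG := hG) hf z v
  refine ⟨max N M, not_not.2 ?_⟩
  exact (hN _ (le_max_left N M)).trans (hz.symm.trans (hM _ (le_max_right N M)).symm)

/-- The tail of the space-time radius. -/
lemma iidLaw_radius_le (hsphere : SphereCondition G) (hf : MonotoneRule f) (e : A × ZMod 2 ≃ T)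
    {b : ℕ → ℕ} (hb : ∀ v r, (ballFinset hG v r).card ≤ b r) (v : V) {n k r : ℕ}
    (hr : n + k < r) :
    iidLaw V ((pairLaw q bitLaw).map e) {y | (r : ℕ∞) ≤ spaceTimeRadius G (codingMap hG f e) v y} ≤
      decay hG q f n + n * (b n * (b n * (1 / 2) ^ k)) := by
  set B : Set ((V × ℕ → A) × (V × ℕ → ZMod 2)) :=
    {z | z.1 ∈ ballDisagree hG f (randomSchedule hG z.2) 0 n v} ∪
      Set.univ ×ˢ (labelsSeparated hG v n k)ᶜ
  have hsub : {y | (r : ℕ∞) ≤ spaceTimeRadius G (codingMap hG f e) v y} ⊆ splitNoise e ⁻¹' B := by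
    intro y hy
    by_contra hB
    rw [Set.mem_preimage, Set.mem_union, not_or, Set.mem_prod] at hB
    simp only [Set.mem_univ, true_and, Set.mem_compl_iff, not_not] at hB
    have h1 := (show (r : ℕ∞) ≤ _ from hy).trans
      (spaceTimeRadius_le (determinedAt_codingMap hf e hB.1 hB.2))
    have h2 : r ≤ n + k := by exact_mod_cast h1
    omega
  refine (measure_mono hsub).trans ((Measure.le_map_apply
    (measurable_splitNoise e).aemeasurable B).trans ?_)
  rw [map_splitNoise]
  refine (measure_union_le _ _).trans (add_le_add (prod_ballDisagree_le n v) ?_)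
  rw [Measure.prod_prod, measure_univ, one_mul]
  exact noise_labelsSeparated_compl_le hsphere hb v n k

end Coding

/-! ### Tails of the space-time radius -/

section Tails

lemma exists_tendsto_diagonal {Q : ℕ → ℕ → Prop} (h : ∀ k, ∀ᶠ r in atTop, Q k r) :
    ∃ K : ℕ → ℕ, Tendsto K atTop atTop ∧ ∀ᶠ r in atTop, Q (K r) r := by
  refine ⟨fun r => Nat.findGreatest (fun k => Q k r) r, tendsto_atTop.2 fun k => ?_, ?_⟩
  · filter_upwards [h k, eventually_ge_atTop k] with r hr hk
    exact Nat.le_findGreatest hk hr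
  · filter_upwards [h 0] with r hr
    exact Nat.findGreatest_spec (P := fun k => Q k r) (Nat.zero_le r) hr

variable {b : ℕ → ℕ}

/-- On graphs of subexponential growth, ties between the labels in a ball are exponentially
unlikely. -/
lemma eventually_tie_bound_le (hb1 : ∀ r, 1 ≤ b r)
    (hgrowth : (fun r : ℕ => Real.log (b r)) =o[atTop] (fun r : ℕ => (r : ℝ))) :
    ∀ᶠ n : ℕ in atTop, (n * (b n * (b n * (1 / 2) ^ n)) : ℝ≥0∞) ≤
      ENNReal.ofReal (8 * Real.exp (-(n : ℝ) / 4)) := by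
  filter_upwards [hgrowth.bound (show (0 : ℝ) < 1 / 16 by norm_num)] with n hn
  have hhalf : (1 / 2 : ℝ≥0∞) = ENNReal.ofReal (1 / 2) := by
    rw [ENNReal.ofReal_div_of_pos two_pos]; simp
  rw [hhalf, ← ENNReal.ofReal_pow (by norm_num), ← ENNReal.ofReal_natCast,
    ← ENNReal.ofReal_natCast, ← ENNReal.ofReal_mul (by positivity),
    ← ENNReal.ofReal_mul (by positivity), ← ENNReal.ofReal_mul (by positivity)]
  refine ENNReal.ofReal_le_ofReal ?_
  have hb0 : (0 : ℝ) < b n := by exact_mod_cast hb1 n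
  have h1 : (b n : ℝ) ≤ Real.exp (n / 16) := by
    rw [← Real.log_le_iff_le_exp hb0]
    refine (le_abs_self _).trans (hn.trans_eq ?_)
    rw [Real.norm_of_nonneg (Nat.cast_nonneg n)]
    ring
  have h2 : (n : ℝ) ≤ 8 * Real.exp (n / 8) := by
    have := Real.add_one_le_exp ((n : ℝ) / 8)
    linarith
  have h3 : ((1 / 2 : ℝ)) ^ n ≤ Real.exp (-(n : ℝ) / 2) := by
    have h4 : (1 / 2 : ℝ) ≤ Real.exp (-(1 / 2)) := by
      have := Real.add_one_le_exp (-(1 / 2) : ℝ)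
      linarith
    calc (1 / 2 : ℝ) ^ n ≤ Real.exp (-(1 / 2)) ^ n := pow_le_pow_left₀ (by norm_num) h4 n
      _ = Real.exp (-(n : ℝ) / 2) := by rw [← Real.exp_nat_mul]; congr 1; ring
  calc (n : ℝ) * (b n * (b n * (1 / 2) ^ n))
      ≤ 8 * Real.exp (n / 8) * (Real.exp (n / 16) * (Real.exp (n / 16) *
        Real.exp (-(n : ℝ) / 2))) := by gcongr
    _ = 8 * Real.exp (-(n : ℝ) / 4) := by
        rw [← Real.exp_add, ← Real.exp_add, mul_assoc, ← Real.exp_add]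
        congr 2; ring

lemma quarter_le_half_pred {r : ℕ} (hr : 4 ≤ r) : (r : ℝ) / 4 ≤ ((r - 1) / 2 : ℕ) := by
  have h : r ≤ 4 * ((r - 1) / 2) := by omega
  have h' : (r : ℝ) ≤ 4 * (((r - 1) / 2 : ℕ) : ℝ) := by exact_mod_cast h
  linarith

lemma tendsto_half_pred : Tendsto (fun r : ℕ => (r - 1) / 2) atTop atTop :=
  tendsto_atTop.2 fun n => by
    filter_upwards [eventually_ge_atTop (2 * n + 1)] with r hr
    omega

variable {V : Type*} {p : ℕ → V → ℝ≥0∞} {D : ℕ → ℝ≥0∞}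

lemma exists_exp_tail (hb1 : ∀ r, 1 ≤ b r)
    (hgrowth : (fun r : ℕ => Real.log (b r)) =o[atTop] (fun r : ℕ => (r : ℝ)))
    (hp1 : ∀ r v, p r v ≤ 1)
    (hp : ∀ n k r v, n + k < r → p r v ≤ D n + n * (b n * (b n * (1 / 2) ^ k)))
    (hD : ∃ C l : ℝ, 0 < C ∧ 0 < l ∧ ∀ n : ℕ, D n ≤ ENNReal.ofReal (C * Real.exp (-l * n))) :
    ∃ C c : ℝ, 0 < C ∧ 0 < c ∧ ∀ r v, p r v ≤ ENNReal.ofReal (C * Real.exp (-c * r)) := by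
  obtain ⟨C, l, hC, hl, hD⟩ := hD
  have hev : ∀ᶠ r : ℕ in atTop, ∀ v, p r v ≤
      ENNReal.ofReal ((C + 8) * Real.exp (-(min l (1 / 4) / 4) * r)) := by
    filter_upwards [tendsto_half_pred.eventually (eventually_tie_bound_le hb1 hgrowth),
      eventually_ge_atTop 4] with r hr hr4 v
    set n := (r - 1) / 2
    refine (hp n n r v (by omega)).trans ((add_le_add (hD n) hr).trans ?_)
    rw [← ENNReal.ofReal_add (by positivity) (by positivity), add_mul]
    have hq : (r : ℝ) / 4 ≤ n := quarter_le_half_pred hr4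
    have hn0 : (0 : ℝ) ≤ n := Nat.cast_nonneg n
    have hm : 0 < min l (1 / 4) := lt_min hl (by norm_num)
    have key : min l (1 / 4) / 4 * r ≤ min l (1 / 4) * n := by nlinarith
    have h1 : min l (1 / 4) * n ≤ l * n := mul_le_mul_of_nonneg_right (min_le_left _ _) hn0
    have h2 : min l (1 / 4) * n ≤ 1 / 4 * n := mul_le_mul_of_nonneg_right (min_le_right _ _) hn0
    refine ENNReal.ofReal_le_ofReal (add_le_add ?_ ?_)
    · exact mul_le_mul_of_nonneg_left (Real.exp_le_exp.2 (by linarith)) hC.le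
    · exact mul_le_mul_of_nonneg_left (Real.exp_le_exp.2 (by linarith)) (by norm_num)
  obtain ⟨N, hN⟩ := eventually_atTop.1 hev
  set c := min l (1 / 4) / 4
  have hc : 0 < c := div_pos (lt_min hl (by norm_num)) (by norm_num)
  refine ⟨C + 8 + Real.exp (c * N), c, by positivity, hc, fun r v => ?_⟩
  rcases le_or_gt N r with h | h
  · refine (hN r h v).trans (ENNReal.ofReal_le_ofReal ?_)
    exact mul_le_mul_of_nonneg_right (by linarith [Real.exp_pos (c * N)]) (Real.exp_pos _).le
  · refine (hp1 r v).trans ?_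
    rw [← ENNReal.ofReal_one]
    refine ENNReal.ofReal_le_ofReal ?_
    have hr : (r : ℝ) ≤ N := by exact_mod_cast h.le
    have h1 : 1 ≤ Real.exp (c * N) * Real.exp (-c * r) := by
      rw [← Real.exp_add]
      exact Real.one_le_exp (by nlinarith)
    have h2 : 0 < Real.exp (-c * r) := Real.exp_pos _
    nlinarith

lemma exists_stretched_tail (hb1 : ∀ r, 1 ≤ b r)
    (hgrowth : (fun r : ℕ => Real.log (b r)) =o[atTop] (fun r : ℕ => (r : ℝ)))
    (hp : ∀ n k r v, n + k < r → p r v ≤ D n + n * (b n * (b n * (1 / 2) ^ k)))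
    (hD : ∀ ε : ℝ, 0 < ε → ε < 1 →
      ∀ᶠ n : ℕ in atTop, D n ≤ ENNReal.ofReal (Real.exp (-(n : ℝ) ^ (1 - ε)))) :
    ∃ ε : ℕ → ℝ, Tendsto ε atTop (𝓝 0) ∧ ∀ᶠ r : ℕ in atTop, ∀ v,
      p r v ≤ ENNReal.ofReal (Real.exp (-((r : ℝ) ^ (1 - ε r)))) := by
  have hev : ∀ δ : ℝ, 0 < δ → 2 * δ < 1 → ∀ᶠ r : ℕ in atTop, ∀ v,
      p r v ≤ ENNReal.ofReal (Real.exp (-((r : ℝ) ^ (1 - 2 * δ)))) := by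
    intro δ hδ hδ1
    have hlarge : ∀ᶠ r : ℕ in atTop, (64 : ℝ) ≤ (r : ℝ) ^ δ :=
      ((tendsto_rpow_atTop hδ).comp tendsto_natCast_atTop_atTop).eventually_ge_atTop 64
    filter_upwards [tendsto_half_pred.eventually (eventually_tie_bound_le hb1 hgrowth),
      tendsto_half_pred.eventually (hD δ hδ (by linarith)), eventually_ge_atTop 4,
      hlarge] with r hr hDr hr4 hr64 v
    set n := (r - 1) / 2
    refine (hp n n r v (by omega)).trans ((add_le_add hDr hr).trans ?_)
    rw [← ENNReal.ofReal_add (by positivity) (by positivity)]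
    refine ENNReal.ofReal_le_ofReal ?_
    have hq : (r : ℝ) / 4 ≤ n := quarter_le_half_pred hr4
    have hr0 : (1 : ℝ) ≤ r := by exact_mod_cast (by omega : 1 ≤ r)
    set x := (r : ℝ) ^ (1 - 2 * δ)
    have hx1 : 1 ≤ x := Real.one_le_rpow hr0 (by linarith)
    have hsplit : (r : ℝ) ^ (1 - δ) = x * (r : ℝ) ^ δ := by
      rw [← Real.rpow_add (by linarith)]; congr 1; ring
    have h1 : (r : ℝ) ^ (1 - δ) / 4 ≤ (n : ℝ) ^ (1 - δ) := by
      refine le_trans ?_ (Real.rpow_le_rpow (by positivity) hq (by linarith))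
      rw [Real.div_rpow (by linarith) (by norm_num)]
      gcongr
      exact Real.rpow_le_self_of_one_le (by norm_num) (by linarith)
    have h2 : (r : ℝ) ^ (1 - δ) / 16 ≤ (n : ℝ) / 4 := by
      have := Real.rpow_le_self_of_one_le hr0 (by linarith : 1 - δ ≤ 1)
      linarith
    have h3 : x + 3 ≤ (r : ℝ) ^ (1 - δ) / 16 := by
      rw [hsplit]
      nlinarith
    have hexp : 9 ≤ Real.exp 3 := by
      have h4 : (2 : ℝ) + 1 / 4 ≤ Real.exp 1 := by linarith [Real.exp_one_gt_d9]
      have h5 : Real.exp 3 = Real.exp 1 ^ 3 := by rw [← Real.exp_nat_mul]; norm_num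
      rw [h5]
      nlinarith [sq_nonneg (Real.exp 1)]
    have h6 : Real.exp (-(n : ℝ) ^ (1 - δ)) ≤ Real.exp (-x - 3) :=
      Real.exp_le_exp.2 (by linarith)
    have h7 : Real.exp (-(n : ℝ) / 4) ≤ Real.exp (-x - 3) := Real.exp_le_exp.2 (by linarith)
    have h8 : Real.exp (-x - 3) * Real.exp 3 = Real.exp (-x) := by
      rw [← Real.exp_add]; congr 1; ring
    nlinarith [Real.exp_pos (-x - 3)]
  obtain ⟨K, hK, hKr⟩ := exists_tendsto_diagonal (Q := fun k r => ∀ v, p r v ≤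
    ENNReal.ofReal (Real.exp (-((r : ℝ) ^ (1 - 2 * (1 / ((k : ℝ) + 3))))))) fun k => by
      refine hev _ (by positivity) ?_
      have hk : (0 : ℝ) ≤ k := Nat.cast_nonneg k
      rw [mul_one_div, div_lt_one (by linarith)]
      linarith
  refine ⟨fun r => 2 * (1 / ((K r : ℝ) + 3)), ?_, hKr⟩
  have h1 : Tendsto (fun r => ((K r : ℝ) + 3)) atTop atTop :=
    tendsto_atTop_add_const_right _ _ (tendsto_natCast_atTop_atTop.comp hK)
  simpa using (tendsto_inv_atTop_zero.comp h1).const_mul 2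

lemma isLittleO_of_isLittleO_div_log {h : ℕ → ℝ}
    (hh : h =o[atTop] (fun r : ℕ => (r : ℝ) / Real.log r)) :
    h =o[atTop] (fun r : ℕ => (r : ℝ)) := by
  refine hh.trans_isBigO (IsBigO.of_bound 1 ?_)
  filter_upwards [(Real.tendsto_log_atTop.comp tendsto_natCast_atTop_atTop).eventually_ge_atTop 1]
    with r hr
  have hr' : 1 ≤ Real.log r := hr
  rw [norm_div, one_mul, Real.norm_of_nonneg (zero_le_one.trans hr')]
  exact div_le_self (norm_nonneg _) hr'

end Tails

instance {V T : Type*} [MeasurableSpace T] (p : PMF T) : IsProbabilityMeasure (iidLaw V p) := by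
  unfold iidLaw; infer_instance

end

end SpaceTimeCoding

open SpaceTimeCoding in
theorem theorem2p2 {V Γ S : Type*} [Countable V] [Infinite V] [Group Γ] [MulAction Γ V]
    (G : SimpleGraph V) (hconn : G.Connected) (hlf : IsLocallyFinite G)
    (haut : ActsByAutomorphisms Γ G) (hqt : QuasiTransitive Γ V)
    (hsphere : SphereCondition G)
    [LinearOrder S] [BoundedOrder S] [Fintype S]
    [TopologicalSpace S] [DiscreteTopology S] [MeasurableSpace S] [DiscreteMeasurableSpace S]
    (ρ : UpDownSpec V S) (hmono : ρ.Monotonic) (hinv : ρ.Invariant Γ)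
    (hirr : ρ.Irreducible) (hfin : ρ.MarginallyFinite) :
    -- the weak limits exist
    ∃ μp μm : ProbabilityMeasure (V → S),
      Tendsto (fun Λ : Finset V => ρ.toProb Λ ⊤) atTop (𝓝 μp) ∧
      Tendsto (fun Λ : Finset V => ρ.toProb Λ ⊥) atTop (𝓝 μm) ∧
      (μp = μm →
        ∃ (k : ℕ) (p : PMF (Fin k)) (φ : (V → ℕ → Fin k) → (V → S)),
          IsCoding Γ (iidLaw V p) (μp : Measure (V → S)) φ ∧
          SpaceTimeFinitary G (iidLaw V p) φ) ∧
      (ρ.WeakSpatialMixing hlf →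
        ∃ (k : ℕ) (p : PMF (Fin k)) (φ : (V → ℕ → Fin k) → (V → S)),
          IsCoding Γ (iidLaw V p) (μp : Measure (V → S)) φ ∧
          SpaceTimeFinitary G (iidLaw V p) φ ∧
          ((fun r : ℕ => Real.log (growth G r)) =o[atTop] (fun r : ℕ => (r : ℝ)) →
            TailBeatsStretchedExp G (iidLaw V p) φ) ∧
          ((fun r : ℕ => Real.log (growth G r)) =o[atTop]
              (fun r : ℕ => (r : ℝ) / Real.log r) →
            ExponentialTail G (iidLaw V p) φ)) := by
  have : Nonempty V := inferInstance
  have hM : (siteLaws ρ).Finite := hfin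
  obtain ⟨q, hq⟩ := exists_law_selection hM
  have := hM.to_subtype
  let : MeasurableSpace (MonotoneSelection (siteLaws ρ)) := ⊤
  have : DiscreteMeasurableSpace (MonotoneSelection (siteLaws ρ)) := ⟨fun _ => trivial⟩
  let : Fintype (MonotoneSelection (siteLaws ρ)) := Fintype.ofFinite _
  have H := heatBath_selectionRule hmono hq
  have hf := fun (γ : Γ) v a σ hσ => selectionRule_translate hinv γ v a (σ := σ) hσ
  let e : MonotoneSelection (siteLaws ρ) × ZMod 2 ≃ Fin _ := Fintype.equivFin _
  let f := selectionRule ρ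
  let P := (noise (V × ℕ) q).prod (noise (V × ℕ) bitLaw)
  have hmp : Measurable (topLimit hlf f) :=
    measurable_config fun v s => measurableSet_topLimit H.mono v s
  have hmm : Measurable (botLimit hlf f) :=
    measurable_config fun v s => measurableSet_botLimit H.mono v s
  have hcoding := isCoding_codingMap (hG := hlf) (q := q) haut hsphere H.mono hf e
  refine ⟨⟨P.map (topLimit hlf f), Measure.isProbabilityMeasure_map hmp.aemeasurable⟩,
    ⟨P.map (botLimit hlf f), Measure.isProbabilityMeasure_map hmm.aemeasurable⟩,
    tendsto_toProb_top hconn H hirr rfl, tendsto_toProb_bot hconn H hirr rfl,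
    fun heq => ?_, fun hW => ?_⟩
  · exact ⟨_, (pairLaw q bitLaw).map e, codingMap hlf f e, hcoding,
      spaceTimeFinitary_codingMap hsphere H.mono e fun v =>
        ae_exists_notMem_ballDisagree_of_map_eq H.mono (congrArg Subtype.val heq) v⟩
  · have hb := card_ballFinset_le_growth hlf haut hqt
    have hb1 := one_le_growth hlf haut hqt
    have hp := fun n k r v (h : n + k < r) =>
      iidLaw_radius_le (q := q) hsphere H.mono e hb v h
    exact ⟨_, (pairLaw q bitLaw).map e, codingMap hlf f e, hcoding,
      spaceTimeFinitary_codingMap hsphere H.mono e fun v =>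
        ae_exists_notMem_ballDisagree_of_tendsto (tendsto_decay_of_mixing H hirr hb hW) v,
      fun hgrowth => exists_stretched_tail hb1 hgrowth hp fun ε hε hε1 =>
        stretched_decay_of_mixing H hmono hirr hb hb1 hW hgrowth hε hε1,
      fun hgrowth => exists_exp_tail hb1 (isLittleO_of_isLittleO_div_log hgrowth)
        (fun r v => prob_le_one) hp (exp_decay_of_mixing H hmono hirr hb hb1 hW hgrowth)⟩
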